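/- Let $F>0$, $T>0$, $D\in\mathbb R$ and $\zeta\in(-1,1)$. The \emph{Gaussian clock} $C_\zeta=\{\rho,\Pi,\Phi_\zeta\}$ consists of the pure states $\rho(\varphi)=|\psi_\varphi\rangle\langle\psi_\varphi|$ on $L^2(\mathbb R)$, $\psi_\varphi(x)=\frac{F^{1/4}}{(2\pi)^{1/4}}\exp\left(-\frac F4(x-\varphi)^2\right)$, of the position measurement $\Pi$ (so $\Pi(A)$ is multiplication by $1_A$), and of the estimator $\Phi_\zeta(\alpha)=(1-\zeta)\alpha$. A \emph{state} of the clock with synchronization period $T$ and local oscillator noise $K_t\varphi=\varphi+DW_t$ ($W$ a standard Brownian motion) is a real process $y(t)$, $t\ge0$, with the following properties. Write $y_n=y(nT)$ and $\bar y_n=\frac1T\int_0^Ty(nT+s)\,ds$. For each $n\ge 0$ there are a standard Brownian motion $W^{(n)}$, which on $[0,T]$ is independent of the initial error $y_0$ and of the noises (on $[0,T]$) and the outcomes of all earlier periods, and a measurement outcome $\alpha_n$, which, conditionally on all of these and on $W^{(n)}$ on $[0,T]$, lies in $A$ with probability $\mathrm{tr}(\rho(\bar y_n)\Pi(A))$,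 such that almost surely $$y(nT+t)=y_n+DW^{(n)}_t\quad(0\le t<T),\qquad y_{n+1}=y_n+DW^{(n)}_T-\Phi_\zeta(\alpha_n).$$ It is a \emph{Gaussian stationary state} if $(y_n)_{n\ge0}$ is a stationary Gaussian process. The clock time $t_{clock}$ is given by $t_{clock}-t=\int_0^ty(s)\,ds$. Put $\sigma^2_{LO}(T)=\mathbb E[(\bar y_n-y_n)^2]$, and let $F_T(\varphi)$ be the quantum Fisher information $\mathrm{tr}(\rho(\varphi)X^2)$, where $X$ is Hermitian with $\frac12\{X,\rho(\varphi)\}=\rho'(\varphi)$. Then the estimation strategy is $\zeta$-biased (given the parameter $\varphi$, the estimate $\Phi_\zeta(\alpha)$ has mean $(1-\zeta)\varphi$), $F_T(\varphi)=F$ for all $\varphi$, and a Gaussian stationary state exists. For every Gaussian stationary state and every $n$, $\sigma^2_{LO}(T)=D^2T/3$, $\mathbb E[y_n]=0$, and the variance of $y_n$ is $$\sigma^2=\frac{1-\zeta}{1+\zeta}\,\frac1F+\sigma^2_{LO}(T)\,\frac{1+\zeta+\zeta^2}{1-\zeta^2};$$ the clock time satisfies $$\lim_{t\to\infty}\frac{\mathbb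 E[(t_{clock}-t)^2]}{t}=T\,\frac1F+T\sigma^2_{LO}(T)\,\frac{3}{(1-\zeta)^2}.$$ These values saturate the general lower bounds for stationary states of $\zeta$-unbiased clocks: the relations $$\frac1T\int_0^T\mathbb E[(y(nT+s)-y_n)^2]\,ds=\sigma^2_{LO}(T)\,\frac{a+2}2,\qquad \mathbb E[(y_n+DW^{(n)}_T-y_n)^2]=b\,\sigma^2_{LO}(T)$$ hold with $a=1$, $b=3$, and for all real $a,b$ satisfying them $$\mathbb E[y_n^2]=\mathbb E\left[\frac1{F_T(\bar y_n)}\right]\frac{1-\zeta}{1+\zeta}+\sigma^2_{LO}(T)\,\frac{\zeta^2+a\zeta+b-1-a}{1-\zeta^2},$$ $$\lim_{t\to\infty}\frac{\mathbb E[(t_{clock}-t)^2]}{t}=T\,\mathbb E\left[\frac1{F_T(\bar y_n)}\right]+T\sigma^2_{LO}(T)\,\frac{b}{(1-\zeta)^2}.$$ -/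

import Mathlib

open MeasureTheory ProbabilityTheory Filter Topology
open scoped NNReal ENNReal InnerProductSpace

namespace AtomicClock

noncomputable section

/-! ### Quantum estimation -/

section Quantum

variable {H : Type*} [NormedAddCommGroup H] [InnerProductSpace ℂ H] [CompleteSpace H]

/-- The trace of a (trace class) operator, computed in an orthonormal basis of `H`. For a trace
class operator the value does not depend on the basis. -/
def opTrace (A : H →L[ℂ] H) : ℂ :=
  ∑' i, ⟪(exists_hilbertBasis ℂ H).choose_spec.choose i,
    A ((exists_hilbertBasis ℂ H).choose_spec.choose i)⟫_ℂ

/-- A density operator: a positive operator of unit trace. -/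
structure IsDensityOperator (ρ : H →L[ℂ] H) : Prop where
  isPositive : ρ.IsPositive
  trace_eq_one : opTrace ρ = 1

/-- `f` is the quantum Fisher information at `φ` of the family of states `ρ`: it equals
`tr (ρ(φ) X²)` where the Hermitian operator `X` solves `½ {X, ρ(φ)} = ρ'(φ)`. -/
def IsQuantumFisherInformation (ρ : ℝ → H →L[ℂ] H) (φ f : ℝ) : Prop :=
  ∃ X ρ' : H →L[ℂ] H, IsSelfAdjoint X ∧ HasDerivAt ρ ρ' φ ∧
    (1 / 2 : ℂ) • (X ∘L ρ φ + ρ φ ∘L X) = ρ' ∧ opTrace (ρ φ ∘L X ∘L X) = (f : ℂ)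

open Classical in
/-- The quantum Fisher information `F(φ)` of the family of states `ρ` (and `0` if there is none). -/
def quantumFisherInformation (ρ : ℝ → H →L[ℂ] H) (φ : ℝ) : ℝ :=
  if h : ∃ f, IsQuantumFisherInformation ρ φ f then h.choose else 0

variable (H) in
/-- A positive operator valued measure on the space `M` of outcomes. -/
structure POVM (M : Type*) [MeasurableSpace M] where
  effect : Set M → H →L[ℂ] H
  isPositive : ∀ A, MeasurableSet A → (effect A).IsPositive
  effect_univ : effect Set.univ = 1
  hasSum_effect : ∀ A : ℕ → Set M, (∀ i, MeasurableSet (A i)) → Pairwise (Function.onFun Disjoint A) →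
    ∀ v : H, HasSum (fun i => ⟪v, effect (A i) v⟫_ℂ) ⟪v, effect (⋃ i, A i) v⟫_ℂ

variable (H) in
/-- An atomic clock `{ρ(φ), Π(α), Φ}`: a family of states (at the end of the interrogation),
a measurement and an estimator. -/
structure Clock (M : Type*) [MeasurableSpace M] where
  state : ℝ → H →L[ℂ] H
  isDensityOperator : ∀ φ, IsDensityOperator (state φ)
  measurement : POVM H M
  estimator : M → ℝ
  measurable_estimator : Measurable estimator

variable {M : Type*} [MeasurableSpace M]

/-- Born's rule: the probability `tr (ρ(φ) Π(A))` that the outcome of the measurement on the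
state `ρ(φ)` belongs to `A`. -/
def Clock.outcomeProb (C : Clock H M) (φ : ℝ) (A : Set M) : ℝ :=
  (opTrace (C.state φ ∘L C.measurement.effect A)).re

/-- The estimation strategy is `ζ`-biased: for each value `φ` of the parameter, the estimate has
mean `(1 - ζ) φ` with respect to the distribution `ν` of the outcome. -/
def Clock.IsBiased (C : Clock H M) (ζ : ℝ) : Prop :=
  ∀ φ : ℝ, ∃ ν : Measure M, IsProbabilityMeasure ν ∧
    (∀ A, MeasurableSet A → ν.real A = C.outcomeProb φ A) ∧
    Integrable C.estimator ν ∧ ∫ a, C.estimator a ∂ν = (1 - ζ) * φ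

end Quantum

/-! ### The clock process -/

section ClockProcess

variable {Ω : Type*} [MeasurableSpace Ω] {M : Type*} [MeasurableSpace M]

/-- A discrete process is stationary: the joint law of `X_{n₁ + h}, …, X_{nⱼ + h}` does not
depend on `h`. -/
def IsStationaryProcess (X : ℕ → Ω → ℝ) (P : Measure Ω) : Prop :=
  ∀ (j : ℕ) (n : Fin j → ℕ) (h : ℕ),
    IdentDistrib (fun ω i => X (n i + h) ω) (fun ω i => X (n i) ω) P P

/-- `y_n = y(nT)`, the frequency error just after the `n`-th synchronization. -/
def syncError (T : ℝ) (y : ℝ → Ω → ℝ) (n : ℕ) (ω : Ω) : ℝ := y (n * T) ω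

/-- `ȳ_n`, the average of `y` over the `n`-th period. -/
def avgError (T : ℝ) (y : ℝ → Ω → ℝ) (n : ℕ) (ω : Ω) : ℝ :=
  (1 / T) * ∫ s in (0 : ℝ)..T, y (n * T + s) ω

/-- `t_clock - t = ∫₀ᵗ y(s) ds`. -/
def clockTimeError (y : ℝ → Ω → ℝ) (t : ℝ) (ω : Ω) : ℝ := ∫ s in (0 : ℝ)..t, y s ω

/-- The simplified Allan variance of the local oscillator, `σ²_LO(T) = E[(ȳ_n - y_n)²]`. -/
def loVariance (P : Measure Ω) (T : ℝ) (y : ℝ → Ω → ℝ) (n : ℕ) : ℝ :=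
  ∫ ω, (avgError T y n ω - syncError T y n ω) ^ 2 ∂P

/-- The sigma-algebra generated by the noise `W` during the `n`-th period. -/
@[reducible] def noiseSigma (T : ℝ) (W : ℕ → ℝ≥0 → Ω → ℝ) (n : ℕ) : MeasurableSpace Ω :=
  ⨆ (t : ℝ≥0) (_ : (t : ℝ) ≤ T), MeasurableSpace.comap (W n t) inferInstance

/-- The sigma-algebra of the events up to the `n`-th synchronization: it is generated by the
initial error and by the noise and the measurement outcomes of the earlier periods. -/
@[reducible] def pastSigma (T : ℝ) (y₀ : Ω → ℝ) (W : ℕ → ℝ≥0 → Ω → ℝ) (α : ℕ → Ω → M) (n : ℕ) :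
    MeasurableSpace Ω :=
  MeasurableSpace.comap y₀ inferInstance ⊔
    ⨆ (k : ℕ) (_ : k < n), (noiseSigma T W k ⊔ MeasurableSpace.comap (α k) inferInstance)

variable {H : Type*} [NormedAddCommGroup H] [InnerProductSpace ℂ H] [CompleteSpace H]

/-- `y(t)`, `t ≥ 0` (the values at negative times play no role), is a state of the clock `C` with
synchronization period `T` and local oscillator noise `K_t φ = φ + D W_t`. In the `n`-th period the
noise is driven by the Brownian motion `W n`, and `α n` is the outcome of the measurement at the end
of that period, performed on the state `ρ(ȳ_n)`. -/
structure IsClockState (C : Clock H M) (T D : ℝ) (P : Measure Ω) (y : ℝ → Ω → ℝ)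
    (W : ℕ → ℝ≥0 → Ω → ℝ) (α : ℕ → Ω → M) : Prop where
  measurable_init : Measurable (y 0)
  measurable_noise : ∀ n t, Measurable (W n t)
  measurable_outcome : ∀ n, Measurable (α n)
  isBrownian : ∀ n, IsBrownianReal (W n) P
  indep_noise : ∀ n, Indep (pastSigma T (y 0) W α n) (noiseSigma T W n) P
  evolution : ∀ᵐ ω ∂P, ∀ (n : ℕ) (t : ℝ≥0), (t : ℝ) < T →
    y (n * T + t) ω = y (n * T) ω + D * W n t ω
  adjustment : ∀ᵐ ω ∂P, ∀ n : ℕ,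
    y ((n + 1 : ℕ) * T) ω = y (n * T) ω + D * W n T.toNNReal ω - C.estimator (α n ω)
  outcome_law : ∀ (n : ℕ) (A : Set M), MeasurableSet A →
    P⟦α n ⁻¹' A | pastSigma T (y 0) W α n ⊔ noiseSigma T W n⟧
      =ᵐ[P] fun ω => C.outcomeProb (avgError T y n ω) A

/-- A Gaussian stationary state of a clock: `y_n` is a stationary Gaussian process. -/
structure IsGaussianStationaryState (C : Clock H M) (T D : ℝ) (P : Measure Ω) (y : ℝ → Ω → ℝ)
    (W : ℕ → ℝ≥0 → Ω → ℝ) (α : ℕ → Ω → M) : Prop extends IsClockState C T D P y W α where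
  stationary : IsStationaryProcess (syncError T y) P
  gaussian : IsGaussianProcess (syncError T y) P

/-- `a` and `b` are the noise constants of the state in the `n`-th period:
`(1/T) ∫₀ᵀ E[(y_n(s) - y_n)²] ds = σ²_LO(T) (a + 2)/2` and
`E[(K_T y_n - y_n)²] = b σ²_LO(T)`, where `K_T y_n = y_n + D W_T`. -/
def IsNoiseConstants (P : Measure Ω) (T D : ℝ) (y : ℝ → Ω → ℝ) (W : ℕ → ℝ≥0 → Ω → ℝ) (n : ℕ)
    (a b : ℝ) : Prop :=
  (1 / T) * (∫ s in (0 : ℝ)..T, ∫ ω, (y (n * T + s) ω - syncError T y n ω) ^ 2 ∂P)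
      = loVariance P T y n * ((a + 2) / 2) ∧
    ∫ ω, ((syncError T y n ω + D * W n T.toNNReal ω) - syncError T y n ω) ^ 2 ∂P
      = b * loVariance P T y n

end ClockProcess

/-! ### The Gaussian clock -/

section Gaussian

/-- The Gaussian wave function `ψ_φ(x) = F^{1/4} / (2π)^{1/4} exp (-(F/4) (x - φ)²)`. -/
def waveFun (F φ x : ℝ) : ℂ :=
  ((F ^ (1 / 4 : ℝ) / (2 * Real.pi) ^ (1 / 4 : ℝ) * Real.exp (-(F / 4) * (x - φ) ^ 2) : ℝ) : ℂ)

lemma norm_sq_waveFun {F : ℝ} (hF : 0 < F) (φ x : ℝ) :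
    ‖waveFun F φ x‖ ^ 2 = gaussianPDFReal φ (1 / F).toNNReal x := by
  have h2 : ∀ z : ℝ, 0 ≤ z → (z ^ (1 / 4 : ℝ)) ^ 2 = √z := by
    intro z hz
    rw [← Real.rpow_natCast, ← Real.rpow_mul hz, Real.sqrt_eq_rpow]
    norm_num
  have hF' : ((1 / F).toNNReal : ℝ) = 1 / F := Real.coe_toNNReal _ (by positivity)
  rw [waveFun, Complex.norm_real, Real.norm_eq_abs, sq_abs, mul_pow, div_pow, h2 _ hF.le,
    h2 _ (by positivity), ← Real.exp_nat_mul, gaussianPDFReal, hF']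
  congr 1
  · rw [← Real.sqrt_div hF.le, ← Real.sqrt_inv]
    congr 1
    field_simp
  · congr 1
    push_cast
    field_simp
    ring

lemma continuous_waveFun (F φ : ℝ) : Continuous (waveFun F φ) := by
  unfold waveFun
  fun_prop

lemma memLp_waveFun {F : ℝ} (hF : 0 < F) (φ : ℝ) : MemLp (waveFun F φ) 2 volume := by
  rw [memLp_two_iff_integrable_sq_norm (continuous_waveFun F φ).aestronglyMeasurable]
  simp_rw [norm_sq_waveFun hF]
  exact integrable_gaussianPDFReal _ _

/-- The unit vector `ψ_φ` of `L²(ℝ)`. -/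
def waveVec {F : ℝ} (hF : 0 < F) (φ : ℝ) : Lp ℂ 2 (volume : Measure ℝ) :=
  (memLp_waveFun hF φ).toLp _

lemma norm_waveVec {F : ℝ} (hF : 0 < F) (φ : ℝ) : ‖waveVec hF φ‖ = 1 := by
  have h : ‖waveVec hF φ‖ ^ 2 = 1 := by
    have h1 : (inner ℂ (waveVec hF φ) (waveVec hF φ) : ℂ) = 1 := by
      rw [L2.inner_def]
      have : ∀ᵐ x ∂(volume : Measure ℝ), (inner ℂ (waveVec hF φ x) (waveVec hF φ x) : ℂ)
          = ((gaussianPDFReal φ (1 / F).toNNReal x : ℝ) : ℂ) := by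
        filter_upwards [(memLp_waveFun hF φ).coeFn_toLp] with x hx
        rw [waveVec, hx, inner_self_eq_norm_sq_to_K, ← norm_sq_waveFun hF]
        norm_cast
      rw [integral_congr_ae this, integral_complex_ofReal, integral_gaussianPDFReal_eq_one]
      · simp
      · simpa using hF
    rw [inner_self_eq_norm_sq_to_K, ← RCLike.ofReal_pow] at h1
    exact Complex.ofReal_injective (by simpa using h1)
  nlinarith [norm_nonneg (waveVec hF φ)]

/-- The Gaussian pure state `ρ(φ) = |ψ_φ⟩⟨ψ_φ|`. -/
def gaussianState {F : ℝ} (hF : 0 < F) (φ : ℝ) :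
    Lp ℂ 2 (volume : Measure ℝ) →L[ℂ] Lp ℂ 2 (volume : Measure ℝ) :=
  InnerProductSpace.rankOne ℂ (waveVec hF φ) (waveVec hF φ)

lemma isDensityOperator_gaussianState {F : ℝ} (hF : 0 < F) (φ : ℝ) :
    IsDensityOperator (gaussianState hF φ) where
  isPositive := InnerProductSpace.isPositive_rankOne_self _
  trace_eq_one := by
    unfold opTrace gaussianState
    have h := ((exists_hilbertBasis ℂ
      (Lp ℂ 2 (volume : Measure ℝ))).choose_spec.choose).tsum_inner_mul_inner
        (waveVec hF φ) (waveVec hF φ)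
    rw [inner_self_eq_norm_sq_to_K, norm_waveVec] at h
    simp only [InnerProductSpace.inner_right_rankOne_apply]
    rw [← (by simpa using h : _ = (1 : ℂ))]
    exact tsum_congr fun i => mul_comm _ _

open Classical in
/-- The effect of the event `A` under the measurement of the position: multiplication by the
indicator function of the (measurable) set `A`, i.e. the spectral projection `1_A(X)`. -/
def positionEffect (A : Set ℝ) :
    Lp ℂ 2 (volume : Measure ℝ) →L[ℂ] Lp ℂ 2 (volume : Measure ℝ) :=
  if hA : MeasurableSet A then
    LinearMap.mkContinuous
      { toFun := fun f => ((Lp.memLp f).indicator hA).toLp _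
        map_add' := fun f g => by
          ext1
          filter_upwards [((Lp.memLp (f + g)).indicator hA).coeFn_toLp,
            ((Lp.memLp f).indicator hA).coeFn_toLp, ((Lp.memLp g).indicator hA).coeFn_toLp,
            Lp.coeFn_add f g, Lp.coeFn_add (((Lp.memLp f).indicator hA).toLp _)
              (((Lp.memLp g).indicator hA).toLp _)] with x h1 h2 h3 h4 h5
          rw [h1, h5, Pi.add_apply, h2, h3]
          by_cases hx : x ∈ A
          · simp only [Set.indicator_of_mem hx]
            exact h4
          · simp [hx]
        map_smul' := fun c f => by
          ext1
          filter_upwards [((Lp.memLp (c • f)).indicator hA).coeFn_toLp,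
            ((Lp.memLp f).indicator hA).coeFn_toLp,
            Lp.coeFn_smul c f, Lp.coeFn_smul c (((Lp.memLp f).indicator hA).toLp _)]
            with x h1 h2 h3 h4
          rw [h1, RingHom.id_apply, h4, Pi.smul_apply, h2]
          by_cases hx : x ∈ A <;> simp [hx, h3] }
      1 (fun f => by
        rw [one_mul]
        refine Lp.norm_le_norm_of_ae_le ?_
        filter_upwards [((Lp.memLp f).indicator hA).coeFn_toLp] with x h1
        simp only [LinearMap.coe_mk, AddHom.coe_mk]
        rw [h1]
        exact norm_indicator_le_norm_self _ _)
  else 0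

lemma coeFn_positionEffect {A : Set ℝ} (hA : MeasurableSet A)
    (f : Lp ℂ 2 (volume : Measure ℝ)) :
    positionEffect A f =ᵐ[volume] A.indicator f := by
  rw [positionEffect, dif_pos hA]
  exact ((Lp.memLp f).indicator hA).coeFn_toLp

lemma inner_positionEffect {A : Set ℝ} (hA : MeasurableSet A)
    (f g : Lp ℂ 2 (volume : Measure ℝ)) :
    ⟪f, positionEffect A g⟫_ℂ = ∫ x in A, ⟪f x, g x⟫_ℂ := by
  rw [L2.inner_def, ← integral_indicator hA]
  refine integral_congr_ae ?_
  filter_upwards [coeFn_positionEffect hA g] with x hx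
  rw [hx]
  by_cases h : x ∈ A <;> simp [h]

/-- The measurement of the position on a line. -/
def positionPOVM : POVM (Lp ℂ 2 (volume : Measure ℝ)) ℝ where
  effect := positionEffect
  isPositive := fun A hA => by
    rw [ContinuousLinearMap.isPositive_def]
    refine ⟨fun f g => ?_, fun f => ?_⟩
    · change ⟪positionEffect A f, g⟫_ℂ = ⟪f, positionEffect A g⟫_ℂ
      rw [← inner_conj_symm, inner_positionEffect hA, inner_positionEffect hA, ← integral_conj]
      simp [mul_comm]
    · rw [ContinuousLinearMap.reApplyInnerSelf_apply, ← inner_conj_symm, inner_positionEffect hA,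
        RCLike.conj_re]
      have : ∀ x, ⟪f x, f x⟫_ℂ = ((‖f x‖ ^ 2 : ℝ) : ℂ) := fun x => by
        rw [inner_self_eq_norm_sq_to_K]; norm_cast
      simp_rw [this]
      rw [integral_complex_ofReal]
      exact integral_nonneg fun x => by positivity
  effect_univ := by
    ext1 f
    ext1
    filter_upwards [coeFn_positionEffect MeasurableSet.univ f] with x hx
    rw [hx]
    simp
  hasSum_effect := fun A hA hd f => by
    rw [inner_positionEffect (MeasurableSet.iUnion hA)]
    simp_rw [fun i => inner_positionEffect (hA i) f f]
    exact hasSum_integral_iUnion hA hd (L2.integrable_inner f f).integrableOn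

/-- The Gaussian clock `C_ζ`: Gaussian pure states, position measurement and the estimator
`Φ_ζ(α) = (1 - ζ) α`. -/
def gaussianClock {F : ℝ} (hF : 0 < F) (ζ : ℝ) : Clock (Lp ℂ 2 (volume : Measure ℝ)) ℝ where
  state := gaussianState hF
  isDensityOperator := isDensityOperator_gaussianState hF
  measurement := positionPOVM
  estimator := fun a => (1 - ζ) * a
  measurable_estimator := by fun_prop

end Gaussian

end

end AtomicClock

/-! Given the past and the local oscillator noise, Born's rule makes the outcome Gaussian with mean
`ȳ_n` and variance `1/F`. Hence `α_n = ȳ_n + ν_n` with `ν_n` a centered Gaussian of variance `1/F`,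
independent of everything before the measurement (`exists_indep_error_of_condExp_eq_gaussianReal`).
As `ȳ_n = y_n + (D/T) ∫ W`, the synchronization rule becomes the autoregression `y_{n+1} = ζ y_n +
η_n - (1 - ζ) ν_n`, where `η_n = D W_T - (1 - ζ)(D/T) ∫ W` and the three terms are pairwise
orthogonal. In a stationary state the mean satisfies `m = ζ m`, and the second moment solves a
linear equation which is invertible because `|ζ| < 1` (`integral_sq_syncError_succ`).

For the clock time, the same rule solved for `T ȳ_k` gives `T/(1 - ζ) (D W_T + y_k - y_{k+1}) - T
ν_k`. The errors telescope, so the clock time is a sum of `n` orthogonal increments plus a remainder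
bounded in `L²` (`clockTimeError_ae_eq`); only the variance of one increment survives after division
by `t`.

The Fisher information is computed from `ψ_φ` and its `L²` derivative: for pure states `X = 2ρ'` is
a solution, and `tr(ρX²) = ‖Xψ‖²` is the same for all solutions.

Existence needs a model. Brownian motion is built from independent Gaussians by the Schauder series
of the Brownian bridge (`isBrownianReal_brownian`). Independent copies drive the periods, other
coordinates supply the measurement errors, and the initial error has the stationary variance. All
errors are then linear combinations of independent centered Gaussians, so they form a Gaussian
process, stationary because its covariance depends on the lag only (`isGaussianStationaryState`). -/

namespace AtomicClock

/-! ### Traces and Fisher information of pure states. -/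

section Trace

variable {H : Type*} [NormedAddCommGroup H] [InnerProductSpace ℂ H] [CompleteSpace H]

/-- Parseval's identity for the vectors `B† v` and `u`, in whichever basis `opTrace` has chosen. -/
lemma opTrace_rankOne_comp (u v : H) (B : H →L[ℂ] H) :
    opTrace (InnerProductSpace.rankOne ℂ u v ∘L B) = ⟪v, B u⟫_ℂ := by
  unfold opTrace
  have h := ((exists_hilbertBasis ℂ H).choose_spec.choose).tsum_inner_mul_inner
    (ContinuousLinearMap.adjoint B v) u
  rw [ContinuousLinearMap.adjoint_inner_left] at h
  rw [← h]
  refine tsum_congr fun i => ?_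
  rw [ContinuousLinearMap.comp_apply, InnerProductSpace.rankOne_apply, inner_smul_right,
    ContinuousLinearMap.adjoint_inner_left]

/-- The scalars are real since `rankOne` is conjugate linear in its second argument; this is enough
to differentiate in the real parameter `φ`. -/
lemma isBoundedBilinearMap_rankOne :
    IsBoundedBilinearMap ℝ (fun p : H × H => InnerProductSpace.rankOne ℂ p.1 p.2) where
  add_left x y z := by ext w; simp
  smul_left c x y := by
    ext w
    simp [InnerProductSpace.rankOne_apply, smul_comm c]
  add_right x y z := by ext w; simp
  smul_right c x y := by
    ext w
    have h : ⟪(c • y), w⟫_ℂ = c • ⟪y, w⟫_ℂ := by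
      rw [← Complex.coe_smul c y, inner_smul_left, Complex.conj_ofReal, Complex.real_smul]
    simp only [InnerProductSpace.rankOne_apply, smul_apply]
    rw [h, smul_assoc]
  bound := ⟨1, one_pos, fun x y => by simp⟩

lemma hasDerivAt_rankOne_self {ψ : ℝ → H} {v : H} {φ : ℝ} (h : HasDerivAt ψ v φ) :
    HasDerivAt (fun t => InnerProductSpace.rankOne ℂ (ψ t) (ψ t))
      (InnerProductSpace.rankOne ℂ (ψ φ) v + InnerProductSpace.rankOne ℂ v (ψ φ)) φ := by
  have h2 : HasDerivAt (fun t => (ψ t, ψ t)) (v, v) φ := h.prodMk h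
  exact (isBoundedBilinearMap_rankOne.hasFDerivAt (ψ φ, ψ φ)).comp_hasDerivAt φ h2

/-- The Fisher information of a family of pure states determines itself. -/
lemma isQuantumFisherInformation_unique_of_pure {ψ : ℝ → H} (hψ : ∀ φ, ‖ψ φ‖ = 1) {φ f g : ℝ}
    (hf : IsQuantumFisherInformation (fun t => InnerProductSpace.rankOne ℂ (ψ t) (ψ t)) φ f)
    (hg : IsQuantumFisherInformation (fun t => InnerProductSpace.rankOne ℂ (ψ t) (ψ t)) φ g) :
    f = g := by
  have hone : ⟪ψ φ, ψ φ⟫_ℂ = 1 := by rw [inner_self_eq_norm_sq_to_K, hψ]; simp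
  -- Applied to `ψ`, the equation reads `Xψ + ⟪ψ, Xψ⟫ ψ = 2ρ'ψ`, and pairing with `ψ` gives `⟪ψ, Xψ⟫
  -- = ⟪ψ, ρ'ψ⟫`. So `X` itself need not be unique but `Xψ` is, and the trace equals `‖Xψ‖²`.
  have key : ∀ X ρ' : H →L[ℂ] H, (1 / 2 : ℂ) • (X ∘L InnerProductSpace.rankOne ℂ (ψ φ) (ψ φ) +
      InnerProductSpace.rankOne ℂ (ψ φ) (ψ φ) ∘L X) = ρ' →
      X (ψ φ) = (2 : ℂ) • ρ' (ψ φ) - ⟪ψ φ, ρ' (ψ φ)⟫_ℂ • ψ φ := by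
    rintro X ρ' rfl
    simp only [smul_apply, add_apply,
      ContinuousLinearMap.comp_apply, InnerProductSpace.rankOne_apply, hone, one_smul,
      inner_smul_right, inner_add_right, smul_smul, smul_add]
    module
  obtain ⟨X, ρ', hX, hd, he, ht⟩ := hf
  obtain ⟨Y, σ', hY, hd', he', ht'⟩ := hg
  have hρ : σ' = ρ' := hd'.unique hd
  have hXY : X (ψ φ) = Y (ψ φ) := by rw [key X ρ' he, key Y σ' he', hρ]
  have tr : ∀ X : H →L[ℂ] H, IsSelfAdjoint X →
      opTrace (InnerProductSpace.rankOne ℂ (ψ φ) (ψ φ) ∘L X ∘L X) = ⟪X (ψ φ), X (ψ φ)⟫_ℂ := by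
    intro X hX
    rw [opTrace_rankOne_comp, ContinuousLinearMap.comp_apply,
      ← ContinuousLinearMap.adjoint_inner_left, ← ContinuousLinearMap.star_eq_adjoint, hX.star_eq]
  rw [tr X hX] at ht
  rw [tr Y hY, ← hXY, ht] at ht'
  exact_mod_cast ht'

/-- A family of unit vectors with `⟪ψ, ψ'⟫ = 0` and `‖ψ'‖² = f / 4` has Fisher information `f`. -/
lemma isQuantumFisherInformation_of_pure {ψ : ℝ → H} {v : H} {φ f : ℝ} (hψ : ‖ψ φ‖ = 1)
    (hd : HasDerivAt ψ v φ) (ho : ⟪ψ φ, v⟫_ℂ = 0) (hv : ⟪v, v⟫_ℂ = ((f / 4 : ℝ) : ℂ)) :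
    IsQuantumFisherInformation (fun t => InnerProductSpace.rankOne ℂ (ψ t) (ψ t)) φ f := by
  have hone : ⟪ψ φ, ψ φ⟫_ℂ = 1 := by rw [inner_self_eq_norm_sq_to_K, hψ]; simp
  have ho' : ⟪v, ψ φ⟫_ℂ = 0 := by rw [← inner_conj_symm, ho, map_zero]
  set A := InnerProductSpace.rankOne ℂ (ψ φ) v + InnerProductSpace.rankOne ℂ v (ψ φ) with hA
  have hadj : ∀ x y : H, ContinuousLinearMap.adjoint (InnerProductSpace.rankOne ℂ x y) =
      InnerProductSpace.rankOne ℂ y x := by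
    intro x y
    exact InnerProductSpace.adjoint_rankOne x y
  -- Differentiating `ρ² = ρ` gives `{ρ', ρ} = ρ'`, so `X = 2ρ'` solves the equation. Orthogonality
  -- yields `Xψ = 2v`, hence the value `4‖v‖² = f`.
  refine ⟨(2 : ℂ) • A, A, ?_, hasDerivAt_rankOne_self hd, ?_, ?_⟩
  · rw [isSelfAdjoint_iff, star_smul, hA, star_add, ContinuousLinearMap.star_eq_adjoint,
      ContinuousLinearMap.star_eq_adjoint, hadj, hadj, add_comm]
    simp
  · ext w
    simp only [hA, smul_apply, add_apply,
      ContinuousLinearMap.comp_apply, InnerProductSpace.rankOne_apply, map_smul, inner_smul_right,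
      inner_add_right, hone, ho, ho']
    module
  · rw [opTrace_rankOne_comp]
    simp only [hA, smul_apply, add_apply,
      ContinuousLinearMap.comp_apply, InnerProductSpace.rankOne_apply, map_smul, inner_smul_right,
      inner_add_right, hone, ho, ho', hv, map_add, inner_smul_right]
    simp only [zero_add, add_zero, mul_one, mul_zero]
    push_cast
    ring

end Trace

/-! ### The Gaussian wave packets: derivative, Fisher information, outcome law. -/

section GaussianClock

variable {F : ℝ}

/-- Completing the square: `(x - a)² + (x - b)² = 2 (x - (a + b)/2)² + (a - b)²/2`. All inner
products of wave packets thereby reduce to moments of a single Gaussian. -/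
lemma waveFun_mul_waveFun (hF : 0 < F) (a b x : ℝ) :
    waveFun F a x * waveFun F b x =
      ((Real.exp (-(F * (a - b) ^ 2 / 8)) *
        gaussianPDFReal ((a + b) / 2) (1 / F).toNNReal x : ℝ) : ℂ) := by
  rw [← norm_sq_waveFun hF]
  simp only [waveFun, Complex.norm_real, Real.norm_eq_abs, sq_abs]
  rw [← Complex.ofReal_mul]
  congr 1
  set c := F ^ (1 / 4 : ℝ) / (2 * Real.pi) ^ (1 / 4 : ℝ)
  have h1 : Real.exp (-(F / 4) * (x - a) ^ 2) * Real.exp (-(F / 4) * (x - b) ^ 2) =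
      Real.exp (-(F * (a - b) ^ 2 / 8)) * Real.exp (-(F / 4) * (x - (a + b) / 2) ^ 2) ^ 2 := by
    rw [← Real.exp_nat_mul, ← Real.exp_add, ← Real.exp_add]
    congr 1
    push_cast
    ring
  linear_combination c ^ 2 * h1

lemma inner_eq_integral_gaussianReal (hF : 0 < F) {a b : ℝ} {p q : ℝ → ℝ}
    {f g : Lp ℂ 2 (volume : Measure ℝ)}
    (hf : f =ᵐ[volume] fun x => (p x : ℂ) * waveFun F a x)
    (hg : g =ᵐ[volume] fun x => (q x : ℂ) * waveFun F b x) :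
    ⟪f, g⟫_ℂ = ((Real.exp (-(F * (a - b) ^ 2 / 8)) *
      ∫ x, p x * q x ∂gaussianReal ((a + b) / 2) (1 / F).toNNReal : ℝ) : ℂ) := by
  rw [L2.inner_def, integral_gaussianReal_eq_integral_smul (by simpa using hF),
    ← integral_const_mul, ← integral_complex_ofReal]
  refine integral_congr_ae ?_
  filter_upwards [hf, hg] with x h1 h2
  rw [h1, h2, RCLike.inner_apply, map_mul, Complex.conj_ofReal]
  have h3 : (starRingEnd ℂ) (waveFun F a x) = waveFun F a x := Complex.conj_ofReal _
  rw [h3]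
  have h4 := waveFun_mul_waveFun hF a b x
  simp only [smul_eq_mul]
  push_cast at h4 ⊢
  linear_combination (p x * q x : ℂ) * h4

lemma coeFn_waveVec (hF : 0 < F) (φ : ℝ) :
    waveVec hF φ =ᵐ[volume] fun x => ((1 : ℝ) : ℂ) * waveFun F φ x := by
  simp only [Complex.ofReal_one, one_mul]
  exact (memLp_waveFun hF φ).coeFn_toLp

lemma memLp_waveVel (hF : 0 < F) (φ : ℝ) :
    MemLp (fun x => ((F / 2 * (x - φ) : ℝ) : ℂ) * waveFun F φ x) 2 volume := by
  have hc : Continuous fun x => ((F / 2 * (x - φ) : ℝ) : ℂ) * waveFun F φ x := by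
    have := continuous_waveFun F φ
    fun_prop
  rw [memLp_two_iff_integrable_sq_norm hc.aestronglyMeasurable]
  have h1 : Integrable (fun x => (F / 2 * (x - φ)) ^ 2) (gaussianReal φ (1 / F).toNNReal) := by
    have h : MemLp (fun x => F / 2 * (x - φ)) 2 (gaussianReal φ (1 / F).toNNReal) :=
      ((memLp_id_gaussianReal 2).sub (memLp_const φ)).const_mul (F / 2)
    exact h.integrable_sq
  rw [gaussianReal_of_var_ne_zero _ (by simpa using hF),
    integrable_withDensity_iff (measurable_gaussianPDF _ _) (ae_of_all _ fun _ => gaussianPDF_lt_top)] at h1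
  refine h1.congr (ae_of_all _ fun x => ?_)
  simp only [norm_mul, mul_pow, norm_sq_waveFun hF, toReal_gaussianPDF, Complex.norm_real,
    Real.norm_eq_abs, sq_abs]

/-- The derivative of `φ ↦ ψ_φ` in `L²(ℝ)`. -/
noncomputable def waveVel (hF : 0 < F) (φ : ℝ) : Lp ℂ 2 (volume : Measure ℝ) :=
  (memLp_waveVel hF φ).toLp _

lemma coeFn_waveVel (hF : 0 < F) (φ : ℝ) :
    waveVel hF φ =ᵐ[volume] fun x => ((F / 2 * (x - φ) : ℝ) : ℂ) * waveFun F φ x :=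
  (memLp_waveVel hF φ).coeFn_toLp

lemma inner_waveVec_waveVec (hF : 0 < F) (a b : ℝ) :
    ⟪waveVec hF a, waveVec hF b⟫_ℂ = (Real.exp (-(F * (a - b) ^ 2 / 8)) : ℝ) := by
  rw [inner_eq_integral_gaussianReal hF (coeFn_waveVec hF a) (coeFn_waveVec hF b)]
  simp

lemma inner_waveVec_waveVel (hF : 0 < F) (a b : ℝ) :
    ⟪waveVec hF a, waveVel hF b⟫_ℂ =
      (Real.exp (-(F * (a - b) ^ 2 / 8)) * (F / 4 * (a - b)) : ℝ) := by
  rw [inner_eq_integral_gaussianReal hF (coeFn_waveVec hF a) (coeFn_waveVel hF b)]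
  have h : ∫ x, 1 * (F / 2 * (x - b)) ∂gaussianReal ((a + b) / 2) (1 / F).toNNReal =
      F / 4 * (a - b) := by
    simp_rw [one_mul]
    rw [integral_const_mul, integral_sub, integral_id_gaussianReal]
    · simp
      ring
    · exact (memLp_id_gaussianReal 1).integrable le_rfl
    · exact integrable_const _
  rw [h]

lemma inner_waveVel_waveVel (hF : 0 < F) (a : ℝ) :
    ⟪waveVel hF a, waveVel hF a⟫_ℂ = ((F / 4 : ℝ) : ℂ) := by
  rw [inner_eq_integral_gaussianReal hF (coeFn_waveVel hF a) (coeFn_waveVel hF a)]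
  congr 1
  have h1 : (a + a) / 2 = a := by ring
  have h2 := variance_fun_id_gaussianReal (μ := a) (v := (1 / F).toNNReal)
  rw [variance_eq_integral aemeasurable_id', integral_id_gaussianReal,
    Real.coe_toNNReal _ (by positivity)] at h2
  have h3 : ∀ x : ℝ, F / 2 * (x - a) * (F / 2 * (x - a)) = F ^ 2 / 4 * (x - a) ^ 2 :=
    fun x => by ring
  simp_rw [h1, h3]
  rw [integral_const_mul, h2]
  simp
  field_simp

lemma hasDerivAt_waveVec (hF : 0 < F) (φ : ℝ) :
    HasDerivAt (waveVec hF) (waveVel hF φ) φ := by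
  rw [hasDerivAt_iff_isLittleO_nhds_zero]
  -- The explicit inner products give the squared norm of the remainder in closed form; `exp(-u) ≥ 1
  -- - u` with `u = F h²/8` bounds it by exactly `(F h²/4)²`, so no pointwise differentiation under
  -- the integral is needed.
  have hb : (fun h : ℝ => waveVec hF (φ + h) - waveVec hF φ - h • waveVel hF φ) =O[𝓝 0]
      fun h : ℝ => h ^ 2 := by
    refine Asymptotics.IsBigO.of_bound (F / 4) (Eventually.of_forall fun h => ?_)
    have e1 : ‖waveVec hF (φ + h) - waveVec hF φ - h • waveVel hF φ‖ ^ 2 =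
        2 + F * h ^ 2 / 4 - 2 * Real.exp (-(F * h ^ 2 / 8))
          - F * h ^ 2 / 2 * Real.exp (-(F * h ^ 2 / 8)) := by
      have hs : h • waveVel hF φ = (h : ℂ) • waveVel hF φ := (Complex.coe_smul _ _).symm
      have e2 : ((‖waveVec hF (φ + h) - waveVec hF φ - h • waveVel hF φ‖ ^ 2 : ℝ) : ℂ) =
        ⟪waveVec hF (φ + h) - waveVec hF φ - h • waveVel hF φ,
          waveVec hF (φ + h) - waveVec hF φ - h • waveVel hF φ⟫_ℂ := by
        rw [inner_self_eq_norm_sq_to_K]; norm_cast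
      have c1 : ∀ a b, ⟪waveVel hF b, waveVec hF a⟫_ℂ =
          (Real.exp (-(F * (a - b) ^ 2 / 8)) * (F / 4 * (a - b)) : ℝ) := fun a b => by
        rw [← inner_conj_symm, inner_waveVec_waveVel, Complex.conj_ofReal]
      rw [hs] at e2
      simp only [inner_sub_left, inner_sub_right, inner_smul_left, inner_smul_right,
        inner_waveVec_waveVec, inner_waveVec_waveVel, inner_waveVel_waveVel, c1,
        Complex.conj_ofReal, ← Complex.ofReal_mul, ← Complex.ofReal_sub] at e2
      rw [hs, Complex.ofReal_injective e2]
      simp only [sub_self, add_sub_cancel_left, sub_add_cancel_left]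
      simp
      ring
    have e3 : 1 - F * h ^ 2 / 8 ≤ Real.exp (-(F * h ^ 2 / 8)) := by
      linarith [Real.add_one_le_exp (-(F * h ^ 2 / 8))]
    have e4 : ‖waveVec hF (φ + h) - waveVec hF φ - h • waveVel hF φ‖ ^ 2 ≤
        (F / 4 * h ^ 2) ^ 2 := by
      rw [e1]
      have : 0 ≤ F * h ^ 2 := by positivity
      nlinarith
    rw [norm_pow, Real.norm_eq_abs, sq_abs]
    exact abs_le_of_sq_le_sq' e4 (by positivity) |>.2
  exact hb.trans_isLittleO (Asymptotics.isLittleO_pow_id one_lt_two)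

lemma isQuantumFisherInformation_gaussianClock (hF : 0 < F) (ζ φ : ℝ) :
    IsQuantumFisherInformation (gaussianClock hF ζ).state φ F :=
  isQuantumFisherInformation_of_pure (norm_waveVec hF φ) (hasDerivAt_waveVec hF φ)
    (by rw [inner_waveVec_waveVel]; simp) (inner_waveVel_waveVel hF φ)

lemma quantumFisherInformation_gaussianClock (hF : 0 < F) (ζ φ : ℝ) :
    quantumFisherInformation (gaussianClock hF ζ).state φ = F := by
  have h : ∃ f, IsQuantumFisherInformation (gaussianClock hF ζ).state φ f :=
    ⟨F, isQuantumFisherInformation_gaussianClock hF ζ φ⟩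
  rw [quantumFisherInformation, dif_pos h]
  exact isQuantumFisherInformation_unique_of_pure (norm_waveVec hF) h.choose_spec
    (isQuantumFisherInformation_gaussianClock hF ζ φ)

/-- The trace is `⟪ψ_φ, 1_A ψ_φ⟫ = ∫_A |ψ_φ|²`, and `|ψ_φ|²` is the Gaussian density of variance
`1/F`. -/
lemma outcomeProb_gaussianClock (hF : 0 < F) (ζ φ : ℝ) {A : Set ℝ} (hA : MeasurableSet A) :
    (gaussianClock hF ζ).outcomeProb φ A = (gaussianReal φ (1 / F).toNNReal).real A := by
  change (opTrace (InnerProductSpace.rankOne ℂ (waveVec hF φ) (waveVec hF φ) ∘L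
    positionEffect A)).re = _
  rw [opTrace_rankOne_comp, inner_positionEffect hA, measureReal_def,
    gaussianReal_apply_eq_integral _ (by simpa using hF),
    ENNReal.toReal_ofReal (integral_nonneg fun x => gaussianPDFReal_nonneg _ _ _)]
  rw [← Complex.ofReal_re (∫ x in A, gaussianPDFReal φ (1 / F).toNNReal x),
    ← integral_complex_ofReal]
  congr 1
  refine integral_congr_ae (ae_restrict_of_ae ?_)
  filter_upwards [(memLp_waveFun hF φ).coeFn_toLp] with x hx
  rw [waveVec, hx, inner_self_eq_norm_sq_to_K, ← norm_sq_waveFun hF]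
  norm_cast

lemma isBiased_gaussianClock (hF : 0 < F) (ζ : ℝ) : (gaussianClock hF ζ).IsBiased ζ := by
  intro φ
  refine ⟨gaussianReal φ (1 / F).toNNReal, inferInstance,
    fun A hA => (outcomeProb_gaussianClock hF ζ φ hA).symm,
    ((memLp_id_gaussianReal 1).integrable le_rfl).const_mul (1 - ζ), ?_⟩
  change ∫ a, (1 - ζ) * a ∂_ = _
  rw [integral_const_mul, integral_id_gaussianReal]

end GaussianClock

/-! ### Second moments of time integrals of Brownian motion. -/

section Averages

variable {Ω : Type*}

/-- A process with continuous paths on `[0, r]` has a jointly measurable version which only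
depends on the values of the process on `[0, r]`. -/
lemma exists_measurable_uncurry_version [MeasurableSpace Ω] {W : ℝ≥0 → Ω → ℝ} {r : ℝ}
    (hm : ∀ t : ℝ≥0, (t : ℝ) ≤ r → Measurable (W t)) (hr : 0 ≤ r) :
    ∃ X : ℝ → Ω → ℝ, Measurable (Function.uncurry X) ∧
      ∀ ω, Continuous (W · ω) → ∀ s ∈ Set.Icc 0 r, X s ω = W s.toNNReal ω := by
  -- Each approximation samples countably many times, hence is jointly measurable, and `limsup`
  -- preserves this even where the paths are not continuous. The cap at `r` keeps the samples in
  -- `[0, r]`, so the σ-algebra may be the one generated by the noise up to `r`.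
  refine ⟨fun s ω => limsup (fun k : ℕ => W (min ((⌊s * k⌋₊ : ℝ) / k) r).toNNReal ω) atTop,
    ?_, ?_⟩
  · refine Measurable.limsup fun k => ?_
    have h1 : Measurable fun p : ℕ × Ω => W (min ((p.1 : ℝ) / k) r).toNNReal p.2 := by
      refine measurable_from_prod_countable_right fun j =>
        hm (min ((j : ℝ) / k) r).toNNReal ?_
      rw [Real.coe_toNNReal _ (le_min (by positivity) hr)]
      exact min_le_right _ _
    have h2 : Measurable fun p : ℝ × Ω => (⌊p.1 * k⌋₊, p.2) :=
      (Nat.measurable_floor.comp (measurable_fst.mul_const _)).prodMk measurable_snd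
    exact h1.comp h2
  · intro ω hc s hs
    have h1 : Tendsto (fun k : ℕ => (⌊s * k⌋₊ : ℝ) / k) atTop (𝓝 s) :=
      (tendsto_nat_floor_mul_div_atTop hs.1).comp tendsto_natCast_atTop_atTop
    have h2 : Tendsto (fun k : ℕ => (min ((⌊s * k⌋₊ : ℝ) / k) r).toNNReal) atTop
        (𝓝 (min s r).toNNReal) :=
      (continuous_real_toNNReal.tendsto _).comp (h1.min tendsto_const_nhds)
    rw [min_eq_left hs.2] at h2
    exact ((hc.tendsto _).comp h2).limsup_eq

lemma stronglyMeasurable_setIntegral [MeasurableSpace Ω] {X : ℝ → Ω → ℝ}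
    (hX : Measurable (Function.uncurry X)) (A : Set ℝ) :
    StronglyMeasurable fun ω => ∫ s in A, X s ω :=
  hX.stronglyMeasurable.integral_prod_left'

variable [MeasurableSpace Ω] {P : Measure Ω}

/-- Cauchy–Schwarz against the constant `1`, obtained by expanding `∫ (r f - I)² ≥ 0` with `r` the
total mass and `I = ∫ f`. -/
lemma sq_integral_le {α : Type*} [MeasurableSpace α] {μ : Measure α} [IsFiniteMeasure μ]
    {f : α → ℝ} (hf : MemLp f 2 μ) : (∫ x, f x ∂μ) ^ 2 ≤ μ.real Set.univ * ∫ x, f x ^ 2 ∂μ := by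
  set I := ∫ x, f x ∂μ with hI
  set r := μ.real Set.univ
  have h1 : ∫ x, (r * f x - I) ^ 2 ∂μ = r ^ 2 * ∫ x, f x ^ 2 ∂μ - r * I ^ 2 := by
    have h2 : ∀ x, (r * f x - I) ^ 2 = r ^ 2 * f x ^ 2 - 2 * r * I * f x + I ^ 2 := fun x => by ring
    simp_rw [h2]
    rw [integral_add, integral_sub, integral_const_mul, integral_const_mul, ← hI, integral_const,
      smul_eq_mul]
    · ring
    · exact hf.integrable_sq.const_mul _
    · exact (hf.integrable one_le_two).const_mul _
    · exact (hf.integrable_sq.const_mul _).sub ((hf.integrable one_le_two).const_mul _)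
    · exact integrable_const _
  have h3 : 0 ≤ ∫ x, (r * f x - I) ^ 2 ∂μ := integral_nonneg fun _ => sq_nonneg _
  rw [h1] at h3
  have hr : 0 ≤ r := measureReal_nonneg
  rcases hr.eq_or_lt with h0 | h0
  · have hμ : μ = 0 := by
      rwa [eq_comm, measureReal_eq_zero_iff, Measure.measure_univ_eq_zero] at h0
    simp [hI, hμ]
  · have h4 : 0 ≤ r * (r * ∫ x, f x ^ 2 ∂μ - I ^ 2) := by linarith
    linarith [nonneg_of_mul_nonneg_right h4 h0]

/-- The integral of the noise `W` over `[0, r]`. -/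
noncomputable def noiseIntegral (W : ℝ≥0 → Ω → ℝ) (r : ℝ) (ω : Ω) : ℝ :=
  ∫ s in (0 : ℝ)..r, W s.toNNReal ω

variable {W : ℝ≥0 → Ω → ℝ} {r : ℝ}

/-- The σ-algebra `m` is arbitrary so that the integral can be shown to belong to `noiseSigma`,
which the independence arguments require. Continuity holds almost surely only, hence the almost
everywhere version. -/
lemma aestronglyMeasurable_noiseIntegral (hW : IsBrownianReal W P) (hr : 0 ≤ r)
    {m : MeasurableSpace Ω} (hm : ∀ t : ℝ≥0, (t : ℝ) ≤ r → Measurable[m] (W t)) :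
    AEStronglyMeasurable[m] (noiseIntegral W r) P := by
  obtain ⟨X, hX, hXW⟩ := @exists_measurable_uncurry_version Ω m W r hm hr
  refine ⟨fun ω => ∫ s in Set.Ioc 0 r, X s ω,
    @stronglyMeasurable_setIntegral Ω m X hX _, ?_⟩
  filter_upwards [hW.cont] with ω hω
  rw [noiseIntegral, intervalIntegral.integral_of_le hr]
  exact setIntegral_congr_fun measurableSet_Ioc fun s hs => (hXW ω hω s ⟨hs.1.le, hs.2⟩).symm

lemma memLp_brownian (hW : IsBrownianReal W P) (t : ℝ≥0) : MemLp (W t) 2 P :=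
  (hW.isGaussianProcess.hasGaussianLaw_eval t).memLp_two

variable [IsProbabilityMeasure P]

lemma memLp_uncurry_two {μ : Measure ℝ} [IsFiniteMeasure μ] {X : ℝ → Ω → ℝ}
    (hX : Measurable (Function.uncurry X)) {C : ℝ}
    (hC : ∀ᵐ s ∂μ, MemLp (X s) 2 P ∧ ∫ ω, X s ω ^ 2 ∂P ≤ C) :
    MemLp (Function.uncurry X) 2 (μ.prod P) := by
  rw [memLp_two_iff_integrable_sq hX.aestronglyMeasurable,
    integrable_prod_iff (hX.pow_const 2).aestronglyMeasurable]
  constructor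
  · filter_upwards [hC] with s hs using hs.1.integrable_sq
  · refine Integrable.mono' (integrable_const C) ?_ ?_
    · exact ((hX.pow_const 2).norm.stronglyMeasurable.integral_prod_right').aestronglyMeasurable
    · filter_upwards [hC] with s hs
      rw [Real.norm_eq_abs, abs_of_nonneg (integral_nonneg fun _ => norm_nonneg _)]
      simpa [Function.uncurry] using hs.2

lemma memLp_integral_of_memLp_uncurry {μ : Measure ℝ} [IsFiniteMeasure μ] {X : ℝ → Ω → ℝ}
    (hX : Measurable (Function.uncurry X)) (h : MemLp (Function.uncurry X) 2 (μ.prod P)) :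
    MemLp (fun ω => ∫ s, X s ω ∂μ) 2 P := by
  have hm : AEStronglyMeasurable (fun ω => ∫ s, X s ω ∂μ) P :=
    (hX.stronglyMeasurable.integral_prod_left').aestronglyMeasurable
  rw [memLp_two_iff_integrable_sq hm]
  have h2 := h.integrable_sq
  refine Integrable.mono' (h2.integral_prod_right.const_mul (μ.real Set.univ)) (hm.pow 2) ?_
  filter_upwards [h2.prod_left_ae] with ω hω
  rw [Real.norm_eq_abs, abs_of_nonneg (sq_nonneg _)]
  have hX' : Measurable fun s => X s ω := hX.comp measurable_prodMk_right
  exact sq_integral_le ((memLp_two_iff_integrable_sq hX'.aestronglyMeasurable).2 hω)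

lemma integral_mul_integral_swap {μ : Measure ℝ} [IsFiniteMeasure μ] {X : ℝ → Ω → ℝ}
    (h : MemLp (Function.uncurry X) 2 (μ.prod P)) {Z : Ω → ℝ} (hZ : MemLp Z 2 P) :
    ∫ ω, Z ω * ∫ s, X s ω ∂μ ∂P = ∫ s, ∫ ω, Z ω * X s ω ∂P ∂μ := by
  have hZ' : MemLp (fun p : ℝ × Ω => Z p.2) 2 (μ.prod P) := hZ.comp_snd μ
  rw [integral_integral_swap (f := fun s ω => Z ω * X s ω) (hZ'.integrable_mul h)]
  simp_rw [integral_const_mul]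

lemma integral_mul_brownian (hW : IsBrownianReal W P) (s t : ℝ≥0) :
    ∫ ω, W s ω * W t ω ∂P = min s t := by
  have h := hW.covariance_eval s t
  rw [covariance_eq_sub (memLp_brownian hW s) (memLp_brownian hW t), hW.integral_eval] at h
  simpa using h

lemma integral_sq_brownian (hW : IsBrownianReal W P) (t : ℝ≥0) : ∫ ω, W t ω ^ 2 ∂P = t := by
  simpa [sq] using integral_mul_brownian hW t t

/-- Fubini requires joint measurability in time and `ω`. Paths are continuous only almost surely, so
`W` is replaced by a jointly measurable version. -/
lemma exists_brownian_version (hW : IsBrownianReal W P) (hm : ∀ t, Measurable (W t))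
    (hr : 0 ≤ r) :
    ∃ X : ℝ → Ω → ℝ, Measurable (Function.uncurry X) ∧
      MemLp (Function.uncurry X) 2 ((volume.restrict (Set.Ioc 0 r)).prod P) ∧
      (∀ s ∈ Set.Ioc 0 r, X s =ᵐ[P] W s.toNNReal) ∧
      noiseIntegral W r =ᵐ[P] fun ω => ∫ s in Set.Ioc 0 r, X s ω := by
  obtain ⟨X, hX, hXW⟩ := exists_measurable_uncurry_version (fun t _ => hm t) hr
  have h1 : ∀ s ∈ Set.Ioc 0 r, X s =ᵐ[P] W s.toNNReal := fun s hs => by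
    filter_upwards [hW.cont] with ω hω using hXW ω hω s ⟨hs.1.le, hs.2⟩
  refine ⟨X, hX, memLp_uncurry_two hX (C := r) ?_, h1, ?_⟩
  · filter_upwards [ae_restrict_mem measurableSet_Ioc] with s hs
    refine ⟨(memLp_brownian hW _).ae_eq (h1 s hs).symm, ?_⟩
    rw [integral_congr_ae (g := fun ω => W s.toNNReal ω ^ 2) (by
      filter_upwards [h1 s hs] with ω hω; rw [hω]), integral_sq_brownian hW,
      Real.coe_toNNReal _ hs.1.le]
    exact hs.2
  · filter_upwards [hW.cont] with ω hω
    rw [noiseIntegral, intervalIntegral.integral_of_le hr]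
    exact setIntegral_congr_fun measurableSet_Ioc fun s hs => (hXW ω hω s ⟨hs.1.le, hs.2⟩).symm

lemma memLp_noiseIntegral (hW : IsBrownianReal W P) (hm : ∀ t, Measurable (W t)) (hr : 0 ≤ r) :
    MemLp (noiseIntegral W r) 2 P := by
  obtain ⟨X, hX, hX2, -, h⟩ := exists_brownian_version hW hm hr
  exact (memLp_integral_of_memLp_uncurry hX hX2).ae_eq h.symm

lemma integral_mul_noiseIntegral (hW : IsBrownianReal W P) (hm : ∀ t, Measurable (W t))
    (hr : 0 ≤ r) {Z : Ω → ℝ} (hZ : MemLp Z 2 P) :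
    ∫ ω, Z ω * noiseIntegral W r ω ∂P = ∫ s in (0 : ℝ)..r, ∫ ω, Z ω * W s.toNNReal ω ∂P := by
  obtain ⟨X, hX, hX2, h1, h⟩ := exists_brownian_version hW hm hr
  rw [intervalIntegral.integral_of_le hr, integral_congr_ae (g := fun ω => Z ω *
    ∫ s in Set.Ioc 0 r, X s ω) (by filter_upwards [h] with ω hω; rw [hω]),
    integral_mul_integral_swap hX2 hZ]
  refine setIntegral_congr_fun measurableSet_Ioc fun s hs => integral_congr_ae ?_
  filter_upwards [h1 s hs] with ω hω
  rw [hω]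

lemma integral_noiseIntegral (hW : IsBrownianReal W P) (hm : ∀ t, Measurable (W t))
    (hr : 0 ≤ r) : ∫ ω, noiseIntegral W r ω ∂P = 0 := by
  have h := integral_mul_noiseIntegral hW hm hr (Z := fun _ => 1) (memLp_const 1)
  simpa [hW.integral_eval] using h

/-- The integral of `min t s` over `s` in `[0, r]`, split at `t`: `t²/2 + t (r - t)`. -/
lemma integral_brownian_mul_noiseIntegral (hW : IsBrownianReal W P) (hm : ∀ t, Measurable (W t))
    {t : ℝ} (ht : 0 ≤ t) (htr : t ≤ r) :
    ∫ ω, W t.toNNReal ω * noiseIntegral W r ω ∂P = r * t - t ^ 2 / 2 := by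
  rw [integral_mul_noiseIntegral hW hm (ht.trans htr) (memLp_brownian hW _)]
  simp_rw [integral_mul_brownian hW]
  have hc : Continuous fun s : ℝ => ((min t.toNNReal s.toNNReal : ℝ≥0) : ℝ) := by fun_prop
  rw [← intervalIntegral.integral_add_adjacent_intervals (hc.intervalIntegrable 0 t)
    (hc.intervalIntegrable t r)]
  have h1 : ∫ s in (0 : ℝ)..t, ((min t.toNNReal s.toNNReal : ℝ≥0) : ℝ) = ∫ s in (0 : ℝ)..t, s := by
    refine intervalIntegral.integral_congr fun s hs => ?_
    rw [Set.uIcc_of_le ht] at hs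
    simp [Real.coe_toNNReal', ht, hs.1, hs.2]
  have h2 : ∫ s in t..r, ((min t.toNNReal s.toNNReal : ℝ≥0) : ℝ) = ∫ s in t..r, t := by
    refine intervalIntegral.integral_congr fun s hs => ?_
    rw [Set.uIcc_of_le htr] at hs
    simp [Real.coe_toNNReal', ht, hs.1, ht.trans hs.1]
  rw [h1, h2, integral_id, intervalIntegral.integral_const, smul_eq_mul]
  ring

lemma integral_sq_noiseIntegral (hW : IsBrownianReal W P) (hm : ∀ t, Measurable (W t))
    (hr : 0 ≤ r) : ∫ ω, noiseIntegral W r ω ^ 2 ∂P = r ^ 3 / 3 := by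
  simp_rw [sq]
  rw [integral_mul_noiseIntegral hW hm hr (memLp_noiseIntegral hW hm hr)]
  have h : ∫ s in (0 : ℝ)..r, ∫ ω, noiseIntegral W r ω * W s.toNNReal ω ∂P =
      ∫ s in (0 : ℝ)..r, (r * s - s ^ 2 / 2) := by
    refine intervalIntegral.integral_congr fun s hs => ?_
    rw [Set.uIcc_of_le hr] at hs
    rw [← integral_brownian_mul_noiseIntegral hW hm hs.1 hs.2]
    simp_rw [mul_comm]
  rw [h, intervalIntegral.integral_sub, intervalIntegral.integral_const_mul, integral_id,
    intervalIntegral.integral_div, integral_pow]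
  · norm_num
    ring
  all_goals exact Continuous.intervalIntegrable (by fun_prop) _ _

end Averages

/-! ### The measurement error is independent of the past. -/

section Independence

variable {Ω : Type*} {m m₁ m₂ m0 : MeasurableSpace Ω} {P : Measure Ω}

lemma integral_mul_of_indep (h₁ : m₁ ≤ m0) (h₂ : m₂ ≤ m0)
    (h : Indep m₁ m₂ P) {X Y : Ω → ℝ} (hX : AEStronglyMeasurable[m₁] X P)
    (hY : AEStronglyMeasurable[m₂] Y P) :
    ∫ ω, X ω * Y ω ∂P = (∫ ω, X ω ∂P) * ∫ ω, Y ω ∂P := by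
  obtain ⟨X', hX', hXX'⟩ := hX
  obtain ⟨Y', hY', hYY'⟩ := hY
  have hi : IndepFun X' Y' P := by
    rw [IndepFun_iff_Indep]
    exact indep_of_indep_of_le h hX'.measurable.comap_le hY'.measurable.comap_le
  rw [integral_congr_ae hXX', integral_congr_ae hYY',
    ← hi.integral_fun_mul_eq_mul_integral (hX'.mono h₁).aestronglyMeasurable
      (hY'.mono h₂).aestronglyMeasurable]
  refine integral_congr_ae ?_
  filter_upwards [hXX', hYY'] with ω h1 h2
  rw [h1, h2]

/-- If, given `m`, the outcome `a` is Gaussian with mean `X` and variance `v`, then the error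
`a - X` is Gaussian with mean `0` and variance `v`, and it is independent of `m`. -/
lemma exists_indep_error_of_condExp_eq_gaussianReal [IsProbabilityMeasure P] (hm : m ≤ m0)
    {a X : Ω → ℝ} (ha : Measurable a) (hX : AEStronglyMeasurable[m] X P) {v : ℝ≥0}
    (h : ∀ A : Set ℝ, MeasurableSet A →
      P⟦a ⁻¹' A | m⟧ =ᵐ[P] fun ω => (gaussianReal (X ω) v).real A) :
    ∃ ν : Ω → ℝ, Measurable ν ∧ ν =ᵐ[P] (fun ω => a ω - X ω) ∧
      Indep m (MeasurableSpace.comap ν inferInstance) P ∧ HasLaw ν (gaussianReal 0 v) P := by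
  obtain ⟨X', hX', hXX'⟩ := hX
  have hX0 : Measurable X' := hX'.measurable.mono hm le_rfl
  have hg : ∀ A : Set ℝ, MeasurableSet A → Measurable fun x => gaussianReal x v A := fun A hA =>
    (Measure.measurable_coe hA).comp (measurable_gaussianReal.comp (measurable_id.prodMk
      measurable_const))
  -- The conditional law integrated over an `m`-measurable event, with `X` replaced by an
  -- `m`-measurable representative `X'`.
  have key : ∀ (B : Set Ω) (A : Set ℝ), MeasurableSet[m] B → MeasurableSet A →
      P (B ∩ a ⁻¹' A) = ∫⁻ ω in B, gaussianReal (X' ω) v A ∂P := by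
    intro B A hB hA
    have h1 : P⟦a ⁻¹' A | m⟧ =ᵐ[P] fun ω => (gaussianReal (X' ω) v).real A := by
      filter_upwards [h A hA, hXX'] with ω h1 h2
      rw [h1, h2]
    have h2 := setIntegral_condExp (μ := P) hm (f := (a ⁻¹' A).indicator fun _ => (1 : ℝ))
      ((integrable_const 1).indicator (ha hA)) hB
    rw [setIntegral_congr_ae (g := fun ω => (gaussianReal (X' ω) v).real A) (hm B hB)
      (by filter_upwards [h1] with ω hω _ using hω), integral_indicator_const _ (ha hA),
      smul_eq_mul, mul_one, measureReal_restrict_apply (ha hA), Set.inter_comm] at h2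
    rw [← ENNReal.ofReal_toReal (measure_ne_top P (B ∩ a ⁻¹' A)), ← measureReal_def, ← h2,
      ofReal_integral_eq_lintegral_ofReal ((integrable_condExp.congr h1).integrableOn)
      (ae_of_all _ fun _ => measureReal_nonneg)]
    exact lintegral_congr fun ω => ENNReal.ofReal_toReal (measure_ne_top _ _)
  have hν : Measurable fun ω => a ω - X' ω := ha.sub hX0
  have hrect : ∀ B : Set Ω, MeasurableSet[m] B → ∀ A : Set ℝ, MeasurableSet A →
      P (B ∩ (fun ω => a ω - X' ω) ⁻¹' A) = P B * gaussianReal 0 v A := by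
    intro B hB A hA
    -- On `B`, the pair `(X', a)` is the image of a product law under the shear `(x, z) ↦ (x, x +
    -- z)`. Applying the difference `a - X'` then leaves the second factor, whatever `B` is: this is
    -- independence and the law at once.
    have e1 : (P.restrict B).map (fun ω => (X' ω, a ω)) =
        (((P.restrict B).map X').prod (gaussianReal 0 v)).map fun p => (p.1, p.1 + p.2) := by
      have : IsFiniteMeasure ((P.restrict B).map X') := inferInstance
      refine Measure.ext_prod fun {s t} hs ht => ?_
      rw [Measure.map_apply (hX0.prodMk ha) (hs.prod ht),
        Measure.map_apply (by fun_prop) (hs.prod ht), Measure.prod_apply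
        ((hs.prod ht).preimage (by fun_prop))]
      have e2 : ∀ x, gaussianReal 0 v (Prod.mk x ⁻¹' ((fun p : ℝ × ℝ => (p.1, p.1 + p.2)) ⁻¹'
          s ×ˢ t)) = s.indicator (fun x => gaussianReal x v t) x := by
        intro x
        by_cases hx : x ∈ s
        · rw [Set.indicator_of_mem hx]
          have := gaussianReal_map_const_add (μ := 0) (v := v) x
          rw [zero_add] at this
          rw [← this, Measure.map_apply (by fun_prop) ht]
          congr 1
          ext z
          simp [hx]
        · rw [Set.indicator_of_notMem hx]
          convert measure_empty (μ := gaussianReal 0 v)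
          ext z
          simp [hx]
      simp_rw [e2]
      rw [lintegral_indicator hs, setLIntegral_map hs (hg t ht) hX0,
        Measure.restrict_restrict (hX0 hs), ← key _ _ ((hX'.measurable hs).inter hB) ht,
        Measure.restrict_apply ((hX0.prodMk ha) (hs.prod ht))]
      congr 1
      ext ω
      simp
      tauto
    have e3 := congrArg (fun μ => μ.map fun p : ℝ × ℝ => p.2 - p.1) e1
    rw [Measure.map_map (by fun_prop) (hX0.prodMk ha), Measure.map_map (by fun_prop)
      (by fun_prop)] at e3
    have e4 := congrArg (fun μ => μ A) e3
    have hf : ((fun p : ℝ × ℝ => p.2 - p.1) ∘ fun p : ℝ × ℝ => (p.1, p.1 + p.2)) = Prod.snd := by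
      ext p; simp
    rw [hf, Measure.map_apply (by exact hν) hA, Measure.restrict_apply (by exact hν hA),
      Measure.map_snd_prod, Measure.map_apply hX0 MeasurableSet.univ] at e4
    rw [Set.inter_comm]
    simp only [Set.preimage_univ, Measure.restrict_apply_univ, Measure.smul_apply,
      smul_eq_mul] at e4
    exact e4
  refine ⟨fun ω => a ω - X' ω, hν, ?_, ?_, ⟨hν.aemeasurable, ?_⟩⟩
  · filter_upwards [hXX'] with ω hω
    rw [hω]
  · rw [Indep_iff]
    rintro B _ hB ⟨A, hA, rfl⟩
    rw [hrect B hB A hA]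
    have h1 := hrect Set.univ MeasurableSet.univ A hA
    rw [Set.univ_inter, measure_univ, one_mul] at h1
    rw [h1]
  · ext A hA
    rw [Measure.map_apply hν hA, ← Set.univ_inter ((fun ω => a ω - X' ω) ⁻¹' A),
      hrect Set.univ MeasurableSet.univ A hA, measure_univ, one_mul]

lemma integral_sq_of_hasLaw_gaussianReal {X : Ω → ℝ} {v : ℝ≥0}
    (h : HasLaw X (gaussianReal 0 v) P) : ∫ ω, X ω ^ 2 ∂P = v := by
  have h1 := h.variance_eq
  rw [variance_id_gaussianReal, variance_of_integral_eq_zero h.aemeasurable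
    (by rw [h.integral_eq, integral_id_gaussianReal])] at h1
  exact h1

end Independence

/-! ### The σ-algebras of the past and of the noise. -/

section Sigma

variable {Ω M : Type*} [MeasurableSpace M] {T : ℝ} {y₀ : Ω → ℝ} {W : ℕ → ℝ≥0 → Ω → ℝ}
  {α : ℕ → Ω → M}

lemma measurable_noiseSigma (n : ℕ) {t : ℝ≥0} (ht : (t : ℝ) ≤ T) :
    Measurable[noiseSigma T W n] (W n t) :=
  Measurable.mono (comap_measurable _) (le_iSup₂_of_le t ht le_rfl) le_rfl

lemma pastSigma_mono {k n : ℕ} (h : k ≤ n) : pastSigma T y₀ W α k ≤ pastSigma T y₀ W α n :=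
  sup_le_sup_left (biSup_mono fun _ hi => hi.trans_le h) _

lemma noiseSigma_le_pastSigma {k n : ℕ} (h : k < n) :
    noiseSigma T W k ≤ pastSigma T y₀ W α n :=
  le_sup_of_le_right (le_iSup₂_of_le k h le_sup_left)

lemma comap_outcome_le_pastSigma {k n : ℕ} (h : k < n) :
    MeasurableSpace.comap (α k) inferInstance ≤ pastSigma T y₀ W α n :=
  le_sup_of_le_right (le_iSup₂_of_le k h le_sup_right)

variable [m0 : MeasurableSpace Ω]

lemma noiseSigma_le (hW : ∀ n t, Measurable (W n t)) (n : ℕ) : noiseSigma T W n ≤ m0 :=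
  iSup₂_le fun t _ => (hW n t).comap_le

lemma pastSigma_le (hy : Measurable y₀) (hW : ∀ n t, Measurable (W n t))
    (hα : ∀ n, Measurable (α n)) (n : ℕ) : pastSigma T y₀ W α n ≤ m0 :=
  sup_le hy.comap_le (iSup₂_le fun k _ => sup_le (noiseSigma_le hW k) (hα k).comap_le)

end Sigma

/-! ### Integrals of the path within one period. -/

section Path

variable {T D r c : ℝ} {f : ℝ → ℝ} {w : ℝ≥0 → ℝ}

lemma integral_path_eq (hw : Continuous w) (hr : 0 ≤ r) (hrT : r ≤ T)
    (hf : ∀ t : ℝ≥0, (t : ℝ) < T → f (c + t) = f c + D * w t) :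
    IntervalIntegrable f volume c (c + r) ∧
      ∫ s in c..(c + r), f s = r * f c + D * ∫ s in (0 : ℝ)..r, w s.toNNReal := by
  have hg : Continuous fun s : ℝ => f c + D * w s.toNNReal := by fun_prop
  -- The evolution equation stops short of `T`, where the synchronization has already acted;
  -- removing the single point `s = r` covers the case `r = T`.
  have hae : ∀ᵐ s ∂(volume : Measure ℝ), s ∈ Set.uIoc 0 r →
      f c + D * w s.toNNReal = f (c + s) := by
    filter_upwards [Measure.ae_ne volume r] with s hs hs'
    rw [Set.uIoc_of_le hr] at hs'
    have h1 := hf s.toNNReal (by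
      rw [Real.coe_toNNReal _ hs'.1.le]
      exact (lt_of_le_of_ne hs'.2 hs).trans_le hrT)
    rw [Real.coe_toNNReal _ hs'.1.le] at h1
    exact h1.symm
  have hint : IntervalIntegrable (fun s => f (c + s)) volume 0 r :=
    (hg.intervalIntegrable 0 r).congr_ae ((ae_restrict_iff' measurableSet_uIoc).2 hae)
  constructor
  · have h2 := hint.comp_add_left (-c)
    simpa [add_comm] using h2
  · have h2 := intervalIntegral.integral_comp_add_left (a := 0) (b := r) f c
    rw [add_zero] at h2
    have hw' : Continuous fun s : ℝ => w s.toNNReal := by fun_prop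
    rw [← h2, ← intervalIntegral.integral_congr_ae hae, intervalIntegral.integral_add,
      intervalIntegral.integral_const_mul, intervalIntegral.integral_const, smul_eq_mul, sub_zero]
    · exact intervalIntegrable_const
    · exact (hw'.intervalIntegrable 0 r).const_mul D

end Path

/-! ### The error recursion and its first two moments. -/

section State

variable {Ω : Type*} [m0 : MeasurableSpace Ω] {P : Measure Ω} {F T D ζ : ℝ} {hF : 0 < F}
  {y : ℝ → Ω → ℝ} {W : ℕ → ℝ≥0 → Ω → ℝ} {α ν : ℕ → Ω → ℝ}

lemma integral_sq_add {X Y : Ω → ℝ} (hX : MemLp X 2 P) (hY : MemLp Y 2 P)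
    (h : ∫ ω, X ω * Y ω ∂P = 0) :
    ∫ ω, (X ω + Y ω) ^ 2 ∂P = ∫ ω, X ω ^ 2 ∂P + ∫ ω, Y ω ^ 2 ∂P := by
  have h1 : ∀ ω, (X ω + Y ω) ^ 2 = X ω ^ 2 + 2 * (X ω * Y ω) + Y ω ^ 2 := fun ω => by ring
  have hXY : Integrable (fun ω => X ω * Y ω) P := hX.integrable_mul hY
  simp_rw [h1]
  have h2 : Integrable (fun ω => X ω ^ 2 + 2 * (X ω * Y ω)) P :=
    hX.integrable_sq.add (hXY.const_mul 2)
  rw [integral_add h2 hY.integrable_sq, integral_add hX.integrable_sq (hXY.const_mul 2),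
    integral_const_mul, h]
  ring

namespace IsClockState

variable (h : IsClockState (gaussianClock hF ζ) T D P y W α)

include h

lemma pastSigma_le (n : ℕ) : pastSigma T (y 0) W α n ≤ m0 :=
  AtomicClock.pastSigma_le h.measurable_init h.measurable_noise h.measurable_outcome n

lemma noiseSigma_le (n : ℕ) : noiseSigma T W n ≤ m0 :=
  AtomicClock.noiseSigma_le h.measurable_noise n

end IsClockState

end State

section State

variable {Ω : Type*} [m0 : MeasurableSpace Ω] {P : Measure Ω} {F T D ζ : ℝ} {hF : 0 < F}
  {y : ℝ → Ω → ℝ} {W : ℕ → ℝ≥0 → Ω → ℝ} {α ν : ℕ → Ω → ℝ}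

lemma aestronglyMeasurable_noise (hT : 0 < T) (n : ℕ) :
    AEStronglyMeasurable[noiseSigma T W n] (W n T.toNNReal) P :=
  (measurable_noiseSigma n (Real.coe_toNNReal _ hT.le).le).stronglyMeasurable.aestronglyMeasurable

lemma aestronglyMeasurable_outcome {k n : ℕ} (hk : k < n) :
    AEStronglyMeasurable[pastSigma T (y 0) W α n] (α k) P :=
  (Measurable.mono (comap_measurable (α k)) (comap_outcome_le_pastSigma hk)
    le_rfl).stronglyMeasurable.aestronglyMeasurable

namespace IsClockState

variable (h : IsClockState (gaussianClock hF ζ) T D P y W α)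

include h

lemma ae_integral_path :
    ∀ᵐ ω ∂P, ∀ (n : ℕ) (r : ℝ), 0 ≤ r → r ≤ T →
      IntervalIntegrable (fun s => y s ω) volume (n * T) (n * T + r) ∧
      ∫ s in (n * T)..(n * T + r), y s ω =
        r * syncError T y n ω + D * noiseIntegral (W n) r ω := by
  have hc : ∀ᵐ ω ∂P, ∀ n, Continuous (W n · ω) := ae_all_iff.2 fun n => (h.isBrownian n).cont
  filter_upwards [hc, h.evolution] with ω h1 h2 n r hr hrT
  exact integral_path_eq (h1 n) hr hrT (h2 n)

lemma avgError_ae_eq (hT : 0 < T) (n : ℕ) :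
    avgError T y n =ᵐ[P] fun ω => syncError T y n ω + D / T * noiseIntegral (W n) T ω := by
  filter_upwards [h.ae_integral_path] with ω hω
  have h1 := (hω n T hT.le le_rfl).2
  rw [avgError, intervalIntegral.integral_comp_add_left (fun s => y s ω), add_zero, h1]
  field_simp

lemma syncError_succ_ae_eq (n : ℕ) :
    syncError T y (n + 1) =ᵐ[P] fun ω =>
      syncError T y n ω + D * W n T.toNNReal ω - (1 - ζ) * α n ω := by
  filter_upwards [h.adjustment] with ω hω using hω n

lemma aestronglyMeasurable_noiseIntegral (hT : 0 < T) (n : ℕ) :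
    AEStronglyMeasurable[noiseSigma T W n] (noiseIntegral (W n) T) P :=
  AtomicClock.aestronglyMeasurable_noiseIntegral (h.isBrownian n) hT.le
    fun _ ht => measurable_noiseSigma n ht

/-- Adaptedness: the adjustment writes `y_{n+1}` through `y_n`, the noise and the outcome of period
`n`, all of which belong to the past at time `n + 1`. -/
lemma aestronglyMeasurable_syncError (hT : 0 < T) (n : ℕ) :
    AEStronglyMeasurable[pastSigma T (y 0) W α n] (syncError T y n) P := by
  induction n with
  | zero =>
    have h0 : syncError T y 0 = y 0 := by ext ω; simp [syncError]
    rw [h0]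
    exact AEStronglyMeasurable.mono (m' := pastSigma T (y 0) W α 0) le_sup_left
      (comap_measurable (y 0)).stronglyMeasurable.aestronglyMeasurable
  | succ n ih =>
    refine AEStronglyMeasurable.congr ?_ (h.syncError_succ_ae_eq n).symm
    exact ((ih.mono (pastSigma_mono n.le_succ)).add
      (((aestronglyMeasurable_noise hT n).mono
        (noiseSigma_le_pastSigma n.lt_succ_self)).const_mul D)).sub
      ((aestronglyMeasurable_outcome n.lt_succ_self).const_mul (1 - ζ))

lemma aestronglyMeasurable_avgError (hT : 0 < T) (n : ℕ) :
    AEStronglyMeasurable[pastSigma T (y 0) W α n ⊔ noiseSigma T W n] (avgError T y n) P := by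
  have h1 : AEStronglyMeasurable[pastSigma T (y 0) W α n ⊔ noiseSigma T W n]
      (syncError T y n) P := (h.aestronglyMeasurable_syncError hT n).mono le_sup_left
  have h2 : AEStronglyMeasurable[pastSigma T (y 0) W α n ⊔ noiseSigma T W n]
      (noiseIntegral (W n) T) P := (h.aestronglyMeasurable_noiseIntegral hT n).mono le_sup_right
  exact (h1.add (h2.const_mul (D / T))).congr (h.avgError_ae_eq hT n).symm

end IsClockState

/-- `ν n` is the error `α n - ȳ n` of the `n`-th measurement. -/
structure IsOutcomeError (F T : ℝ) (P : Measure Ω) (y : ℝ → Ω → ℝ) (W : ℕ → ℝ≥0 → Ω → ℝ)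
    (α ν : ℕ → Ω → ℝ) : Prop where
  measurable : ∀ n, Measurable (ν n)
  ae_eq : ∀ n, ν n =ᵐ[P] fun ω => α n ω - avgError T y n ω
  indep : ∀ n, Indep (pastSigma T (y 0) W α n ⊔ noiseSigma T W n)
    (MeasurableSpace.comap (ν n) inferInstance) P
  hasLaw : ∀ n, HasLaw (ν n) (gaussianReal 0 (1 / F).toNNReal) P

lemma IsOutcomeError.memLp (hν : IsOutcomeError F T P y W α ν) (n : ℕ) : MemLp (ν n) 2 P :=
  (hν.hasLaw n).hasGaussianLaw.memLp_two

namespace IsClockState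

variable (h : IsClockState (gaussianClock hF ζ) T D P y W α)

include h

/-- The mean `ȳ_n` is determined by the past and the current noise, and the outcome is Gaussian
around it, so measurement acts as independent additive noise. -/
lemma exists_isOutcomeError [IsProbabilityMeasure P] (hT : 0 < T) :
    ∃ ν, IsOutcomeError F T P y W α ν := by
  have key := fun n => exists_indep_error_of_condExp_eq_gaussianReal
    (sup_le (h.pastSigma_le n) (h.noiseSigma_le n)) (h.measurable_outcome n)
    (h.aestronglyMeasurable_avgError hT n) (v := (1 / F).toNNReal)
    (fun A hA => by
      filter_upwards [h.outcome_law n A hA] with ω hω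
      rw [hω, outcomeProb_gaussianClock hF ζ _ hA])
  choose ν h1 h2 h3 h4 using key
  exact ⟨ν, h1, h2, h3, h4⟩

lemma integral_mul_outcomeError (hν : IsOutcomeError F T P y W α ν) (n : ℕ) {Z : Ω → ℝ}
    (hZ : AEStronglyMeasurable[pastSigma T (y 0) W α n ⊔ noiseSigma T W n] Z P) :
    ∫ ω, Z ω * ν n ω ∂P = 0 := by
  rw [integral_mul_of_indep (sup_le (h.pastSigma_le n) (h.noiseSigma_le n))
    (hν.measurable n).comap_le (hν.indep n) hZ
    (comap_measurable (ν n)).stronglyMeasurable.aestronglyMeasurable,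
    (hν.hasLaw n).integral_eq, integral_id_gaussianReal, mul_zero]

lemma integral_mul_noise {n : ℕ} {Z A : Ω → ℝ}
    (hZ : AEStronglyMeasurable[pastSigma T (y 0) W α n] Z P)
    (hA : AEStronglyMeasurable[noiseSigma T W n] A P) (hA0 : ∫ ω, A ω ∂P = 0) :
    ∫ ω, Z ω * A ω ∂P = 0 := by
  rw [integral_mul_of_indep (h.pastSigma_le n) (h.noiseSigma_le n) (h.indep_noise n) hZ hA, hA0,
    mul_zero]

end IsClockState

/-- The noise that the local oscillator adds to the frequency error between two
synchronizations. -/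
noncomputable def periodNoise (T D ζ : ℝ) (w : ℝ≥0 → Ω → ℝ) (ω : Ω) : ℝ :=
  D * w T.toNNReal ω - (1 - ζ) * (D / T) * noiseIntegral w T ω

section PeriodNoise

variable [IsProbabilityMeasure P] {w : ℝ≥0 → Ω → ℝ} (hw : IsBrownianReal w P)
  (hm : ∀ t, Measurable (w t)) (hT : 0 < T)

include hw hm hT

lemma memLp_periodNoise : MemLp (periodNoise T D ζ w) 2 P :=
  ((memLp_brownian hw _).const_mul D).sub ((memLp_noiseIntegral hw hm hT.le).const_mul _)

lemma integral_periodNoise : ∫ ω, periodNoise T D ζ w ω ∂P = 0 := by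
  simp only [periodNoise]
  rw [integral_sub (((memLp_brownian hw _).integrable one_le_two).const_mul D)
    (((memLp_noiseIntegral hw hm hT.le).integrable one_le_two).const_mul _), integral_const_mul,
    integral_const_mul, integral_noiseIntegral hw hm hT.le, hw.integral_eval]
  simp

/-- With the moments `T`, `T²/2` and `T³/3` of `W_T²`, `W_T ∫ W` and `(∫ W)²`, the value is `D² T (1
- (1 - ζ) + (1 - ζ)²/3)`. -/
lemma integral_sq_periodNoise :
    ∫ ω, periodNoise T D ζ w ω ^ 2 ∂P = D ^ 2 * T / 3 * (1 + ζ + ζ ^ 2) := by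
  have h1 : ∀ ω, periodNoise T D ζ w ω ^ 2 = D ^ 2 * w T.toNNReal ω ^ 2
      - 2 * D * ((1 - ζ) * (D / T)) * (w T.toNNReal ω * noiseIntegral w T ω)
      + ((1 - ζ) * (D / T)) ^ 2 * noiseIntegral w T ω ^ 2 := fun ω => by
    rw [periodNoise]; ring
  have i1 : Integrable (fun ω => D ^ 2 * w T.toNNReal ω ^ 2) P :=
    (memLp_brownian hw _).integrable_sq.const_mul _
  have i2 : Integrable (fun ω => 2 * D * ((1 - ζ) * (D / T)) *
      (w T.toNNReal ω * noiseIntegral w T ω)) P :=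
    ((memLp_brownian hw _).integrable_mul (memLp_noiseIntegral hw hm hT.le)).const_mul _
  have i12 : Integrable (fun ω => D ^ 2 * w T.toNNReal ω ^ 2 - 2 * D * ((1 - ζ) * (D / T)) *
      (w T.toNNReal ω * noiseIntegral w T ω)) P := i1.sub i2
  simp_rw [h1]
  rw [integral_add i12 ((memLp_noiseIntegral hw hm hT.le).integrable_sq.const_mul _),
    integral_sub i1 i2, integral_const_mul, integral_const_mul, integral_const_mul,
    integral_sq_brownian hw, integral_brownian_mul_noiseIntegral hw hm hT.le le_rfl,
    integral_sq_noiseIntegral hw hm hT.le, Real.coe_toNNReal _ hT.le]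
  field_simp
  ring

end PeriodNoise

lemma aestronglyMeasurable_periodNoise (hw : ∀ n, IsBrownianReal (W n) P) (hT : 0 < T) (n : ℕ) :
    AEStronglyMeasurable[noiseSigma T W n] (periodNoise T D ζ (W n)) P :=
  ((aestronglyMeasurable_noise hT n).const_mul D).sub
    ((AtomicClock.aestronglyMeasurable_noiseIntegral (hw n) hT.le
      fun _ ht => measurable_noiseSigma n ht).const_mul _)

namespace IsClockState

variable (h : IsClockState (gaussianClock hF ζ) T D P y W α)

include h

/-- The outcome is `y_n + (D/T) ∫ W + ν_n`; substituting it leaves the fraction `ζ` of the old error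
plus two independent innovations. All moments of `y_n` used below come from this autoregression. -/
lemma syncError_succ_ae_eq_add (hT : 0 < T) (hν : IsOutcomeError F T P y W α ν) (n : ℕ) :
    syncError T y (n + 1) =ᵐ[P] fun ω =>
      ζ * syncError T y n ω + periodNoise T D ζ (W n) ω + -(1 - ζ) * ν n ω := by
  filter_upwards [h.syncError_succ_ae_eq n, h.avgError_ae_eq hT n, hν.ae_eq n] with ω h1 h2 h3
  rw [h1, h3, h2, periodNoise]
  ring

variable [IsProbabilityMeasure P]

lemma loVariance_eq (hT : 0 < T) (n : ℕ) : loVariance P T y n = D ^ 2 * T / 3 := by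
  have h1 : (fun ω => (avgError T y n ω - syncError T y n ω) ^ 2) =ᵐ[P]
      fun ω => (D / T) ^ 2 * noiseIntegral (W n) T ω ^ 2 := by
    filter_upwards [h.avgError_ae_eq hT n] with ω hω
    rw [hω]
    ring
  rw [loVariance, integral_congr_ae h1, integral_const_mul,
    integral_sq_noiseIntegral (h.isBrownian n) (h.measurable_noise n) hT.le]
  field_simp

/-- The mean square displacement after time `s` is `D² s`. Its average `D² T/2` is `3/2` times `D²
T/3`, whence `a = 1`; its final value `D² T` is three times `D² T/3`, whence `b = 3`. -/
lemma isNoiseConstants (hT : 0 < T) (n : ℕ) : IsNoiseConstants P T D y W n 1 3 := by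
  rw [IsNoiseConstants, h.loVariance_eq hT]
  constructor
  · have h1 : ∫ s in (0 : ℝ)..T, ∫ ω, (y (n * T + s) ω - syncError T y n ω) ^ 2 ∂P =
        ∫ s in (0 : ℝ)..T, D ^ 2 * s := by
      refine intervalIntegral.integral_congr_ae ?_
      filter_upwards [Measure.ae_ne volume T] with s hs hs'
      rw [Set.uIoc_of_le hT.le] at hs'
      have hs0 : (s.toNNReal : ℝ) = s := Real.coe_toNNReal _ hs'.1.le
      have h2 : (fun ω => (y (n * T + s) ω - syncError T y n ω) ^ 2) =ᵐ[P]
          fun ω => D ^ 2 * W n s.toNNReal ω ^ 2 := by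
        filter_upwards [h.evolution] with ω hω
        have h3 := hω n s.toNNReal (by rw [hs0]; exact lt_of_le_of_ne hs'.2 hs)
        rw [hs0] at h3
        rw [h3, syncError]
        ring
      rw [integral_congr_ae h2, integral_const_mul, integral_sq_brownian (h.isBrownian n), hs0]
    rw [h1, intervalIntegral.integral_const_mul, integral_id]
    field_simp
    ring
  · have h1 : ∀ ω, ((syncError T y n ω + D * W n T.toNNReal ω) - syncError T y n ω) ^ 2 =
        D ^ 2 * W n T.toNNReal ω ^ 2 := fun ω => by ring
    simp_rw [h1]
    rw [integral_const_mul, integral_sq_brownian (h.isBrownian n), Real.coe_toNNReal _ hT.le]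
    ring

variable (hT : 0 < T) (hY : ∀ n, MemLp (syncError T y n) 2 P)

include hT hY

lemma integral_syncError_succ (n : ℕ) :
    ∫ ω, syncError T y (n + 1) ω ∂P = ζ * ∫ ω, syncError T y n ω ∂P := by
  obtain ⟨ν, hν⟩ := h.exists_isOutcomeError hT
  have i1 := ((hY n).integrable one_le_two).const_mul ζ
  have i2 : Integrable (periodNoise T D ζ (W n)) P :=
    (memLp_periodNoise (h.isBrownian n) (h.measurable_noise n) hT).integrable one_le_two
  have i3 := ((hν.memLp n).integrable one_le_two).const_mul (-(1 - ζ))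
  have i12 : Integrable (fun ω => ζ * syncError T y n ω + periodNoise T D ζ (W n) ω) P :=
    i1.add i2
  rw [integral_congr_ae (h.syncError_succ_ae_eq_add hT hν n), integral_add i12 i3,
    integral_add i1 i2, integral_const_mul, integral_const_mul, (hν.hasLaw n).integral_eq,
    integral_id_gaussianReal,
    integral_periodNoise (h.isBrownian n) (h.measurable_noise n) hT]
  ring

/-- Pythagoras: the period noise is centered and independent of the past, and the measurement error
is centered and independent of both. -/
lemma integral_sq_syncError_succ (n : ℕ) :
    ∫ ω, syncError T y (n + 1) ω ^ 2 ∂P = ζ ^ 2 * ∫ ω, syncError T y n ω ^ 2 ∂P +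
      D ^ 2 * T / 3 * (1 + ζ + ζ ^ 2) + (1 - ζ) ^ 2 * (1 / F) := by
  obtain ⟨ν, hν⟩ := h.exists_isOutcomeError hT
  have i2 := memLp_periodNoise (D := D) (ζ := ζ) (h.isBrownian n) (h.measurable_noise n) hT
  have m1 : AEStronglyMeasurable[pastSigma T (y 0) W α n] (fun ω => ζ * syncError T y n ω) P :=
    (h.aestronglyMeasurable_syncError hT n).const_mul ζ
  have m2 : AEStronglyMeasurable[noiseSigma T W n] (periodNoise T D ζ (W n)) P :=
    aestronglyMeasurable_periodNoise h.isBrownian hT n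
  have m3 : AEStronglyMeasurable[pastSigma T (y 0) W α n ⊔ noiseSigma T W n]
      (fun ω => ζ * syncError T y n ω + periodNoise T D ζ (W n) ω) P :=
    AEStronglyMeasurable.add (m := pastSigma T (y 0) W α n ⊔ noiseSigma T W n)
      (m1.mono le_sup_left) (m2.mono le_sup_right)
  have e1 : ∫ ω, (ζ * syncError T y n ω) * periodNoise T D ζ (W n) ω ∂P = 0 :=
    h.integral_mul_noise m1 m2
      (integral_periodNoise (h.isBrownian n) (h.measurable_noise n) hT)
  have e2 : ∫ ω, (ζ * syncError T y n ω + periodNoise T D ζ (W n) ω) *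
      (-(1 - ζ) * ν n ω) ∂P = 0 := by
    have := h.integral_mul_outcomeError hν n m3
    simp_rw [mul_left_comm _ (-(1 - ζ))]
    rw [integral_const_mul, this, mul_zero]
  have h1 : (fun ω => syncError T y (n + 1) ω ^ 2) =ᵐ[P] fun ω =>
      ((ζ * syncError T y n ω + periodNoise T D ζ (W n) ω) + -(1 - ζ) * ν n ω) ^ 2 := by
    filter_upwards [h.syncError_succ_ae_eq_add hT hν n] with ω hω
    rw [hω]
  have i12 : MemLp (fun ω => ζ * syncError T y n ω + periodNoise T D ζ (W n) ω) 2 P :=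
    ((hY n).const_mul ζ).add i2
  rw [integral_congr_ae h1, integral_sq_add i12 ((hν.memLp n).const_mul _) e2,
    integral_sq_add ((hY n).const_mul ζ) i2 e1,
    integral_sq_periodNoise (h.isBrownian n) (h.measurable_noise n) hT]
  simp_rw [mul_pow]
  rw [integral_const_mul, integral_const_mul, integral_sq_of_hasLaw_gaussianReal (hν.hasLaw n),
    Real.coe_toNNReal _ (by positivity)]
  ring

end IsClockState
end State
lemma aestronglyMeasurable_sum_range {Ω : Type*} {m m0 : MeasurableSpace Ω} {P : Measure Ω}
    {f : ℕ → Ω → ℝ} (n : ℕ) (hf : ∀ k < n, AEStronglyMeasurable[m] (f k) P) :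
    AEStronglyMeasurable[m] (fun ω => ∑ k ∈ Finset.range n, f k ω) P := by
  induction n with
  | zero => simpa using aestronglyMeasurable_const
  | succ n ih =>
    simp_rw [Finset.sum_range_succ]
    exact (ih fun k hk => hf k (hk.trans n.lt_succ_self)).add (hf n n.lt_succ_self)

/-! ### Growth of the clock time, and moments of stationary states. -/

section ClockTime

variable {Ω : Type*} [m0 : MeasurableSpace Ω] {P : Measure Ω} {F T D ζ : ℝ} {hF : 0 < F}
  {y : ℝ → Ω → ℝ} {W : ℕ → ℝ≥0 → Ω → ℝ} {α ν : ℕ → Ω → ℝ}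

/-- The increment over one period of the martingale part of the clock time. -/
noncomputable def clockStep (T D ζ : ℝ) (w : ℝ≥0 → Ω → ℝ) (e : Ω → ℝ) (ω : Ω) : ℝ :=
  T / (1 - ζ) * D * w T.toNNReal ω + -T * e ω

/-- The difference between the clock time and its martingale part, at the time `n T + r`. -/
noncomputable def clockRest (T D ζ : ℝ) (y : ℝ → Ω → ℝ) (W : ℕ → ℝ≥0 → Ω → ℝ) (n : ℕ) (r : ℝ)
    (ω : Ω) : ℝ :=
  T / (1 - ζ) * syncError T y 0 ω + (r - T / (1 - ζ)) * syncError T y n ω +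
    D * noiseIntegral (W n) r ω

/-- From `2|MR| ≤ ε M² + ε⁻¹ R²`. The parameter stays free because it is later tuned to the growth
of `M` against a bounded `R`. -/
lemma abs_integral_sq_add_sub_le {M R : Ω → ℝ} (hM : MemLp M 2 P) (hR : MemLp R 2 P) {ε : ℝ}
    (hε : 0 < ε) :
    |∫ ω, (M ω + R ω) ^ 2 ∂P - ∫ ω, M ω ^ 2 ∂P| ≤
      ε * ∫ ω, M ω ^ 2 ∂P + (1 + ε⁻¹) * ∫ ω, R ω ^ 2 ∂P := by
  have hMR : Integrable (fun ω => (M ω + R ω) ^ 2) P := (hM.add hR).integrable_sq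
  rw [← integral_sub hMR hM.integrable_sq, ← integral_const_mul, ← integral_const_mul,
    ← integral_add (hM.integrable_sq.const_mul _) (hR.integrable_sq.const_mul _)]
  refine (abs_integral_le_integral_abs).trans (integral_mono (hMR.sub hM.integrable_sq).abs
    ((hM.integrable_sq.const_mul _).add (hR.integrable_sq.const_mul _)) fun ω => ?_)
  have h1 : 0 ≤ ε⁻¹ * (ε * M ω + R ω) ^ 2 := by positivity
  have h2 : 0 ≤ ε⁻¹ * (ε * M ω - R ω) ^ 2 := by positivity
  have h3 : ε⁻¹ * (ε * M ω + R ω) ^ 2 = ε * M ω ^ 2 + 2 * (M ω * R ω) + ε⁻¹ * R ω ^ 2 := by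
    field_simp
    ring
  have h4 : ε⁻¹ * (ε * M ω - R ω) ^ 2 = ε * M ω ^ 2 - 2 * (M ω * R ω) + ε⁻¹ * R ω ^ 2 := by
    field_simp
    ring
  simp only [abs_le]
  constructor <;> nlinarith [sq_nonneg (R ω)]

/-- A function of time whose values are `c n` up to `O(√n)` after `n` periods grows like
`c / T`. -/
lemma tendsto_div_of_abs_sub_le {f : ℝ → ℝ} {c C T : ℝ} (hT : 0 < T)
    (hf : ∀ (n : ℕ) (r : ℝ), 0 ≤ r → r ≤ T → |f (n * T + r) - n * c| ≤ C * (√(n + 1) + 1)) :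
    Tendsto (fun t => f t / t) atTop (𝓝 (c / T)) := by
  have hC : 0 ≤ C := by
    have h1 := (abs_nonneg _).trans (hf 0 0 le_rfl hT.le)
    have h2 : 0 < √((0 : ℕ) + 1 : ℝ) + 1 := by positivity
    exact nonneg_of_mul_nonneg_left h1 h2
  rw [tendsto_iff_norm_sub_tendsto_zero]
  have hlim : Tendsto (fun t : ℝ => (C * (√(2 / T) + 1) + |c|) * (√t)⁻¹) atTop (𝓝 0) := by
    have h1 : Tendsto (fun t : ℝ => (√t)⁻¹) atTop (𝓝 0) :=
      tendsto_inv_atTop_zero.comp Real.tendsto_sqrt_atTop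
    simpa using h1.const_mul (C * (√(2 / T) + 1) + |c|)
  refine squeeze_zero' (Eventually.of_forall fun _ => norm_nonneg _) ?_ hlim
  filter_upwards [eventually_ge_atTop T, eventually_ge_atTop 1] with t htT ht1
  have ht0 : 0 < t := by linarith
  set n := ⌊t / T⌋₊ with hn
  have hn1 : (n : ℝ) ≤ t / T := Nat.floor_le (by positivity)
  have hn2 : t / T < n + 1 := Nat.lt_floor_add_one _
  rw [le_div_iff₀ hT] at hn1
  rw [div_lt_iff₀ hT] at hn2
  have h1 := hf n (t - n * T) (by linarith) (by linarith)
  rw [add_sub_cancel] at h1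
  have h2 : √((n : ℝ) + 1) ≤ √(2 / T) * √t := by
    rw [← Real.sqrt_mul (by positivity)]
    refine Real.sqrt_le_sqrt ?_
    rw [div_mul_eq_mul_div, le_div_iff₀ hT]
    linarith
  have h3 : 1 ≤ √t := Real.one_le_sqrt.2 ht1
  have h4 : |(n : ℝ) * c - c * t / T| ≤ |c| := by
    have : (n : ℝ) * c - c * t / T = c * ((n * T - t) / T) := by field_simp
    rw [this, abs_mul]
    refine mul_le_of_le_one_right (abs_nonneg _) ?_
    rw [abs_div, abs_of_pos hT, div_le_one hT, abs_le]
    constructor <;> linarith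
  have h5 : |f t - c * t / T| ≤ (C * (√(2 / T) + 1) + |c|) * √t := by
    calc |f t - c * t / T| ≤ |f t - n * c| + |n * c - c * t / T| := abs_sub_le _ _ _
      _ ≤ C * (√(2 / T) * √t + √t) + |c| * √t := by
        refine add_le_add (h1.trans ?_) (h4.trans (le_mul_of_one_le_right (abs_nonneg _) h3))
        exact mul_le_mul_of_nonneg_left (add_le_add h2 h3) hC
      _ = _ := by ring
  have h6 : f t / t - c / T = (f t - c * t / T) / t := by field_simp
  rw [h6, Real.norm_eq_abs, abs_div, abs_of_pos ht0, div_le_iff₀ ht0]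
  refine h5.trans (le_of_eq ?_)
  have h7 : √t * √t = t := Real.mul_self_sqrt ht0.le
  have h8 : √t ≠ 0 := by positivity
  field_simp
  rw [sq, h7]

namespace IsClockState

variable (h : IsClockState (gaussianClock hF ζ) T D P y W α)

include h

/-- Solving the update rule for the integral over period `k` gives `T/(1 - ζ) (D W_T + y_k -
y_{k+1}) - T ν_k`. The errors telescope to boundary terms, which join the last incomplete period in
`clockRest`. -/
lemma clockTimeError_ae_eq (hT : 0 < T) (hζ : |ζ| < 1) (hν : IsOutcomeError F T P y W α ν)
    (n : ℕ) {r : ℝ} (hr : 0 ≤ r) (hrT : r ≤ T) :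
    clockTimeError y (n * T + r) =ᵐ[P] fun ω =>
      ∑ k ∈ Finset.range n, clockStep T D ζ (W k) (ν k) ω + clockRest T D ζ y W n r ω := by
  have hζ1 : 1 - ζ ≠ 0 := by linarith [(abs_lt.1 hζ).2]
  filter_upwards [h.ae_integral_path, ae_all_iff.2 fun k => h.syncError_succ_ae_eq k,
    ae_all_iff.2 fun k => h.avgError_ae_eq hT k, ae_all_iff.2 hν.ae_eq] with ω h1 h2 h3 h4
  have key : ∀ k : ℕ, IntervalIntegrable (fun s => y s ω) volume 0 (k * T) ∧
      ∫ s in (0 : ℝ)..k * T, y s ω = ∑ i ∈ Finset.range k, clockStep T D ζ (W i) (ν i) ω +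
        T / (1 - ζ) * (syncError T y 0 ω - syncError T y k ω) := by
    intro k
    induction k with
    | zero => simp
    | succ k ih =>
      have h5 := h1 k T hT.le le_rfl
      have h6 : ((k + 1 : ℕ) : ℝ) * T = k * T + T := by push_cast; ring
      rw [h6]
      refine ⟨ih.1.trans h5.1, ?_⟩
      rw [← intervalIntegral.integral_add_adjacent_intervals ih.1 h5.1, ih.2, h5.2,
        Finset.sum_range_succ, h2 k, clockStep, h4 k, h3 k]
      field_simp
      ring
  have h5 := h1 n r hr hrT
  rw [clockTimeError, ← intervalIntegral.integral_add_adjacent_intervals (key n).1 h5.1,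
    (key n).2, h5.2, clockRest]
  ring

lemma aestronglyMeasurable_clockStep (hT : 0 < T) (hν : IsOutcomeError F T P y W α ν)
    {k n : ℕ} (hk : k < n) :
    AEStronglyMeasurable[pastSigma T (y 0) W α n] (clockStep T D ζ (W k) (ν k)) P := by
  have h1 : AEStronglyMeasurable[pastSigma T (y 0) W α n] (avgError T y k) P :=
    (h.aestronglyMeasurable_avgError hT k).mono
      (sup_le (pastSigma_mono hk.le) (noiseSigma_le_pastSigma hk))
  have h2 : AEStronglyMeasurable[pastSigma T (y 0) W α n] (ν k) P :=
    ((aestronglyMeasurable_outcome hk).sub h1).congr (hν.ae_eq k).symm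
  have h3 : AEStronglyMeasurable[pastSigma T (y 0) W α n] (W k T.toNNReal) P :=
    (aestronglyMeasurable_noise hT k).mono (noiseSigma_le_pastSigma hk)
  exact (h3.const_mul _).add (h2.const_mul _)

lemma memLp_clockStep (hν : IsOutcomeError F T P y W α ν) (n : ℕ) :
    MemLp (clockStep T D ζ (W n) (ν n)) 2 P :=
  ((memLp_brownian (h.isBrownian n) _).const_mul _).add ((hν.memLp n).const_mul _)

variable [IsProbabilityMeasure P]

lemma integral_sq_clockStep (hT : 0 < T) (hν : IsOutcomeError F T P y W α ν) (n : ℕ) :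
    ∫ ω, clockStep T D ζ (W n) (ν n) ω ^ 2 ∂P =
      T ^ 2 * (1 / F) + T ^ 2 * (D ^ 2 * T) / (1 - ζ) ^ 2 := by
  have e1 : ∫ ω, (T / (1 - ζ) * D * W n T.toNNReal ω) * (-T * ν n ω) ∂P = 0 := by
    have h1 : AEStronglyMeasurable[pastSigma T (y 0) W α n ⊔ noiseSigma T W n]
        (fun ω => T / (1 - ζ) * D * W n T.toNNReal ω) P :=
      AEStronglyMeasurable.mono le_sup_right ((aestronglyMeasurable_noise hT n).const_mul _)
    have := h.integral_mul_outcomeError hν n h1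
    simp_rw [mul_left_comm _ (-T)]
    rw [integral_const_mul, this, mul_zero]
  simp_rw [clockStep]
  rw [integral_sq_add ((memLp_brownian (h.isBrownian n) _).const_mul _)
    ((hν.memLp n).const_mul _) e1]
  simp_rw [mul_pow]
  rw [integral_const_mul, integral_const_mul, integral_sq_of_hasLaw_gaussianReal (hν.hasLaw n),
    Real.coe_toNNReal _ (by positivity), integral_sq_brownian (h.isBrownian n),
    Real.coe_toNNReal _ hT.le, div_pow]
  ring

/-- The increments are orthogonal: the sum up to `n` belongs to the past, while `W_n(T)` and `ν_n`
are centered and independent of it. -/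
lemma integral_sq_sum_clockStep (hT : 0 < T) (hν : IsOutcomeError F T P y W α ν) (n : ℕ) :
    ∫ ω, (∑ k ∈ Finset.range n, clockStep T D ζ (W k) (ν k) ω) ^ 2 ∂P =
      n * (T ^ 2 * (1 / F) + T ^ 2 * (D ^ 2 * T) / (1 - ζ) ^ 2) := by
  induction n with
  | zero => simp
  | succ n ih =>
    have hM : AEStronglyMeasurable[pastSigma T (y 0) W α n]
        (fun ω => ∑ k ∈ Finset.range n, clockStep T D ζ (W k) (ν k) ω) P := by
      exact aestronglyMeasurable_sum_range n fun k hk =>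
        h.aestronglyMeasurable_clockStep hT hν hk
    have hM2 : MemLp (fun ω => ∑ k ∈ Finset.range n, clockStep T D ζ (W k) (ν k) ω) 2 P :=
      memLp_finsetSum _ fun k _ => h.memLp_clockStep hν k
    have i1 := hM2.integrable_mul ((memLp_brownian (h.isBrownian n) T.toNNReal).const_mul
      (T / (1 - ζ) * D))
    have i2 := hM2.integrable_mul ((hν.memLp n).const_mul (-T))
    have e1 := h.integral_mul_noise hM (aestronglyMeasurable_noise hT n)
      ((h.isBrownian n).integral_eval _)
    have e2 := h.integral_mul_outcomeError hν n (hM.mono le_sup_left)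
    have e0 : ∫ ω, (∑ k ∈ Finset.range n, clockStep T D ζ (W k) (ν k) ω) *
        clockStep T D ζ (W n) (ν n) ω ∂P = 0 := by
      simp_rw [clockStep.eq_1 T D ζ (W n), mul_add]
      refine (integral_add i1 i2).trans ?_
      simp_rw [Pi.mul_apply, mul_left_comm _ (-T), mul_left_comm _ (T / (1 - ζ) * D)]
      rw [integral_const_mul, integral_const_mul, e1, e2, mul_zero, mul_zero, add_zero]
    simp_rw [Finset.sum_range_succ]
    rw [integral_sq_add hM2 (h.memLp_clockStep hν n) e0, ih, h.integral_sq_clockStep hT hν]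
    push_cast
    ring

lemma memLp_clockRest (hY : ∀ n, MemLp (syncError T y n) 2 P) (n : ℕ) {r : ℝ} (hr : 0 ≤ r) : MemLp (clockRest T D ζ y W n r) 2 P :=
  (((hY 0).const_mul _).add ((hY n).const_mul _)).add
    ((memLp_noiseIntegral (h.isBrownian n) (h.measurable_noise n) hr).const_mul _)

/-- From `(a + b + c)² ≤ 3 (a² + b² + c²)`. What matters is that the bound depends on neither `n`
nor `r`, since the second moments of the errors are constant. -/
lemma integral_sq_clockRest_le (hY : ∀ n, MemLp (syncError T y n) 2 P)
    {S : ℝ} (hS : ∀ n, ∫ ω, syncError T y n ω ^ 2 ∂P = S) (n : ℕ)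
    {r : ℝ} (hr : 0 ≤ r) (hrT : r ≤ T) :
    ∫ ω, clockRest T D ζ y W n r ω ^ 2 ∂P ≤
      3 * ((T / (1 - ζ)) ^ 2 * S + 2 * (T ^ 2 + (T / (1 - ζ)) ^ 2) * S + D ^ 2 * T ^ 3) := by
  have i1 := (hY 0).integrable_sq.const_mul ((T / (1 - ζ)) ^ 2)
  have i2 := (hY n).integrable_sq.const_mul ((r - T / (1 - ζ)) ^ 2)
  have i3 := (memLp_noiseIntegral (h.isBrownian n) (h.measurable_noise n)
    hr).integrable_sq.const_mul (D ^ 2)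
  have i12 : Integrable (fun ω => (T / (1 - ζ)) ^ 2 * syncError T y 0 ω ^ 2 +
      (r - T / (1 - ζ)) ^ 2 * syncError T y n ω ^ 2) P := i1.add i2
  have i123 : Integrable (fun ω => (T / (1 - ζ)) ^ 2 * syncError T y 0 ω ^ 2 +
      (r - T / (1 - ζ)) ^ 2 * syncError T y n ω ^ 2 + D ^ 2 * noiseIntegral (W n) r ω ^ 2) P :=
    i12.add i3
  have h1 : ∫ ω, clockRest T D ζ y W n r ω ^ 2 ∂P ≤
      ∫ ω, 3 * ((T / (1 - ζ)) ^ 2 * syncError T y 0 ω ^ 2 +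
      (r - T / (1 - ζ)) ^ 2 * syncError T y n ω ^ 2 + D ^ 2 * noiseIntegral (W n) r ω ^ 2) ∂P := by
    refine integral_mono (h.memLp_clockRest hY n hr).integrable_sq (i123.const_mul 3)
      fun ω => ?_
    simp only [clockRest]
    simp only [← mul_pow]
    generalize T / (1 - ζ) * syncError T y 0 ω = a
    generalize (r - T / (1 - ζ)) * syncError T y n ω = b
    generalize D * noiseIntegral (W n) r ω = c
    nlinarith [sq_nonneg (a - b), sq_nonneg (a - c), sq_nonneg (b - c)]
  have hS0 : 0 ≤ S := (hS 0) ▸ integral_nonneg fun _ => sq_nonneg _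
  refine h1.trans ?_
  rw [integral_const_mul, integral_add i12 i3, integral_add i1 i2, integral_const_mul,
    integral_const_mul, integral_const_mul, hS, hS,
    integral_sq_noiseIntegral (h.isBrownian n) (h.measurable_noise n) hr]
  have h2 : (r - T / (1 - ζ)) ^ 2 ≤ 2 * (T ^ 2 + (T / (1 - ζ)) ^ 2) := by
    have : r ^ 2 ≤ T ^ 2 := pow_le_pow_left₀ hr hrT 2
    nlinarith [sq_nonneg (r + T / (1 - ζ))]
  have h3 : r ^ 3 / 3 ≤ T ^ 3 := by
    have : r ^ 3 ≤ T ^ 3 := pow_le_pow_left₀ hr hrT 3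
    have : 0 ≤ r ^ 3 := by positivity
    linarith
  gcongr

lemma tendsto_clockTimeError (hT : 0 < T) (hY : ∀ n, MemLp (syncError T y n) 2 P) (hζ : |ζ| < 1) {S : ℝ}
    (hS : ∀ n, ∫ ω, syncError T y n ω ^ 2 ∂P = S) :
    Tendsto (fun t : ℝ => (∫ ω, clockTimeError y t ω ^ 2 ∂P) / t) atTop
      (𝓝 (T * (1 / F) + T * (D ^ 2 * T) / (1 - ζ) ^ 2)) := by
  obtain ⟨ν, hν⟩ := h.exists_isOutcomeError hT
  set c := T ^ 2 * (1 / F) + T ^ 2 * (D ^ 2 * T) / (1 - ζ) ^ 2 with hc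
  have hc0 : 0 ≤ c := by positivity
  set K := 3 * ((T / (1 - ζ)) ^ 2 * S + 2 * (T ^ 2 + (T / (1 - ζ)) ^ 2) * S + D ^ 2 * T ^ 3)
    with hK
  have hlim : T * (1 / F) + T * (D ^ 2 * T) / (1 - ζ) ^ 2 = c / T := by
    rw [hc]
    field_simp
  rw [hlim]
  refine tendsto_div_of_abs_sub_le (C := c + K) hT fun n r hr hrT => ?_
  have h1 : (fun ω => clockTimeError y (n * T + r) ω ^ 2) =ᵐ[P] fun ω =>
      (∑ k ∈ Finset.range n, clockStep T D ζ (W k) (ν k) ω + clockRest T D ζ y W n r ω) ^ 2 := by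
    filter_upwards [h.clockTimeError_ae_eq hT hζ hν n hr hrT] with ω hω
    rw [hω]
  have hM2 : MemLp (fun ω => ∑ k ∈ Finset.range n, clockStep T D ζ (W k) (ν k) ω) 2 P :=
    memLp_finsetSum _ fun k _ => h.memLp_clockStep hν k
  have hs : 0 < √((n : ℝ) + 1) := by positivity
  -- The main part has second moment `n c` and the remainder at most `K`; the choice `ε = 1/√(n +
  -- 1)` makes both error terms `O(√n)`.
  have h2 := abs_integral_sq_add_sub_le hM2 (h.memLp_clockRest hY n hr)
    (inv_pos.2 hs)
  rw [h.integral_sq_sum_clockStep hT hν n, inv_inv] at h2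
  have h3 := h.integral_sq_clockRest_le hY hS n hr hrT
  rw [integral_congr_ae h1]
  have hss : √((n : ℝ) + 1) * √((n : ℝ) + 1) = n + 1 := Real.mul_self_sqrt (by positivity)
  have h4 : (√((n : ℝ) + 1))⁻¹ * (n * c) ≤ c * √((n : ℝ) + 1) := by
    rw [inv_mul_le_iff₀ hs]
    nlinarith
  have h5 : (1 + √((n : ℝ) + 1)) * ∫ ω, clockRest T D ζ y W n r ω ^ 2 ∂P ≤
      (1 + √((n : ℝ) + 1)) * K := mul_le_mul_of_nonneg_left h3 (by positivity)
  nlinarith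

end IsClockState

namespace IsGaussianStationaryState

variable (h : IsGaussianStationaryState (gaussianClock hF ζ) T D P y W α)

include h

lemma memLp_syncError (n : ℕ) : MemLp (syncError T y n) 2 P :=
  (h.gaussian.hasGaussianLaw_eval n).memLp_two

lemma identDistrib (n : ℕ) : IdentDistrib (syncError T y n) (syncError T y 0) P P := by
  have h1 := (h.stationary 1 (fun _ => 0) n).comp (u := fun x => x 0) (measurable_pi_apply 0)
  simpa [Function.comp_def] using h1

variable [IsProbabilityMeasure P]

lemma integral_syncError (hT : 0 < T) (hζ : |ζ| < 1) (n : ℕ) :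
    ∫ ω, syncError T y n ω ∂P = 0 := by
  have h1 := h.integral_syncError_succ hT h.memLp_syncError n
  rw [(h.identDistrib (n + 1)).integral_eq, ← (h.identDistrib n).integral_eq] at h1
  have h2 : (1 - ζ) * ∫ ω, syncError T y n ω ∂P = 0 := by linarith
  exact (mul_eq_zero.1 h2).resolve_left (by linarith [(abs_lt.1 hζ).2])

/-- Stationarity turns the second-moment recursion into a fixed-point equation, which can be solved
because `1 - ζ² ≠ 0`. -/
lemma integral_sq_syncError (hT : 0 < T) (hζ : |ζ| < 1) (n : ℕ) :
    ∫ ω, syncError T y n ω ^ 2 ∂P = (1 - ζ) / (1 + ζ) * (1 / F) +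
      D ^ 2 * T / 3 * ((1 + ζ + ζ ^ 2) / (1 - ζ ^ 2)) := by
  have h0 : ∀ k, ∫ ω, syncError T y k ω ^ 2 ∂P = ∫ ω, syncError T y 0 ω ^ 2 ∂P := fun k =>
    ((h.identDistrib k).comp (measurable_id.pow_const 2)).integral_eq
  have h1 := h.integral_sq_syncError_succ hT h.memLp_syncError n
  rw [h0 (n + 1), ← h0 n] at h1
  have p1 : 1 - ζ ≠ 0 := by linarith [(abs_lt.1 hζ).2]
  have p2 : 1 + ζ ≠ 0 := by linarith [(abs_lt.1 hζ).1]
  have p3 : 1 - ζ ^ 2 = (1 - ζ) * (1 + ζ) := by ring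
  rw [p3]
  field_simp at h1 ⊢
  linarith

end IsGaussianStationaryState

end ClockTime

/-! ### Almost sure limits of centered Gaussians. -/

section GaussianLimit

variable {Ω : Type*} [MeasurableSpace Ω] {P : Measure Ω} [IsProbabilityMeasure P]

lemma charFun_gaussianReal_zero (v : ℝ≥0) (u : ℝ) :
    charFun (gaussianReal 0 v) u = (Real.exp (-(v * u ^ 2 / 2)) : ℝ) := by
  rw [charFun_gaussianReal]
  push_cast
  congr 1
  ring

lemma tendsto_charFun_of_tendsto_ae {X : ℕ → Ω → ℝ} {Y : Ω → ℝ} (hX : ∀ k, AEMeasurable (X k) P)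
    (hlim : ∀ᵐ ω ∂P, Tendsto (fun k => X k ω) atTop (𝓝 (Y ω))) (u : ℝ) :
    Tendsto (fun k => charFun (P.map (X k)) u) atTop (𝓝 (charFun (P.map Y) u)) := by
  have hY : AEMeasurable Y P := aemeasurable_of_tendsto_metrizable_ae _ hX hlim
  have hc : Continuous fun x : ℝ => Complex.exp (u * x * Complex.I) := by fun_prop
  simp_rw [charFun_apply_real]
  rw [integral_map hY hc.aestronglyMeasurable]
  simp_rw [fun k => integral_map (hX k) hc.aestronglyMeasurable]
  refine tendsto_integral_of_dominated_convergence (fun _ => 1)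
    (fun k => hc.comp_aestronglyMeasurable (hX k).aestronglyMeasurable) (integrable_const _)
    (fun k => ae_of_all _ fun ω => ?_) ?_
  · rw [← Complex.ofReal_mul, Complex.norm_exp_ofReal_mul_I]
  · filter_upwards [hlim] with ω hω using (hc.tendsto _).comp hω

/-- An almost sure limit of centered Gaussian random variables is centered and Gaussian, and the
variances converge. -/
lemma exists_hasLaw_gaussianReal_of_tendsto_ae {X : ℕ → Ω → ℝ} {Y : Ω → ℝ} {v : ℕ → ℝ≥0}
    (hX : ∀ k, HasLaw (X k) (gaussianReal 0 (v k)) P)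
    (hlim : ∀ᵐ ω ∂P, Tendsto (fun k => X k ω) atTop (𝓝 (Y ω))) :
    ∃ w : ℝ≥0, HasLaw Y (gaussianReal 0 w) P ∧ Tendsto v atTop (𝓝 w) := by
  have hY : AEMeasurable Y P :=
    aemeasurable_of_tendsto_metrizable_ae _ (fun k => (hX k).aemeasurable) hlim
  have : IsProbabilityMeasure (P.map Y) := Measure.isProbabilityMeasure_map hY
  have h1 : ∀ u : ℝ, Tendsto (fun k => ((Real.exp (-(v k * u ^ 2 / 2)) : ℝ) : ℂ)) atTop
      (𝓝 (charFun (P.map Y) u)) := fun u => by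
    have := tendsto_charFun_of_tendsto_ae (fun k => (hX k).aemeasurable) hlim u
    simp_rw [(hX _).map_eq, charFun_gaussianReal_zero] at this
    exact this
  -- A frequency where the limiting characteristic function does not vanish exists by continuity at
  -- `0`. There the logarithm of `exp(-v_k u²/2)` converges, which excludes that the variances
  -- diverge.
  obtain ⟨u, hu0, hu⟩ : ∃ u : ℝ, u ≠ 0 ∧ charFun (P.map Y) u ≠ 0 := by
    have h2 : ∀ᶠ u in 𝓝 (0 : ℝ), charFun (P.map Y) u ≠ 0 :=
      (continuous_charFun.tendsto 0).eventually_ne (by simp)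
    have h3 : ∀ᶠ u in 𝓝[≠] (0 : ℝ), charFun (P.map Y) u ≠ 0 := h2.filter_mono nhdsWithin_le_nhds
    obtain ⟨u, hu, hu'⟩ := (h3.and self_mem_nhdsWithin).exists
    exact ⟨u, hu', hu⟩
  have h2 := (h1 u).norm
  simp only [Complex.norm_real, Real.norm_eq_abs, Real.abs_exp] at h2
  have h3 := (Real.continuousAt_log (norm_ne_zero_iff.2 hu)).tendsto.comp h2
  simp only [Function.comp_def, Real.log_exp] at h3
  have h4 : Tendsto (fun k => (v k : ℝ)) atTop
      (𝓝 (-(2 / u ^ 2) * Real.log ‖charFun (P.map Y) u‖)) := by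
    refine (h3.const_mul (-(2 / u ^ 2))).congr fun k => ?_
    field_simp
  set w := -(2 / u ^ 2) * Real.log ‖charFun (P.map Y) u‖ with hw
  have hw0 : 0 ≤ w := ge_of_tendsto' h4 fun k => (v k).2
  lift w to ℝ≥0 using hw0 with w' hw'
  refine ⟨w', ⟨hY, ?_⟩, NNReal.tendsto_coe.1 h4⟩
  refine Measure.ext_of_charFun (funext fun t => ?_)
  rw [charFun_gaussianReal_zero]
  refine tendsto_nhds_unique (h1 t) ?_
  refine (Complex.continuous_ofReal.tendsto _).comp ((Real.continuous_exp.tendsto _).comp ?_)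
  exact ((h4.mul_const (t ^ 2)).div_const 2).neg

omit [IsProbabilityMeasure P] in
lemma hasLaw_gaussianReal_of_integral_eq_zero {X : Ω → ℝ} (h : HasGaussianLaw X P)
    (h0 : ∫ ω, X ω ∂P = 0) : HasLaw X (gaussianReal 0 (Var[X; P]).toNNReal) P :=
  ⟨h.aemeasurable, by rw [h.map_eq_gaussianReal, h0]⟩

variable {ι : Type*}

lemma exists_linearMap_restrict_eq_sum (I : Finset ι) (L : (I → ℝ) →L[ℝ] ℝ) :
    ∃ c : I → ℝ, ∀ x : ι → ℝ, L (I.restrict x) = ∑ i : I, c i * x i := by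
  classical
  refine ⟨fun i => L fun j => if i = j then 1 else 0, fun x => ?_⟩
  rw [← ContinuousLinearMap.coe_coe, LinearMap.pi_apply_eq_sum_univ]
  simp [mul_comm]

/-- An almost sure limit of centered Gaussian processes is a centered Gaussian process, and the
covariances converge. -/
lemma isGaussianProcess_of_tendsto_ae {X : ℕ → ι → Ω → ℝ} {Y : ι → Ω → ℝ}
    (hX : ∀ k, IsGaussianProcess (X k) P) (h0 : ∀ k i, ∫ ω, X k i ω ∂P = 0)
    (hlim : ∀ i, ∀ᵐ ω ∂P, Tendsto (fun k => X k i ω) atTop (𝓝 (Y i ω))) :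
    IsGaussianProcess Y P ∧ (∀ i, ∫ ω, Y i ω ∂P = 0) ∧
      ∀ i j, Tendsto (fun k => cov[X k i, X k j; P]) atTop (𝓝 cov[Y i, Y j; P]) := by
  have hG : IsGaussianProcess Y P := by
    -- Cramér–Wold: it suffices to treat one linear functional of finitely many coordinates, where
    -- the scalar limit theorem applies.
    refine ⟨fun I => ⟨isGaussian_of_map_eq_gaussianReal fun L => ?_⟩⟩
    have hY : ∀ i, AEMeasurable (Y i) P := fun i =>
      aemeasurable_of_tendsto_metrizable_ae _ (fun k => (hX k).aemeasurable i) (hlim i)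
    have hYI : AEMeasurable (fun ω => I.restrict (Y · ω)) P :=
      aemeasurable_pi_lambda _ fun i => hY i
    have h1 : ∀ k, HasGaussianLaw (fun ω => L (I.restrict (X k · ω))) P := fun k =>
      ((hX k).hasGaussianLaw I).map_fun L
    have h2 : ∀ k, ∫ ω, L (I.restrict (X k · ω)) ∂P = 0 := fun k => by
      obtain ⟨c, hc⟩ := exists_linearMap_restrict_eq_sum I L
      simp_rw [hc]
      rw [integral_finsetSum]
      · simp [integral_const_mul, h0]
      · exact fun i _ => ((hX k).hasGaussianLaw_eval i).integrable.const_mul _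
    obtain ⟨w, hw, -⟩ := exists_hasLaw_gaussianReal_of_tendsto_ae
      (fun k => hasLaw_gaussianReal_of_integral_eq_zero (h1 k) (h2 k))
      (Y := fun ω => L (I.restrict (Y · ω))) (by
        filter_upwards [(ae_all_iff (ι := I)).2 fun i => hlim i] with ω hω
        exact (L.continuous.tendsto _).comp (tendsto_pi_nhds.2 fun i => hω i))
    refine ⟨0, w, ?_⟩
    rw [AEMeasurable.map_map_of_aemeasurable L.continuous.measurable.aemeasurable hYI]
    exact hw.map_eq
  have hmean : ∀ i, ∫ ω, Y i ω ∂P = 0 := fun i => by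
    obtain ⟨w, hw, -⟩ := exists_hasLaw_gaussianReal_of_tendsto_ae
      (fun k => hasLaw_gaussianReal_of_integral_eq_zero ((hX k).hasGaussianLaw_eval i) (h0 k i))
      (hlim i)
    rw [hw.integral_eq, integral_id_gaussianReal]
  have hvar : ∀ (Z : ℕ → Ω → ℝ) (V : Ω → ℝ), (∀ k, HasGaussianLaw (Z k) P) →
      (∀ k, ∫ ω, Z k ω ∂P = 0) → (∀ᵐ ω ∂P, Tendsto (fun k => Z k ω) atTop (𝓝 (V ω))) →
      Tendsto (fun k => Var[Z k; P]) atTop (𝓝 Var[V; P]) := fun Z V h1 h2 h3 => by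
    obtain ⟨w, hw, hw'⟩ := exists_hasLaw_gaussianReal_of_tendsto_ae
      (fun k => hasLaw_gaussianReal_of_integral_eq_zero (h1 k) (h2 k)) h3
    rw [hw.variance_eq, variance_id_gaussianReal]
    refine (NNReal.tendsto_coe.2 hw').congr fun k => ?_
    exact Real.coe_toNNReal _ (variance_nonneg _ _)
  refine ⟨hG, hmean, fun i j => ?_⟩
  have hL2 : ∀ k i, MemLp (X k i) 2 P := fun k i => ((hX k).hasGaussianLaw_eval i).memLp_two
  have hY2 : ∀ i, MemLp (Y i) 2 P := fun i => (hG.hasGaussianLaw_eval i).memLp_two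
  have hadd := hvar (fun k => X k i + X k j) (Y i + Y j) (fun k => (hX k).hasGaussianLaw_add)
    (fun k => by
      simp only [Pi.add_apply]
      rw [integral_add ((hL2 k i).integrable one_le_two) ((hL2 k j).integrable one_le_two),
        h0, h0, add_zero])
    (by filter_upwards [hlim i, hlim j] with ω h1 h2 using h1.add h2)
  have hi := hvar (fun k => X k i) (Y i) (fun k => (hX k).hasGaussianLaw_eval i)
    (fun k => h0 k i) (hlim i)
  have hj := hvar (fun k => X k j) (Y j) (fun k => (hX k).hasGaussianLaw_eval j)
    (fun k => h0 k j) (hlim j)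
  -- Polarization deduces convergence of covariances from convergence of variances.
  have hpol : ∀ {A B : Ω → ℝ}, MemLp A 2 P → MemLp B 2 P →
      cov[A, B; P] = (Var[A + B; P] - Var[A; P] - Var[B; P]) / 2 := fun hA hB => by
    rw [variance_add hA hB]
    ring
  rw [hpol (hY2 i) (hY2 j)]
  simp_rw [fun k => hpol (hL2 k i) (hL2 k j)]
  exact ((hadd.sub hi).sub hj).div_const 2

end GaussianLimit

/-! ### Tent functions and the covariance of the Brownian bridge. -/

section Schauder

/-- The tent function, supported in `[0, 1]`. -/
noncomputable def tent (x : ℝ) : ℝ := max 0 (min x (1 - x))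

lemma tent_nonneg (x : ℝ) : 0 ≤ tent x := le_max_left _ _

lemma tent_le_one (x : ℝ) : tent x ≤ 1 := by
  refine max_le zero_le_one ?_
  rcases le_total x 1 with h | h
  · exact (min_le_left _ _).trans h
  · exact (min_le_right _ _).trans (by linarith)

lemma tent_of_nonpos {x : ℝ} (h : x ≤ 0) : tent x = 0 :=
  max_eq_left ((min_le_left _ _).trans h)

lemma tent_of_one_le {x : ℝ} (h : 1 ≤ x) : tent x = 0 :=
  max_eq_left ((min_le_right _ _).trans (by linarith))

lemma tent_of_le_half {x : ℝ} (h0 : 0 ≤ x) (h : x ≤ 1 / 2) : tent x = x := by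
  rw [tent, min_eq_left (by linarith), max_eq_right h0]

lemma tent_of_half_le {x : ℝ} (h1 : x ≤ 1) (h : 1 / 2 ≤ x) : tent x = 1 - x := by
  rw [tent, min_eq_right (by linarith), max_eq_right (by linarith)]

lemma continuous_tent : Continuous tent := by
  unfold tent
  fun_prop

/-- The integer translates of the tent do not overlap: only the term of index `⌊x⌋₊` can be nonzero
at `x`. -/
lemma abs_sum_tent_mul_le {m : ℕ} {a : ℕ → ℝ} {A : ℝ} (hA : 0 ≤ A) (ha : ∀ k < m, |a k| ≤ A)
    (x : ℝ) : |∑ k ∈ Finset.range m, tent (x - k) * a k| ≤ A := by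
  have h0 : ∀ k : ℕ, k ≠ ⌊x⌋₊ → tent (x - k) = 0 := by
    intro k hk
    rcases le_or_gt x k with h | h
    · exact tent_of_nonpos (by linarith)
    · rcases le_or_gt (k + 1 : ℝ) x with h' | h'
      · exact tent_of_one_le (by linarith)
      · exact absurd ((Nat.floor_eq_iff (by linarith [k.cast_nonneg (α := ℝ)])).2
          ⟨h.le, h'⟩).symm hk
  by_cases hm : ⌊x⌋₊ < m
  · rw [Finset.sum_eq_single_of_mem _ (Finset.mem_range.2 hm)
      (fun k _ hk => by rw [h0 k hk, zero_mul]), abs_mul, abs_of_nonneg (tent_nonneg _)]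
    calc tent (x - ⌊x⌋₊) * |a ⌊x⌋₊| ≤ 1 * A :=
          mul_le_mul (tent_le_one _) (ha _ hm) (abs_nonneg _) zero_le_one
      _ = A := one_mul A
  · rw [Finset.sum_eq_zero (fun k hk => by
      rw [h0 k (fun h => hm (h ▸ Finset.mem_range.1 hk)), zero_mul]), abs_zero]
    exact hA

/-- The covariance of the sum of the first `N` levels of the series for the Brownian bridge. -/
noncomputable def bridgeCov (N : ℕ) (s t : ℝ) : ℝ :=
  ∑ n ∈ Finset.range N, ∑ k ∈ Finset.range (2 ^ n),
    (1 / 2 : ℝ) ^ n * (tent (2 ^ n * s - k) * tent (2 ^ n * t - k))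

/-- Self-similarity: the levels above the zeroth split into the left and right halves of `[0, 1]`,
each a copy of the whole at doubled scale and half the weight. -/
lemma bridgeCov_succ (N : ℕ) (s t : ℝ) :
    bridgeCov (N + 1) s t = tent s * tent t + 1 / 2 * bridgeCov N (2 * s) (2 * t) +
      1 / 2 * bridgeCov N (2 * s - 1) (2 * t - 1) := by
  simp only [bridgeCov]
  rw [Finset.sum_range_succ', Finset.mul_sum, Finset.mul_sum, add_assoc, ← Finset.sum_add_distrib,
    add_comm]
  congr 1
  · simp
  · refine Finset.sum_congr rfl fun n _ => ?_
    rw [pow_succ 2 n, mul_two, Finset.sum_range_add, Finset.mul_sum, Finset.mul_sum]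
    congr 1
    · refine Finset.sum_congr rfl fun k _ => ?_
      rw [pow_succ, pow_succ]
      ring_nf
    · refine Finset.sum_congr rfl fun k _ => ?_
      rw [pow_succ, pow_succ]
      push_cast
      have e : ∀ r : ℝ, 2 ^ n * 2 * r - (2 ^ n + k) = 2 ^ n * (2 * r - 1) - k := fun r => by ring
      rw [e, e]
      ring

lemma tent_level_eq_zero {n k : ℕ} (hk : k < 2 ^ n) {s : ℝ} (hs : s ≤ 0 ∨ 1 ≤ s) :
    tent (2 ^ n * s - k) = 0 := by
  have h2 : (0 : ℝ) < 2 ^ n := by positivity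
  rcases hs with hs | hs
  · refine tent_of_nonpos ?_
    have : (0 : ℝ) ≤ k := k.cast_nonneg
    nlinarith
  · refine tent_of_one_le ?_
    have : (k : ℝ) + 1 ≤ 2 ^ n := by exact_mod_cast hk
    nlinarith

lemma bridgeCov_eq_zero_left (N : ℕ) {s : ℝ} (hs : s ≤ 0 ∨ 1 ≤ s) (t : ℝ) :
    bridgeCov N s t = 0 :=
  Finset.sum_eq_zero fun n _ => Finset.sum_eq_zero fun k hk => by
    rw [tent_level_eq_zero (Finset.mem_range.1 hk) hs, zero_mul, mul_zero]

lemma bridgeCov_comm (N : ℕ) (s t : ℝ) : bridgeCov N s t = bridgeCov N t s :=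
  Finset.sum_congr rfl fun n _ => Finset.sum_congr rfl fun k _ => by
    rw [mul_comm (tent _)]

/-- The bridge covariance `s (1 - t)` obeys the same self-similarity. For `s`, `t` in one half the
deviation is half that of the rescaled pair; in different halves the zeroth level alone gives `s (1
- t)` exactly. -/
lemma abs_bridgeCov_sub_le (N : ℕ) : ∀ {s t : ℝ}, 0 ≤ s → s ≤ t → t ≤ 1 →
    |bridgeCov N s t - (s - s * t)| ≤ (1 / 2) ^ N := by
  induction N with
  | zero =>
    intro s t hs hst ht
    simp only [bridgeCov, Finset.range_zero, Finset.sum_empty, pow_zero]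
    rw [abs_le]
    constructor <;> nlinarith
  | succ N ih =>
    intro s t hs hst ht
    rw [bridgeCov_succ]
    rcases le_total t (1 / 2) with h | h
    · rw [bridgeCov_eq_zero_left N (s := 2 * s - 1) (Or.inl (by linarith)),
        tent_of_le_half hs (hst.trans h), tent_of_le_half (hs.trans hst) h]
      have h1 := ih (s := 2 * s) (t := 2 * t) (by linarith) (by linarith) (by linarith)
      rw [show s * t + 1 / 2 * bridgeCov N (2 * s) (2 * t) + 1 / 2 * 0 - (s - s * t) =
        1 / 2 * (bridgeCov N (2 * s) (2 * t) - (2 * s - 2 * s * (2 * t))) by ring, abs_mul,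
        pow_succ', abs_of_pos (by norm_num : (0 : ℝ) < 1 / 2)]
      linarith
    · rcases le_total s (1 / 2) with h' | h'
      · rw [bridgeCov_eq_zero_left N (s := 2 * s - 1) (Or.inl (by linarith)),
          bridgeCov_comm, bridgeCov_eq_zero_left N (s := 2 * t) (Or.inr (by linarith)),
          tent_of_le_half hs h', tent_of_half_le ht h]
        rw [show s * (1 - t) + 1 / 2 * 0 + 1 / 2 * 0 - (s - s * t) = 0 by ring, abs_zero]
        positivity
      · rw [bridgeCov_eq_zero_left N (s := 2 * s) (Or.inr (by linarith)),
          tent_of_half_le (hst.trans ht) h', tent_of_half_le ht h]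
        have h1 := ih (s := 2 * s - 1) (t := 2 * t - 1) (by linarith) (by linarith) (by linarith)
        rw [show (1 - s) * (1 - t) + 1 / 2 * 0 + 1 / 2 * bridgeCov N (2 * s - 1) (2 * t - 1) -
          (s - s * t) = 1 / 2 * (bridgeCov N (2 * s - 1) (2 * t - 1) -
            (2 * s - 1 - (2 * s - 1) * (2 * t - 1))) by ring, abs_mul,
          pow_succ', abs_of_pos (by norm_num : (0 : ℝ) < 1 / 2)]
        linarith

lemma tendsto_bridgeCov {s t : ℝ} (hs : 0 ≤ s) (hst : s ≤ t) (ht : t ≤ 1) :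
    Tendsto (fun N => bridgeCov N s t) atTop (𝓝 (s - s * t)) := by
  rw [tendsto_iff_norm_sub_tendsto_zero]
  exact squeeze_zero (fun _ => norm_nonneg _) (fun N => abs_bridgeCov_sub_le N hs hst ht)
    (tendsto_pow_atTop_nhds_zero_of_lt_one (by norm_num) (by norm_num))

end Schauder

/-! ### Independent Gaussians and their growth. -/

section WhiteNoise

/-- The index set of the white noise: level and position of the Schauder functions. -/
abbrev NoiseIndex : Type := (_ : ℕ) × ℕ

/-- The law of a sequence of independent standard Gaussian random variables. -/
noncomputable def whiteNoise : Measure (NoiseIndex → ℝ) :=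
  Measure.infinitePi fun _ => gaussianReal 0 1

instance : IsProbabilityMeasure whiteNoise := by
  unfold whiteNoise
  infer_instance

lemma hasLaw_whiteNoise (p : NoiseIndex) :
    HasLaw (fun x : NoiseIndex → ℝ => x p) (gaussianReal 0 1) whiteNoise :=
  (measurePreserving_eval_infinitePi (fun _ : NoiseIndex => gaussianReal 0 1) p).hasLaw

lemma iIndepFun_whiteNoise : iIndepFun (fun (p : NoiseIndex) (x : NoiseIndex → ℝ) => x p)
    whiteNoise :=
  iIndepFun_infinitePi (X := fun _ x => x) fun _ => measurable_id

lemma isGaussianProcess_whiteNoise :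
    IsGaussianProcess (fun (p : NoiseIndex) (x : NoiseIndex → ℝ) => x p) whiteNoise where
  hasGaussianLaw I := by
    have h1 : iIndepFun (fun (p : I) (x : NoiseIndex → ℝ) => x p) whiteNoise :=
      iIndepFun_whiteNoise.precomp Subtype.val_injective
    exact h1.hasGaussianLaw fun p => (hasLaw_whiteNoise p).hasGaussianLaw

lemma memLp_whiteNoise (p : NoiseIndex) :
    MemLp (fun x : NoiseIndex → ℝ => x p) 2 whiteNoise :=
  (hasLaw_whiteNoise p).hasGaussianLaw.memLp_two

lemma covariance_whiteNoise (p q : NoiseIndex) :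
    cov[fun x : NoiseIndex → ℝ => x p, fun x => x q; whiteNoise] = if p = q then 1 else 0 := by
  split_ifs with h
  · rw [← h, covariance_self (hasLaw_whiteNoise p).aemeasurable, (hasLaw_whiteNoise p).variance_eq,
      variance_id_gaussianReal]
    simp
  · exact (iIndepFun_whiteNoise.indepFun h).covariance_eq_zero (memLp_whiteNoise p)
      (memLp_whiteNoise q)

lemma covariance_sum_whiteNoise (I : Finset NoiseIndex) (a b : NoiseIndex → ℝ) :
    cov[fun x : NoiseIndex → ℝ => ∑ p ∈ I, a p * x p, fun x => ∑ p ∈ I, b p * x p; whiteNoise] =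
      ∑ p ∈ I, a p * b p := by
  rw [covariance_fun_sum_fun_sum' (fun p _ => (memLp_whiteNoise p).const_mul _)
    (fun p _ => (memLp_whiteNoise p).const_mul _)]
  refine Finset.sum_congr rfl fun p hp => ?_
  simp_rw [covariance_const_mul_left, covariance_const_mul_right, covariance_whiteNoise]
  simp [hp]

/-- The white noises which grow slowly enough for the Schauder series to converge. -/
def tameNoise : Set (NoiseIndex → ℝ) :=
  {x | ∃ C : ℕ, ∀ n k : ℕ, k < 2 ^ n → |x ⟨n, k⟩| ≤ C * (5 / 4 : ℝ) ^ n}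

lemma measurableSet_tameNoise : MeasurableSet tameNoise := by
  have : tameNoise = ⋃ C : ℕ, ⋂ n : ℕ, ⋂ k : ℕ, ⋂ _ : k < 2 ^ n,
      {x | |x ⟨n, k⟩| ≤ C * (5 / 4 : ℝ) ^ n} := by
    ext x
    simp [tameNoise]
  rw [this]
  refine MeasurableSet.iUnion fun C => MeasurableSet.iInter fun n => MeasurableSet.iInter fun k =>
    MeasurableSet.iInter fun _ => measurableSet_le ?_ measurable_const
  fun_prop

/-- Fourth moments suffice: level `n` has `2^n` variables, so the weighted sum of fourth powers has
expectation a geometric series of ratio `2 (4/5)⁴ = 512/625 < 1`, and an almost surely finite sum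
bounds each term. The rate `5/4` is also below `√2`, which makes the Schauder series converge. -/
lemma ae_mem_tameNoise : ∀ᵐ x ∂whiteNoise, x ∈ tameNoise := by
  set m4 : ℝ≥0∞ := ∫⁻ z, ENNReal.ofReal (z ^ 4) ∂gaussianReal 0 1 with hm4
  have hm4' : m4 ≠ ∞ := by
    have h1 : MemLp (fun z : ℝ => z) 4 (gaussianReal 0 1) := memLp_id_gaussianReal 4
    have h2 : Integrable (fun z : ℝ => z ^ 4) (gaussianReal 0 1) := by
      have := h1.integrable_norm_pow (p := 4) (by norm_num)
      refine this.congr (ae_of_all _ fun z => ?_)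
      simp [Real.norm_eq_abs, Even.pow_abs (show Even 4 by decide)]
    exact (h2.lintegral_lt_top).ne
  set S : (NoiseIndex → ℝ) → ℝ≥0∞ := fun x => ∑' n : ℕ, ∑ k ∈ Finset.range (2 ^ n),
    ENNReal.ofReal ((4 / 5) ^ n) ^ 4 * ENNReal.ofReal (x ⟨n, k⟩ ^ 4) with hS
  have hterm : ∀ n k : ℕ, Measurable fun x : NoiseIndex → ℝ =>
      ENNReal.ofReal ((4 / 5) ^ n) ^ 4 * ENNReal.ofReal (x ⟨n, k⟩ ^ 4) := fun n k => by fun_prop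
  have hSint : ∫⁻ x, S x ∂whiteNoise ≠ ∞ := by
    rw [hS, lintegral_tsum fun n => (Finset.measurable_fun_sum _ fun k _ => hterm n k).aemeasurable]
    have h1 : ∀ n : ℕ, ∫⁻ x, ∑ k ∈ Finset.range (2 ^ n),
        ENNReal.ofReal ((4 / 5) ^ n) ^ 4 * ENNReal.ofReal (x ⟨n, k⟩ ^ 4) ∂whiteNoise =
        ENNReal.ofReal (512 / 625) ^ n * m4 := fun n => by
      rw [lintegral_finsetSum _ fun k _ => hterm n k]
      have h2 : ∀ k : ℕ, ∫⁻ x, ENNReal.ofReal ((4 / 5) ^ n) ^ 4 *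
          ENNReal.ofReal (x ⟨n, k⟩ ^ 4) ∂whiteNoise = ENNReal.ofReal ((4 / 5) ^ n) ^ 4 * m4 := by
        intro k
        rw [lintegral_const_mul _ (by fun_prop), hm4, ← (hasLaw_whiteNoise ⟨n, k⟩).map_eq,
          lintegral_map (by fun_prop) (by fun_prop)]
      simp_rw [h2]
      rw [Finset.sum_const, Finset.card_range, nsmul_eq_mul, ← mul_assoc]
      congr 1
      rw [← ENNReal.ofReal_pow (by positivity), ← ENNReal.ofReal_pow (by norm_num),
        ← ENNReal.ofReal_natCast, ← ENNReal.ofReal_mul (by positivity)]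
      congr 1
      push_cast
      rw [← pow_mul, mul_comm n 4, pow_mul, ← mul_pow]
      norm_num
    simp_rw [h1]
    rw [ENNReal.tsum_mul_right, ENNReal.tsum_geometric]
    refine ENNReal.mul_ne_top (ENNReal.inv_ne_top.2 ?_) hm4'
    rw [← ENNReal.ofReal_one, ← ENNReal.ofReal_sub _ (by norm_num)]
    norm_num
  have hSm : Measurable S := Measurable.tsum fun n =>
    Finset.measurable_fun_sum _ fun k _ => hterm n k
  filter_upwards [ae_lt_top hSm hSint] with x hx
  -- Taking `C ≥ 1` gives `C ≤ C⁴`, so the fourth root can be avoided.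
  obtain ⟨C, hC⟩ := exists_nat_ge (max 1 (S x).toReal)
  refine ⟨C, fun n k hk => ?_⟩
  have h1 : ENNReal.ofReal (((4 / 5) ^ n) ^ 4 * x ⟨n, k⟩ ^ 4) ≤ S x := by
    rw [ENNReal.ofReal_mul (by positivity), ENNReal.ofReal_pow (by positivity)]
    refine le_trans ?_ (ENNReal.le_tsum n)
    exact Finset.single_le_sum (f := fun k => ENNReal.ofReal ((4 / 5) ^ n) ^ 4 *
      ENNReal.ofReal (x ⟨n, k⟩ ^ 4)) (fun _ _ => zero_le) (Finset.mem_range.2 hk)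
  have h2 : ((4 / 5) ^ n * |x ⟨n, k⟩|) ^ 4 ≤ C := by
    rw [mul_pow, Even.pow_abs (by decide)]
    exact ((ENNReal.ofReal_le_iff_le_toReal hx.ne).1 h1).trans ((le_max_right _ _).trans hC)
  have hC1 : (1 : ℝ) ≤ C := (le_max_left _ _).trans hC
  have h3 : (4 / 5) ^ n * |x ⟨n, k⟩| ≤ C := by
    refine le_of_pow_le_pow_left₀ (n := 4) (by norm_num) (by positivity) (h2.trans ?_)
    exact le_self_pow₀ hC1 (by norm_num)
  have h4 : (4 / 5 : ℝ) ^ n * (5 / 4) ^ n = 1 := by rw [← mul_pow]; norm_num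
  have h5 : (0 : ℝ) < (5 / 4) ^ n := by positivity
  calc |x ⟨n, k⟩| = ((4 / 5) ^ n * |x ⟨n, k⟩|) * (5 / 4) ^ n := by linear_combination (-|x ⟨n, k⟩|) * h4
    _ ≤ C * (5 / 4) ^ n := mul_le_mul_of_nonneg_right h3 h5.le

end WhiteNoise

/-! ### Construction of Brownian motion. -/

section BrownianMotion

/-- The Schauder function of index `p`. -/
noncomputable def schauder (p : NoiseIndex) (t : ℝ) : ℝ :=
  (√2)⁻¹ ^ p.1 * tent (2 ^ p.1 * t - p.2)

lemma continuous_schauder (p : NoiseIndex) : Continuous (schauder p) := by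
  have := continuous_tent
  unfold schauder
  fun_prop

/-- The indices of the first `N` levels. -/
def bridgeIndex (N : ℕ) : Finset NoiseIndex :=
  (Finset.range N).sigma fun n => Finset.range (2 ^ n)

/-- The sum of the first `N` levels of the series for the Brownian bridge. -/
noncomputable def bridgeSum (N : ℕ) (t : ℝ) (x : NoiseIndex → ℝ) : ℝ :=
  ∑ p ∈ bridgeIndex N, schauder p t * x p

/-- One level of the series for the Brownian bridge. -/
noncomputable def bridgeLevel (x : NoiseIndex → ℝ) (n : ℕ) (t : ℝ) : ℝ :=
  ∑ k ∈ Finset.range (2 ^ n), schauder ⟨n, k⟩ t * x ⟨n, k⟩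

lemma bridgeSum_eq_sum (N : ℕ) (t : ℝ) (x : NoiseIndex → ℝ) :
    bridgeSum N t x = ∑ n ∈ Finset.range N, bridgeLevel x n t := by
  rw [bridgeSum, bridgeIndex, Finset.sum_sigma]
  rfl

lemma sum_schauder_mul_schauder (N : ℕ) (s t : ℝ) :
    ∑ p ∈ bridgeIndex N, schauder p s * schauder p t = bridgeCov N s t := by
  rw [bridgeIndex, Finset.sum_sigma, bridgeCov]
  refine Finset.sum_congr rfl fun n _ => Finset.sum_congr rfl fun k _ => ?_
  have h : (1 / 2 : ℝ) ^ n = (√2)⁻¹ ^ n * (√2)⁻¹ ^ n := by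
    rw [← mul_pow, ← mul_inv, Real.mul_self_sqrt (by norm_num), one_div]
  rw [h]
  simp only [schauder]
  ring

lemma norm_bridgeLevel_le {x : NoiseIndex → ℝ} {C : ℕ}
    (hC : ∀ n k : ℕ, k < 2 ^ n → |x ⟨n, k⟩| ≤ C * (5 / 4 : ℝ) ^ n) (n : ℕ) (t : ℝ) :
    ‖bridgeLevel x n t‖ ≤ C * ((√2)⁻¹ * (5 / 4)) ^ n := by
  have h1 : bridgeLevel x n t = (√2)⁻¹ ^ n *
      ∑ k ∈ Finset.range (2 ^ n), tent (2 ^ n * t - k) * x ⟨n, k⟩ := by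
    rw [bridgeLevel, Finset.mul_sum]
    exact Finset.sum_congr rfl fun k _ => by rw [schauder, mul_assoc]
  have h2 := abs_sum_tent_mul_le (a := fun k => x ⟨n, k⟩) (by positivity) (hC n) (2 ^ n * t)
  rw [h1, norm_mul, Real.norm_of_nonneg (by positivity), mul_pow, Real.norm_eq_abs, mul_left_comm]
  exact mul_le_mul_of_nonneg_left h2 (by positivity)

lemma summable_bridgeBound (C : ℝ) : Summable fun n : ℕ => C * ((√2)⁻¹ * (5 / 4)) ^ n := by
  refine Summable.mul_left C (summable_geometric_of_lt_one (by positivity) ?_)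
  rw [inv_mul_lt_iff₀ (by positivity), mul_one, Real.lt_sqrt (by norm_num)]
  norm_num

open Classical in
/-- Brownian motion, as a function of the white noise: it is obtained from the Brownian bridge
`b` on `[0, 1]` as `(1 + t) b (t / (1 + t))`. -/
noncomputable def brownian (t : ℝ≥0) (x : NoiseIndex → ℝ) : ℝ :=
  if x ∈ tameNoise then (1 + t) * ∑' n, bridgeLevel x n (t / (1 + t)) else 0

/-- The Weierstrass test on `tameNoise`, and the zero path elsewhere. Continuity for every `x`, not
only almost every one, later gives genuine measurability of the noise integrals in small σ-algebras.
-/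
lemma continuous_brownian (x : NoiseIndex → ℝ) : Continuous fun t => brownian t x := by
  by_cases hx : x ∈ tameNoise
  · simp only [brownian, if_pos hx]
    obtain ⟨C, hC⟩ := hx
    have h1 : Continuous fun t : ℝ => ∑' n, bridgeLevel x n t := by
      refine continuous_tsum (fun n => ?_) (summable_bridgeBound C)
        fun n t => norm_bridgeLevel_le hC n t
      exact continuous_finsetSum _ fun k _ => (continuous_schauder _).mul continuous_const
    have h2 : Continuous fun t : ℝ≥0 => (t : ℝ) / (1 + t) :=
      NNReal.continuous_coe.div (by fun_prop) fun t => by positivity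
    have h3 := h1.comp h2
    exact (by fun_prop : Continuous fun t : ℝ≥0 => 1 + (t : ℝ)).mul h3
  · simp only [brownian, if_neg hx]
    exact continuous_const

lemma brownian_zero (x : NoiseIndex → ℝ) : brownian 0 x = 0 := by
  have h : ∀ n, bridgeLevel x n 0 = 0 := fun n => Finset.sum_eq_zero fun k _ => by
    rw [schauder, mul_zero, tent_of_nonpos (by simp), mul_zero, zero_mul]
  simp [brownian, h]

lemma tendsto_bridgeSum {x : NoiseIndex → ℝ} (hx : x ∈ tameNoise) (t : ℝ≥0) :
    Tendsto (fun N => (1 + t) * bridgeSum N (t / (1 + t)) x) atTop (𝓝 (brownian t x)) := by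
  simp only [brownian, if_pos hx, bridgeSum_eq_sum]
  obtain ⟨C, hC⟩ := hx
  have h1 : Summable fun n => bridgeLevel x n ((t : ℝ) / (1 + t)) :=
    Summable.of_norm_bounded (summable_bridgeBound C) fun n => norm_bridgeLevel_le hC n _
  exact (h1.hasSum.tendsto_sum_nat).const_mul _

lemma measurable_brownian (t : ℝ≥0) : Measurable (brownian t) := by
  refine measurable_of_tendsto_metrizable (f := fun N => tameNoise.indicator
    fun x => (1 + (t : ℝ)) * bridgeSum N (t / (1 + t)) x) (fun N => ?_) ?_
  · refine Measurable.indicator ?_ measurableSet_tameNoise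
    unfold bridgeSum
    fun_prop
  · rw [tendsto_pi_nhds]
    intro x
    by_cases hx : x ∈ tameNoise
    · simpa [hx] using tendsto_bridgeSum hx t
    · simp [hx, brownian]

/-- Brownian motion exists. -/
theorem isBrownianReal_brownian : IsBrownianReal brownian whiteNoise := by
  set X : ℕ → ℝ≥0 → (NoiseIndex → ℝ) → ℝ := fun N t x =>
    ∑ p ∈ bridgeIndex N, ((1 + t) * schauder p (t / (1 + t))) * x p with hX
  have hXb : ∀ N t x, X N t x = (1 + t) * bridgeSum N (t / (1 + t)) x := fun N t x => by
    simp only [hX, bridgeSum, Finset.mul_sum, mul_assoc]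
  have hlim : ∀ t, ∀ᵐ x ∂whiteNoise, Tendsto (fun N => X N t x) atTop (𝓝 (brownian t x)) := by
    intro t
    filter_upwards [ae_mem_tameNoise] with x hx
    simp_rw [hXb]
    exact tendsto_bridgeSum hx t
  have hG : ∀ N, IsGaussianProcess (X N) whiteNoise := fun N =>
    isGaussianProcess_whiteNoise.of_isGaussianProcess fun t => by
      refine ⟨bridgeIndex N, ∑ p : bridgeIndex N, ((1 + t) * schauder p (t / (1 + t)) : ℝ) •
        ContinuousLinearMap.proj (R := ℝ) (φ := fun _ : bridgeIndex N => ℝ) p, fun x => ?_⟩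
      simp only [hX, sum_apply, smul_apply,
        ContinuousLinearMap.proj_apply, Finset.restrict, smul_eq_mul]
      exact (Finset.sum_coe_sort (bridgeIndex N)
        fun p => ((1 + t) * schauder p (t / (1 + t)) : ℝ) * x p).symm
  have h0 : ∀ N t, ∫ x, X N t x ∂whiteNoise = 0 := fun N t => by
    simp only [hX]
    rw [integral_finsetSum _ fun p _ =>
      ((memLp_whiteNoise p).integrable one_le_two).const_mul _]
    refine Finset.sum_eq_zero fun p _ => ?_
    rw [integral_const_mul, (hasLaw_whiteNoise p).integral_eq, integral_id_gaussianReal, mul_zero]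
  obtain ⟨h1, h2, h3⟩ := isGaussianProcess_of_tendsto_ae hG h0 hlim
  refine ⟨h1.isPreBrownianReal_of_covariance h2 fun s t hst => ?_,
    ae_of_all _ continuous_brownian⟩
  refine tendsto_nhds_unique (h3 s t) ?_
  have h4 : ∀ N, cov[X N s, X N t; whiteNoise] =
      (1 + s) * (1 + t) * bridgeCov N (s / (1 + s)) (t / (1 + t)) := fun N => by
    rw [covariance_sum_whiteNoise, ← sum_schauder_mul_schauder, Finset.mul_sum]
    exact Finset.sum_congr rfl fun p _ => by ring
  simp_rw [h4]
  have hst' : (s : ℝ) ≤ t := hst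
  have h5 := tendsto_bridgeCov (s := s / (1 + s)) (t := t / (1 + t)) (by positivity)
    (by rw [div_le_div_iff₀ (by positivity) (by positivity)]; linarith)
    (by rw [div_le_one (by positivity)]; linarith)
  -- The bridge covariance at `s/(1+s)` and `t/(1+t)` is `s/((1+s)(1+t))`; the factors `1+s` and
  -- `1+t` turn it into `s`, which is `min s t`.
  have h6 : (s : ℝ) = (1 + s) * (1 + t) * (s / (1 + s) - s / (1 + s) * (t / (1 + t))) := by
    field_simp
    ring
  rw [h6]
  exact (h5.const_mul _).congr fun N => by rw [← h6]

end BrownianMotion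

/-! ### Riemann sums of continuous paths. -/

section RiemannSum

lemma tendsto_riemannSum {w : ℝ → ℝ} (hw : Continuous w) {T : ℝ} (hT : 0 < T) :
    Tendsto (fun k : ℕ => T / (k + 1) * ∑ j ∈ Finset.range (k + 1), w (j * (T / (k + 1)))) atTop
      (𝓝 (∫ s in (0 : ℝ)..T, w s)) := by
  have huc := isCompact_Icc.uniformContinuousOn_of_continuous (hw.continuousOn (s := Set.Icc 0 T))
  rw [Metric.uniformContinuousOn_iff] at huc
  rw [Metric.tendsto_atTop]
  intro ε hε
  obtain ⟨δ, hδ, h⟩ := huc (ε / (2 * T)) (by positivity)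
  obtain ⟨N, hN⟩ := exists_nat_gt (T / δ)
  refine ⟨N, fun k hk => ?_⟩
  set d := T / ((k : ℝ) + 1) with hd
  have hk0 : (0 : ℝ) < k + 1 := by positivity
  have hd0 : 0 < d := by positivity
  have hdk : (k + 1) * d = T := by rw [hd]; field_simp
  have hdδ : d < δ := by
    rw [hd, div_lt_iff₀ hk0]
    rw [div_lt_iff₀ hδ] at hN
    have : (N : ℝ) ≤ k := by exact_mod_cast hk
    nlinarith
  have h1 : ∫ s in (0 : ℝ)..T, w s =
      ∑ j ∈ Finset.range (k + 1), ∫ s in (j * d)..((j + 1 : ℕ) * d), w s := by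
    have := intervalIntegral.sum_integral_adjacent_intervals (f := w) (μ := volume)
      (a := fun j : ℕ => (j : ℝ) * d) (n := k + 1)
      fun j _ => hw.intervalIntegrable _ _
    rw [this]
    push_cast
    rw [hdk, zero_mul]
  rw [dist_comm, Real.dist_eq, h1, Finset.mul_sum, ← Finset.sum_sub_distrib]
  have h2 : ∀ j ∈ Finset.range (k + 1), |(∫ s in (j * d)..((j + 1 : ℕ) * d), w s) - d * w (j * d)| ≤
      ε / (2 * T) * d := by
    intro j hj
    have hjd : ((j + 1 : ℕ) : ℝ) * d = j * d + d := by push_cast; ring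
    have hj1 : (j : ℝ) + 1 ≤ k + 1 := by exact_mod_cast Finset.mem_range.1 hj
    have hj0 : 0 ≤ (j : ℝ) * d := by positivity
    have hjT : (j : ℝ) * d + d ≤ T := by nlinarith
    have h3 : d * w (j * d) = ∫ s in (j * d)..(j * d + d), w (j * d) := by
      rw [intervalIntegral.integral_const, smul_eq_mul]; ring
    rw [hjd, h3, ← intervalIntegral.integral_sub (hw.intervalIntegrable _ _)
      intervalIntegrable_const, ← Real.norm_eq_abs]
    refine (intervalIntegral.norm_integral_le_of_norm_le_const (C := ε / (2 * T))
      fun s hs => ?_).trans (le_of_eq ?_)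
    · rw [Set.uIoc_of_le (by linarith)] at hs
      refine (h s ⟨by linarith [hs.1], by linarith [hs.2]⟩ (j * d) ⟨hj0, by linarith⟩ ?_).le
      rw [Real.dist_eq, abs_lt]
      constructor <;> linarith [hs.1, hs.2]
    · rw [add_sub_cancel_left, abs_of_pos hd0]
  calc |∑ j ∈ Finset.range (k + 1), ((∫ s in (j * d)..((j + 1 : ℕ) * d), w s) - d * w (j * d))|
      ≤ ∑ j ∈ Finset.range (k + 1), ε / (2 * T) * d :=
        (Finset.abs_sum_le_sum_abs _ _).trans (Finset.sum_le_sum h2)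
    _ = ε / 2 := by
        rw [Finset.sum_const, Finset.card_range, nsmul_eq_mul]
        push_cast
        rw [mul_left_comm, hdk]
        field_simp
    _ < ε := by linarith

end RiemannSum

/-! ### Gaussian vectors, and Gaussianity of the period noise. -/

section GaussianProcess

variable {Ω ι κ : Type*} [MeasurableSpace Ω] {P : Measure Ω}

lemma isGaussianProcess_of_eq_sum {X : ι → Ω → ℝ} (hX : IsGaussianProcess X P) {Y : κ → Ω → ℝ}
    (h : ∀ s, ∃ (I : Finset ι) (c : ι → ℝ), ∀ ω, Y s ω = ∑ p ∈ I, c p * X p ω) :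
    IsGaussianProcess Y P :=
  hX.of_isGaussianProcess fun s => by
    obtain ⟨I, c, hc⟩ := h s
    refine ⟨I, ∑ p : I, c p • ContinuousLinearMap.proj (R := ℝ) (φ := fun _ : I => ℝ) p,
      fun ω => ?_⟩
    simp only [hc, sum_apply, smul_apply, ContinuousLinearMap.proj_apply, Finset.restrict,
      smul_eq_mul]
    exact (Finset.sum_coe_sort I fun p => c p * X p ω).symm

lemma hasGaussianLaw_pi_of_isGaussianProcess [Finite κ] {X : κ → Ω → ℝ}
    (hX : IsGaussianProcess X P) : HasGaussianLaw (fun ω i => X i ω) P := by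
  have := Fintype.ofFinite κ
  exact (hX.hasGaussianLaw Finset.univ).map_fun (ContinuousLinearMap.pi fun i : κ =>
    ContinuousLinearMap.proj (R := ℝ) (φ := fun _ : (Finset.univ : Finset κ) => ℝ)
      ⟨i, Finset.mem_univ i⟩)

/-- Two centered Gaussian vectors with the same covariances have the same law. -/
lemma map_eq_map_of_hasGaussianLaw [IsProbabilityMeasure P] [Fintype κ] {X Y : κ → Ω → ℝ}
    (hX : HasGaussianLaw (fun ω i => X i ω) P) (hY : HasGaussianLaw (fun ω i => Y i ω) P)
    (hX0 : ∀ i, ∫ ω, X i ω ∂P = 0) (hY0 : ∀ i, ∫ ω, Y i ω ∂P = 0)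
    (hXY : ∀ i j, ∫ ω, X i ω * X j ω ∂P = ∫ ω, Y i ω * Y j ω ∂P) :
    P.map (fun ω i => X i ω) = P.map (fun ω i => Y i ω) := by
  classical
  have := hX.isGaussian_map
  have := hY.isGaussian_map
  -- The characteristic function of a Gaussian law depends only on the mean and variance of each
  -- linear functional, and these are expressed by the second moments.
  have key : ∀ (Z : κ → Ω → ℝ), HasGaussianLaw (fun ω i => Z i ω) P → (∀ i, ∫ ω, Z i ω ∂P = 0) →
      ∀ L : (κ → ℝ) →L[ℝ] ℝ, (∫ x, L x ∂(P.map fun ω i => Z i ω) = 0) ∧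
      Var[L; P.map fun ω i => Z i ω] = ∑ i, ∑ j, L (fun k => if i = k then 1 else 0) *
        L (fun k => if j = k then 1 else 0) * ∫ ω, Z i ω * Z j ω ∂P := by
    intro Z hZ hZ0 L
    have hL : ∀ x : κ → ℝ, L x = ∑ i, L (fun k => if i = k then 1 else 0) * x i := fun x => by
      have := LinearMap.pi_apply_eq_sum_univ (L : (κ → ℝ) →ₗ[ℝ] ℝ) x
      simpa [mul_comm] using this
    have h2 : ∀ i, MemLp (Z i) 2 P := fun i => (hZ.eval i).memLp_two
    have h0 : ∫ ω, L (fun i => Z i ω) ∂P = 0 := by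
      simp_rw [hL (fun i => Z i _)]
      rw [integral_finsetSum _ fun i _ => ((h2 i).integrable one_le_two).const_mul _]
      simp [integral_const_mul, hZ0]
    have h1 : ∫ x, L x ∂(P.map fun ω i => Z i ω) = 0 := by
      rw [integral_map hZ.aemeasurable L.continuous.aestronglyMeasurable, h0]
    refine ⟨h1, ?_⟩
    rw [variance_of_integral_eq_zero L.continuous.aemeasurable h1,
      integral_map hZ.aemeasurable (by fun_prop)]
    simp only [hL (fun i => Z i _), sq, Finset.sum_mul_sum]
    have h3 : ∀ i j, Integrable (fun ω => L (fun k => if i = k then 1 else 0) * Z i ω *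
        (L (fun k => if j = k then 1 else 0) * Z j ω)) P := fun i j =>
      ((h2 i).const_mul _).integrable_mul ((h2 j).const_mul _)
    rw [integral_finsetSum _ fun i _ => integrable_finsetSum _ fun j _ => h3 i j]
    refine Finset.sum_congr rfl fun i _ => ?_
    rw [integral_finsetSum _ fun j _ => h3 i j]
    refine Finset.sum_congr rfl fun j _ => ?_
    rw [← integral_const_mul]
    exact integral_congr_ae (ae_of_all _ fun ω => by ring)
  refine Measure.ext_of_charFunDual (funext fun L => ?_)
  rw [IsGaussian.charFunDual_eq, IsGaussian.charFunDual_eq, integral_complex_ofReal,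
    integral_complex_ofReal, (key X hX hX0 L).1, (key Y hY hY0 L).1, (key X hX hX0 L).2,
    (key Y hY hY0 L).2]
  simp_rw [hXY]

/-- Replacing the integral by Riemann sums leaves finite combinations of values of `W`, which are
Gaussian and converge along continuous paths. The variance is read off from the second moment
already computed. -/
lemma hasLaw_periodNoise [IsProbabilityMeasure P] {w : ℝ≥0 → Ω → ℝ} (hw : IsBrownianReal w P)
    (hm : ∀ t, Measurable (w t)) {T D ζ : ℝ} (hT : 0 < T) :
    HasLaw (periodNoise T D ζ w)
      (gaussianReal 0 (D ^ 2 * T / 3 * (1 + ζ + ζ ^ 2)).toNNReal) P := by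
  -- Index `0` carries the endpoint term `D W_T`, index `j + 1` the `j`-th node of the Riemann sum.
  set t : ℕ → ℕ → ℝ≥0 := fun k i => Nat.casesOn i T.toNNReal
    fun j => ((j : ℝ) * (T / (k + 1))).toNNReal with ht
  set c : ℕ → ℕ → ℝ := fun k i => Nat.casesOn i D
    fun _ => -((1 - ζ) * (D / T)) * (T / (k + 1)) with hc
  set X : ℕ → Ω → ℝ := fun k ω => ∑ i ∈ Finset.range (k + 2), c k i * w (t k i) ω with hX
  have hG : ∀ k, HasGaussianLaw (X k) P := fun k =>
    ((hw.isGaussianProcess.comp_right (t k)).smul (c k)).hasGaussianLaw_fun_sum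
  have h0 : ∀ k, ∫ ω, X k ω ∂P = 0 := fun k => by
    simp only [hX]
    rw [integral_finsetSum _ fun i _ => (hw.integrable_eval _).const_mul _]
    simp [integral_const_mul, hw.integral_eval]
  have hlim : ∀ᵐ ω ∂P, Tendsto (fun k => X k ω) atTop (𝓝 (periodNoise T D ζ w ω)) := by
    filter_upwards [hw.cont] with ω hω
    have h1 := (tendsto_riemannSum (w := fun s => w s.toNNReal ω) (by fun_prop) hT).const_mul
      (-((1 - ζ) * (D / T)))
    have h2 := h1.const_add (D * w T.toNNReal ω)
    have h3 : D * w T.toNNReal ω + -((1 - ζ) * (D / T)) * ∫ s in (0 : ℝ)..T, w s.toNNReal ω =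
        periodNoise T D ζ w ω := by
      rw [periodNoise, noiseIntegral]
      ring
    rw [h3] at h2
    refine h2.congr fun k => ?_
    simp only [hX]
    rw [← mul_assoc, Finset.mul_sum, add_comm]
    exact (Finset.sum_range_succ' (fun i => c k i * w (t k i) ω) (k + 1)).symm
  obtain ⟨v, hv, -⟩ := exists_hasLaw_gaussianReal_of_tendsto_ae
    (fun k => hasLaw_gaussianReal_of_integral_eq_zero (hG k) (h0 k)) hlim
  have h1 := integral_sq_of_hasLaw_gaussianReal hv
  rw [integral_sq_periodNoise hw hm hT] at h1
  rwa [h1, Real.toNNReal_coe]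

end GaussianProcess

/-! ### Stationarity from covariances. -/

section Stationary

variable {Ω : Type*} [MeasurableSpace Ω] {P : Measure Ω} [IsProbabilityMeasure P]
  {F T D ζ : ℝ} {hF : 0 < F}
  {y : ℝ → Ω → ℝ} {W : ℕ → ℝ≥0 → Ω → ℝ} {α : ℕ → Ω → ℝ}

/-- The innovations of period `n + k` are orthogonal to `y_n`, so each further period multiplies the
correlation by `ζ`. -/
lemma IsClockState.integral_syncError_mul (h : IsClockState (gaussianClock hF ζ) T D P y W α)
    (hT : 0 < T) (hY : ∀ n, MemLp (syncError T y n) 2 P) (n k : ℕ) :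
    ∫ ω, syncError T y n ω * syncError T y (n + k) ω ∂P =
      ζ ^ k * ∫ ω, syncError T y n ω ^ 2 ∂P := by
  induction k with
  | zero => simp [sq]
  | succ k ih =>
    obtain ⟨ν, hν⟩ := h.exists_isOutcomeError hT
    have hZ : AEStronglyMeasurable[pastSigma T (y 0) W α (n + k)] (syncError T y n) P :=
      (h.aestronglyMeasurable_syncError hT n).mono (pastSigma_mono (n.le_add_right k))
    have hN := memLp_periodNoise (D := D) (ζ := ζ) (h.isBrownian (n + k))
      (h.measurable_noise (n + k)) hT
    have e1 := h.integral_mul_noise hZ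
      (aestronglyMeasurable_periodNoise (D := D) (ζ := ζ) h.isBrownian hT (n + k))
      (integral_periodNoise (h.isBrownian (n + k)) (h.measurable_noise (n + k)) hT)
    have e2 := h.integral_mul_outcomeError hν (n + k) (hZ.mono le_sup_left)
    have i1 : Integrable (fun ω => ζ * (syncError T y n ω * syncError T y (n + k) ω)) P :=
      ((hY n).integrable_mul (hY (n + k))).const_mul ζ
    have i2 : Integrable (fun ω => syncError T y n ω * periodNoise T D ζ (W (n + k)) ω) P :=
      (hY n).integrable_mul hN
    have i3 : Integrable (fun ω => -(1 - ζ) * (syncError T y n ω * ν (n + k) ω)) P :=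
      ((hY n).integrable_mul (hν.memLp (n + k))).const_mul _
    have i12 : Integrable (fun ω => ζ * (syncError T y n ω * syncError T y (n + k) ω) +
        syncError T y n ω * periodNoise T D ζ (W (n + k)) ω) P := i1.add i2
    have h1 : (fun ω => syncError T y n ω * syncError T y (n + k + 1) ω) =ᵐ[P] fun ω =>
        ζ * (syncError T y n ω * syncError T y (n + k) ω) +
        syncError T y n ω * periodNoise T D ζ (W (n + k)) ω +
        -(1 - ζ) * (syncError T y n ω * ν (n + k) ω) := by
      filter_upwards [h.syncError_succ_ae_eq_add hT hν (n + k)] with ω hω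
      rw [hω]
      ring
    rw [← add_assoc, integral_congr_ae h1, integral_add i12 i3, integral_add i1 i2,
      integral_const_mul, integral_const_mul, e1, e2, ih]
    ring

/-- A state whose errors form a centered Gaussian process, the initial one having the stationary
variance, is a stationary state. -/
lemma IsClockState.isGaussianStationaryState
    (h : IsClockState (gaussianClock hF ζ) T D P y W α) (hT : 0 < T) (hζ : |ζ| < 1)
    (hG : IsGaussianProcess (syncError T y) P) (h0 : ∫ ω, syncError T y 0 ω ∂P = 0)
    (h2 : ∫ ω, syncError T y 0 ω ^ 2 ∂P = (1 - ζ) / (1 + ζ) * (1 / F) +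
      D ^ 2 * T / 3 * ((1 + ζ + ζ ^ 2) / (1 - ζ ^ 2))) :
    IsGaussianStationaryState (gaussianClock hF ζ) T D P y W α := by
  refine ⟨h, fun j n k => ?_, hG⟩
  have hY : ∀ n, MemLp (syncError T y n) 2 P := fun n => (hG.hasGaussianLaw_eval n).memLp_two
  have hmean : ∀ n, ∫ ω, syncError T y n ω ∂P = 0 := fun n => by
    induction n with
    | zero => exact h0
    | succ n ih => rw [h.integral_syncError_succ hT hY, ih, mul_zero]
  have p1 : 1 - ζ ≠ 0 := by linarith [(abs_lt.1 hζ).2]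
  have p2 : 1 + ζ ≠ 0 := by linarith [(abs_lt.1 hζ).1]
  have p3 : 1 - ζ ^ 2 = (1 - ζ) * (1 + ζ) := by ring
  have hvar : ∀ n, ∫ ω, syncError T y n ω ^ 2 ∂P = ∫ ω, syncError T y 0 ω ^ 2 ∂P := fun n => by
    induction n with
    | zero => rfl
    | succ n ih =>
      rw [h.integral_sq_syncError_succ hT hY, ih, h2, p3]
      field_simp
      ring
  -- With constant variance the covariance depends on the lag alone, and a centered Gaussian vector
  -- is determined by its covariances.
  have hcov : ∀ a b d : ℕ, ∫ ω, syncError T y (a + d) ω * syncError T y (b + d) ω ∂P =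
      ∫ ω, syncError T y a ω * syncError T y b ω ∂P := by
    have hle : ∀ a b d : ℕ, a ≤ b → ∫ ω, syncError T y (a + d) ω * syncError T y (b + d) ω ∂P =
        ∫ ω, syncError T y a ω * syncError T y b ω ∂P := by
      intro a b d hab
      obtain ⟨k, rfl⟩ := Nat.exists_eq_add_of_le hab
      rw [add_right_comm, h.integral_syncError_mul hT hY, h.integral_syncError_mul hT hY,
        hvar, hvar a]
    intro a b d
    rcases le_total a b with hab | hab
    · exact hle a b d hab
    · simp_rw [mul_comm (syncError T y (a + d) _), mul_comm (syncError T y a _)]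
      exact hle b a d hab
  have g1 := hasGaussianLaw_pi_of_isGaussianProcess (hG.comp_right fun i => n i + k)
  have g2 := hasGaussianLaw_pi_of_isGaussianProcess (hG.comp_right n)
  exact ⟨g1.aemeasurable, g2.aemeasurable, map_eq_map_of_hasGaussianLaw g1 g2
    (fun i => hmean _) (fun i => hmean _) fun i j => hcov _ _ _⟩

end Stationary

/-! ### The conditional law of a variable with independent Gaussian error. -/

section CondLaw

variable {Ω : Type*} {m m0 : MeasurableSpace Ω} {P : Measure Ω}

/-- If `X` is determined by `m` and the error `ξ` is Gaussian with variance `v` and independent of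
`m`, then, given `m`, the sum `X + ξ` is Gaussian with mean `X` and variance `v`. -/
lemma condExp_eq_gaussianReal_of_indep [IsProbabilityMeasure P] (hm : m ≤ m0) {X ξ : Ω → ℝ}
    (hX : Measurable[m] X) (hξ : Measurable ξ)
    (hi : Indep m (MeasurableSpace.comap ξ inferInstance) P) {v : ℝ≥0}
    (hl : HasLaw ξ (gaussianReal 0 v) P) {A : Set ℝ} (hA : MeasurableSet A) :
    P⟦(fun ω => X ω + ξ ω) ⁻¹' A | m⟧ =ᵐ[P] fun ω => (gaussianReal (X ω) v).real A := by
  have hX0 : Measurable X := hX.mono hm le_rfl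
  have hg : Measurable fun x => gaussianReal x v A :=
    (Measure.measurable_coe hA).comp (measurable_gaussianReal.comp (measurable_id.prodMk
      measurable_const))
  have key : ∀ B : Set Ω, MeasurableSet[m] B →
      P (B ∩ (fun ω => X ω + ξ ω) ⁻¹' A) = ∫⁻ ω in B, gaussianReal (X ω) v A ∂P := by
    intro B hB
    have e1 : (P.restrict B).map (fun ω => (X ω, ξ ω)) =
        ((P.restrict B).map X).prod (gaussianReal 0 v) := by
      refine Measure.ext_prod fun {s t} hs ht => ?_
      rw [Measure.prod_prod, Measure.map_apply (hX0.prodMk hξ) (hs.prod ht),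
        Measure.map_apply hX0 hs, Measure.restrict_apply (hX0 hs),
        Measure.restrict_apply ((hX0.prodMk hξ) (hs.prod ht)), ← hl.map_eq,
        Measure.map_apply hξ ht, ← (Indep_iff _ _ P).1 hi _ _ ((hX hs).inter hB) ⟨t, ht, rfl⟩]
      congr 1
      ext ω
      simp
      tauto
    have hS : MeasurableSet ((fun p : ℝ × ℝ => p.1 + p.2) ⁻¹' A) := by measurability
    have e2 := congrArg (fun μ => μ ((fun p : ℝ × ℝ => p.1 + p.2) ⁻¹' A)) e1
    rw [Measure.map_apply (hX0.prodMk hξ) hS,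
      Measure.restrict_apply ((hX0.prodMk hξ) hS), Measure.prod_apply hS] at e2
    have e3 : ∀ x, gaussianReal 0 v (Prod.mk x ⁻¹' ((fun p : ℝ × ℝ => p.1 + p.2) ⁻¹' A)) =
        gaussianReal x v A := fun x => by
      have := gaussianReal_map_const_add (μ := 0) (v := v) x
      rw [zero_add] at this
      rw [← this, Measure.map_apply (by fun_prop) hA]
      rfl
    simp_rw [e3] at e2
    rw [lintegral_map hg hX0] at e2
    rw [Set.inter_comm, ← e2]
    rfl
  have hgm : Measurable[m] fun ω => (gaussianReal (X ω) v).real A :=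
    (ENNReal.measurable_toReal.comp hg).comp hX
  have hA' : MeasurableSet ((fun ω => X ω + ξ ω) ⁻¹' A) := (hX0.add hξ) hA
  have hint : Integrable (fun ω => (gaussianReal (X ω) v).real A) P :=
    Integrable.of_bound (hgm.mono hm le_rfl).aestronglyMeasurable 1 (ae_of_all _ fun ω => by
      rw [Real.norm_of_nonneg measureReal_nonneg]
      exact measureReal_le_one)
  refine (ae_eq_condExp_of_forall_setIntegral_eq hm ((integrable_const (1 : ℝ)).indicator hA')
    (fun B _ _ => hint.integrableOn) (fun B hB _ => ?_)
    hgm.stronglyMeasurable.aestronglyMeasurable).symm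
  rw [integral_indicator_const _ hA', smul_eq_mul, mul_one, measureReal_restrict_apply hA',
    Set.inter_comm, measureReal_def, key B hB]
  exact integral_toReal (hg.comp hX0).aemeasurable (ae_of_all _ fun ω => measure_lt_top _ _)

end CondLaw

/-! ### Brownian motions pulled back to other spaces, and strict measurability. -/

section Transfer

variable {Ω Ω' : Type*} [MeasurableSpace Ω] [MeasurableSpace Ω'] {P : Measure Ω} {P' : Measure Ω'}

lemma isBrownianReal_comp_of_measurePreserving {W : ℝ≥0 → Ω → ℝ} (hW : IsBrownianReal W P)
    {f : Ω' → Ω} (hf : MeasurePreserving f P' P) : IsBrownianReal (fun t ω => W t (f ω)) P' where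
  hasLaw I := (hW.hasLaw I).comp hf.hasLaw
  cont := hf.quasiMeasurePreserving.ae hW.cont

lemma measurable_noiseIntegral {W : ℝ≥0 → Ω → ℝ} (hc : ∀ ω, Continuous (W · ω))
    {r : ℝ} (hm : ∀ t : ℝ≥0, (t : ℝ) ≤ r → Measurable (W t)) (hr : 0 ≤ r) :
    Measurable (noiseIntegral W r) := by
  obtain ⟨X, hX, hXW⟩ := exists_measurable_uncurry_version hm hr
  have h : noiseIntegral W r = fun ω => ∫ s in Set.Ioc 0 r, X s ω := by
    ext ω
    rw [noiseIntegral, intervalIntegral.integral_of_le hr]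
    exact setIntegral_congr_fun measurableSet_Ioc fun s hs =>
      (hXW ω (hc ω) s ⟨hs.1.le, hs.2⟩).symm
  rw [h]
  exact (stronglyMeasurable_setIntegral hX _).measurable

end Transfer

/-! ### A stationary state on a product of white noises. -/

section Model

/-- The law of a sequence of independent copies of the white noise. -/
noncomputable def noiseLaw : Measure (ℕ → NoiseIndex → ℝ) :=
  Measure.infinitePi fun _ => whiteNoise

instance : IsProbabilityMeasure noiseLaw := by
  unfold noiseLaw
  infer_instance

lemma measurePreserving_eval_noiseLaw (i : ℕ) :
    MeasurePreserving (fun ω : ℕ → NoiseIndex → ℝ => ω i) noiseLaw whiteNoise :=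
  measurePreserving_eval_infinitePi (fun _ => whiteNoise) i

/-- The information contained in the coordinates in `S`. -/
@[reducible] def coordSigma (S : Set ℕ) : MeasurableSpace (ℕ → NoiseIndex → ℝ) :=
  ⨆ i ∈ S, MeasurableSpace.comap (fun ω => ω i) inferInstance

lemma indep_coordSigma {S S' : Set ℕ} (h : Disjoint S S') :
    Indep (coordSigma S) (coordSigma S') noiseLaw :=
  indep_iSup_of_disjoint (fun i => (measurable_pi_apply i).comap_le)
    (iIndepFun_infinitePi (P := fun _ : ℕ => whiteNoise) (X := fun _ x => x)
      fun _ => measurable_id) h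

lemma measurable_coordSigma {S : Set ℕ} {i : ℕ} (hi : i ∈ S) {β : Type*} [MeasurableSpace β]
    {g : (NoiseIndex → ℝ) → β} (hg : Measurable g) :
    Measurable[coordSigma S] fun ω => g (ω i) :=
  hg.comp (Measurable.mono (comap_measurable _) (le_iSup₂_of_le i hi le_rfl) le_rfl)

/-- The Brownian motion which drives the local oscillator in the `n`-th period. -/
noncomputable def modelNoise (n : ℕ) (t : ℝ≥0) (ω : ℕ → NoiseIndex → ℝ) : ℝ :=
  brownian t (ω (2 * n + 1))

/-- The error of the measurement at the end of the `n`-th period. -/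
noncomputable def modelMeasurementError (F : ℝ) (n : ℕ) (ω : ℕ → NoiseIndex → ℝ) : ℝ :=
  √(1 / F) * ω (2 * n + 2) ⟨0, 0⟩

/-- The errors just after the synchronizations, with an initial error of variance `v`. -/
noncomputable def modelError (F T D ζ v : ℝ) : ℕ → (ℕ → NoiseIndex → ℝ) → ℝ
  | 0, ω => √v * ω 0 ⟨0, 0⟩
  | n + 1, ω => modelError F T D ζ v n ω + D * modelNoise n T.toNNReal ω - (1 - ζ) *
      (modelError F T D ζ v n ω + D / T * noiseIntegral (modelNoise n) T ω +
        modelMeasurementError F n ω)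

/-- The outcome of the measurement at the end of the `n`-th period. -/
noncomputable def modelOutcome (F T D ζ v : ℝ) (n : ℕ) (ω : ℕ → NoiseIndex → ℝ) : ℝ :=
  modelError F T D ζ v n ω + D / T * noiseIntegral (modelNoise n) T ω +
    modelMeasurementError F n ω

/-- A state of the Gaussian clock. -/
noncomputable def modelState (F T D ζ v t : ℝ) (ω : ℕ → NoiseIndex → ℝ) : ℝ :=
  modelError F T D ζ v ⌊t / T⌋₊ ω +
    D * modelNoise ⌊t / T⌋₊ (t - ⌊t / T⌋₊ * T).toNNReal ω

variable {F T D ζ v : ℝ}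

lemma modelError_succ (n : ℕ) (ω : ℕ → NoiseIndex → ℝ) :
    modelError F T D ζ v (n + 1) ω = modelError F T D ζ v n ω + D * modelNoise n T.toNNReal ω -
      (1 - ζ) * modelOutcome F T D ζ v n ω := rfl

lemma modelError_succ' (n : ℕ) (ω : ℕ → NoiseIndex → ℝ) :
    modelError F T D ζ v (n + 1) ω = ζ * modelError F T D ζ v n ω +
      periodNoise T D ζ brownian (ω (2 * n + 1)) -
      (1 - ζ) * √(1 / F) * ω (2 * n + 2) ⟨0, 0⟩ := by
  have h : noiseIntegral (modelNoise n) T ω = noiseIntegral brownian T (ω (2 * n + 1)) := rfl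
  rw [modelError_succ, modelOutcome, modelMeasurementError, modelNoise, periodNoise, h]
  ring

lemma isBrownianReal_modelNoise (n : ℕ) : IsBrownianReal (modelNoise n) noiseLaw :=
  isBrownianReal_comp_of_measurePreserving isBrownianReal_brownian
    (measurePreserving_eval_noiseLaw (2 * n + 1))

lemma continuous_modelNoise (n : ℕ) (ω : ℕ → NoiseIndex → ℝ) :
    Continuous (modelNoise n · ω) := continuous_brownian _

lemma modelState_mul_add (hT : 0 < T) (n : ℕ) {t : ℝ≥0} (ht : (t : ℝ) < T)
    (ω : ℕ → NoiseIndex → ℝ) :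
    modelState F T D ζ v (n * T + t) ω = modelError F T D ζ v n ω + D * modelNoise n t ω := by
  have h : ⌊(n * T + t) / T⌋₊ = n := by
    rw [Nat.floor_eq_iff (by positivity), le_div_iff₀ hT, div_lt_iff₀ hT]
    have := t.2
    constructor <;> linarith
  rw [modelState, h, add_sub_cancel_left, Real.toNNReal_coe]

lemma modelState_mul (hT : 0 < T) (n : ℕ) :
    modelState F T D ζ v (n * T) = modelError F T D ζ v n := by
  ext ω
  have h := modelState_mul_add (F := F) (D := D) (ζ := ζ) (v := v) hT n (t := 0) (by simpa) ω
  simpa [modelNoise, brownian_zero] using h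

lemma modelState_zero (hT : 0 < T) : modelState F T D ζ v 0 = modelError F T D ζ v 0 := by
  simpa using modelState_mul (F := F) (D := D) (ζ := ζ) (v := v) hT 0

lemma syncError_modelState (hT : 0 < T) :
    syncError T (modelState F T D ζ v) = modelError F T D ζ v :=
  funext fun n => modelState_mul hT n

lemma avgError_modelState (hT : 0 < T) (n : ℕ) (ω : ℕ → NoiseIndex → ℝ) :
    avgError T (modelState F T D ζ v) n ω =
      modelError F T D ζ v n ω + D / T * noiseIntegral (modelNoise n) T ω := by
  have h := (integral_path_eq (T := T) (r := T) (c := n * T) (D := D)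
    (f := fun s => modelState F T D ζ v s ω)
    (continuous_modelNoise n ω) hT.le le_rfl fun t ht => by
      simp only [modelState_mul_add hT n ht, modelState_mul hT]).2
  rw [avgError, intervalIntegral.integral_comp_add_left (fun s => modelState F T D ζ v s ω),
    add_zero, h, modelState_mul hT, noiseIntegral]
  field_simp

lemma measurable_modelNoise {S : Set ℕ} {n : ℕ} (h : 2 * n + 1 ∈ S) (t : ℝ≥0) :
    Measurable[coordSigma S] (modelNoise n t) :=
  measurable_coordSigma h (measurable_brownian t)

lemma measurable_modelOutcome_of_modelError {m : MeasurableSpace (ℕ → NoiseIndex → ℝ)} {n : ℕ}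
    (hT : 0 < T) (h : Measurable[m] (modelError F T D ζ v n))
    (hm : ∀ S ⊆ ({2 * n + 1, 2 * n + 2} : Set ℕ), coordSigma S ≤ m) :
    Measurable[m] (modelOutcome F T D ζ v n) := by
  have h1 : Measurable[m] (noiseIntegral (modelNoise n) T) :=
    @measurable_noiseIntegral _ m _ (continuous_modelNoise n) _ (fun t _ =>
      (measurable_modelNoise (S := {2 * n + 1}) rfl t).mono (hm _ (by simp)) le_rfl) hT.le
  have h2 : Measurable[m] (modelMeasurementError F n) :=
    (measurable_coordSigma (S := {2 * n + 2}) rfl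
      ((measurable_pi_apply (⟨0, 0⟩ : NoiseIndex)).const_mul √(1 / F))).mono
      (hm _ (by simp)) le_rfl
  exact (h.add (h1.const_mul (D / T))).add h2

/-- Coordinate `0` carries the initial error, `2n + 1` the oscillator noise and `2n + 2` the
measurement error of period `n`; hence the `n`-th error uses no coordinate beyond `2n`. -/
lemma measurable_modelError (hT : 0 < T) {n k : ℕ} (h : 2 * n < k) :
    Measurable[coordSigma (Set.Iio k)] (modelError F T D ζ v n) := by
  induction n with
  | zero =>
    exact measurable_coordSigma (S := Set.Iio k) (i := 0) h
      ((measurable_pi_apply (⟨0, 0⟩ : NoiseIndex)).const_mul √v)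
  | succ n ih =>
    have h0 := ih (by omega)
    have h1 : Measurable[coordSigma (Set.Iio k)] (modelOutcome F T D ζ v n) :=
      measurable_modelOutcome_of_modelError hT h0 fun S hS => biSup_mono fun i hi => by
        rcases hS hi with rfl | rfl <;> simp only [Set.mem_Iio] <;> omega
    have h2 := measurable_modelNoise (S := Set.Iio k) (n := n)
      (by simp only [Set.mem_Iio]; omega) T.toNNReal
    exact (h0.add (h2.const_mul D)).sub (h1.const_mul (1 - ζ))

lemma measurable_modelOutcome (hT : 0 < T) {n k : ℕ} (h : 2 * n + 2 < k) :
    Measurable[coordSigma (Set.Iio k)] (modelOutcome F T D ζ v n) :=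
  measurable_modelOutcome_of_modelError hT (measurable_modelError hT (by omega))
    fun S hS => biSup_mono fun i hi => by
      rcases hS hi with rfl | rfl <;> simp only [Set.mem_Iio] <;> omega

lemma coordSigma_le (S : Set ℕ) : coordSigma S ≤ MeasurableSpace.pi :=
  iSup₂_le fun i _ => (measurable_pi_apply i).comap_le

lemma noiseSigma_modelNoise_le {S : Set ℕ} {n : ℕ} (h : 2 * n + 1 ∈ S) :
    noiseSigma T modelNoise n ≤ coordSigma S :=
  iSup₂_le fun t _ => (measurable_modelNoise h t).comap_le

lemma pastSigma_model_le (hT : 0 < T) (n : ℕ) :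
    pastSigma T (modelError F T D ζ v 0) modelNoise (modelOutcome F T D ζ v) n ≤
      coordSigma (Set.Iio (2 * n + 1)) :=
  sup_le (measurable_modelError hT (by omega)).comap_le (iSup₂_le fun k hk => sup_le
    (noiseSigma_modelNoise_le (by simp only [Set.mem_Iio]; omega))
    (measurable_modelOutcome hT (by omega)).comap_le)

/-- Independence may be checked on the larger `coordSigma`, but the conditional law of the outcome
is relative to the past σ-algebra itself, so the error must be measurable for that one. -/
lemma measurable_modelError_pastSigma (hT : 0 < T) (n : ℕ) :
    Measurable[pastSigma T (modelError F T D ζ v 0) modelNoise (modelOutcome F T D ζ v) n]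
      (modelError F T D ζ v n) := by
  induction n with
  | zero => exact Measurable.mono (comap_measurable _) le_sup_left le_rfl
  | succ n ih =>
    have h0 := ih.mono (pastSigma_mono n.le_succ) le_rfl
    have h1 := (comap_measurable (modelOutcome F T D ζ v n)).mono
      (comap_outcome_le_pastSigma (T := T) (y₀ := modelError F T D ζ v 0) (W := modelNoise)
        n.lt_succ_self) le_rfl
    have h2 := (measurable_noiseSigma (W := modelNoise) n (t := T.toNNReal)
      (Real.coe_toNNReal T hT.le).le).mono (noiseSigma_le_pastSigma
      (y₀ := modelError F T D ζ v 0) (α := modelOutcome F T D ζ v) n.lt_succ_self) le_rfl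
    exact (h0.add (h2.const_mul D)).sub (h1.const_mul (1 - ζ))

lemma hasLaw_modelMeasurementError (hF : 0 < F) (n : ℕ) :
    HasLaw (modelMeasurementError F n) (gaussianReal 0 (1 / F).toNNReal) noiseLaw := by
  have h1 := (hasLaw_whiteNoise ⟨0, 0⟩).comp
    (measurePreserving_eval_noiseLaw (2 * n + 2)).hasLaw
  have h2 := gaussianReal_const_mul h1 √(1 / F)
  rw [mul_zero, mul_one] at h2
  have h3 : (1 / F).toNNReal = NNReal.mk (√(1 / F) ^ 2) (sq_nonneg _) := by
    ext
    rw [Real.coe_toNNReal _ (by positivity), NNReal.coe_mk, Real.sq_sqrt (by positivity)]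
  rw [h3]
  exact h2

/-- The past and the current noise live on the coordinates below `2n + 2`, and the measurement error
on coordinate `2n + 2` alone. -/
lemma condExp_modelOutcome (hF : 0 < F) (hT : 0 < T) (n : ℕ) {A : Set ℝ}
    (hA : MeasurableSet A) :
    noiseLaw⟦modelOutcome F T D ζ v n ⁻¹' A |
      pastSigma T (modelError F T D ζ v 0) modelNoise (modelOutcome F T D ζ v) n ⊔
        noiseSigma T modelNoise n⟧ =ᵐ[noiseLaw] fun ω =>
      (gaussianReal (modelError F T D ζ v n ω + D / T * noiseIntegral (modelNoise n) T ω)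
        (1 / F).toNNReal).real A := by
  have h0 := (measurable_modelError_pastSigma (F := F) (D := D) (ζ := ζ) (v := v) hT n).mono
    (le_sup_left (b := noiseSigma T modelNoise n)) le_rfl
  have h1 := @measurable_noiseIntegral _ (noiseSigma T modelNoise n) _
    (continuous_modelNoise n) T (fun t ht => measurable_noiseSigma n ht) hT.le
  have h2 := h0.add ((h1.mono le_sup_right le_rfl).const_mul (D / T))
  have h3 : pastSigma T (modelError F T D ζ v 0) modelNoise (modelOutcome F T D ζ v) n ⊔
      noiseSigma T modelNoise n ≤ coordSigma (Set.Iio (2 * n + 2)) :=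
    sup_le ((pastSigma_model_le hT n).trans (biSup_mono fun i hi => by
      simp only [Set.mem_Iio] at hi ⊢; omega)) (noiseSigma_modelNoise_le (by simp))
  have h4 : Measurable[coordSigma {2 * n + 2}] (modelMeasurementError F n) :=
    measurable_coordSigma (S := {2 * n + 2}) rfl
      ((measurable_pi_apply (⟨0, 0⟩ : NoiseIndex)).const_mul √(1 / F))
  exact condExp_eq_gaussianReal_of_indep (h3.trans (coordSigma_le _)) h2
    (h4.mono (coordSigma_le _) le_rfl)
    (indep_of_indep_of_le (indep_coordSigma (by simp)) h3 h4.comap_le)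
    (hasLaw_modelMeasurementError hF n) hA

theorem isClockState_model (hF : 0 < F) (hT : 0 < T) :
    IsClockState (gaussianClock hF ζ) T D noiseLaw (modelState F T D ζ v) modelNoise
      (modelOutcome F T D ζ v) where
  measurable_init := by
    rw [modelState_zero hT]
    exact (measurable_modelError hT (k := 1) (by omega)).mono (coordSigma_le _) le_rfl
  measurable_noise n t :=
    (measurable_modelNoise (S := Set.univ) trivial t).mono (coordSigma_le _) le_rfl
  measurable_outcome n :=
    (measurable_modelOutcome hT (2 * n + 2).lt_succ_self).mono (coordSigma_le _) le_rfl
  isBrownian := isBrownianReal_modelNoise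
  indep_noise n := by
    rw [modelState_zero hT]
    exact indep_of_indep_of_le (indep_coordSigma (S := Set.Iio (2 * n + 1)) (S' := {2 * n + 1})
      (by simp)) (pastSigma_model_le hT n) (noiseSigma_modelNoise_le rfl)
  evolution := ae_of_all _ fun ω n t ht => by
    rw [modelState_mul_add hT n ht, modelState_mul hT]
  adjustment := ae_of_all _ fun ω n => by
    rw [modelState_mul hT, modelState_mul hT, modelError_succ]
    rfl
  outcome_law n A hA := by
    rw [modelState_zero hT]
    simp_rw [avgError_modelState hT, outcomeProb_gaussianClock hF ζ _ hA]
    exact condExp_modelOutcome hF hT n hA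

/-- The independent Gaussian random variables of which the errors are linear combinations. -/
noncomputable def modelComponent (T D ζ : ℝ) (i : ℕ) (x : NoiseIndex → ℝ) : ℝ :=
  if i % 2 = 1 then periodNoise T D ζ brownian x else x ⟨0, 0⟩

/-- Unrolling the recursion: odd coordinates enter through their period noise, even ones through a
standard Gaussian. Joint Gaussianity of the errors follows from independence of these components. -/
lemma exists_modelError_eq_sum (n : ℕ) : ∃ c : ℕ → ℝ, ∀ ω, modelError F T D ζ v n ω =
    ∑ i ∈ Finset.range (2 * n + 1), c i * modelComponent T D ζ i (ω i) := by
  induction n with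
  | zero => exact ⟨fun _ => √v, fun ω => by simp [modelError, modelComponent]⟩
  | succ n ih =>
    obtain ⟨c, hc⟩ := ih
    refine ⟨fun i => if i < 2 * n + 1 then ζ * c i else if i = 2 * n + 1 then 1 else
      -((1 - ζ) * √(1 / F)), fun ω => ?_⟩
    rw [modelError_succ', hc, show 2 * (n + 1) + 1 = 2 * n + 1 + 1 + 1 by ring,
      Finset.mul_sum, Finset.sum_range_succ _ (2 * n + 1 + 1), Finset.sum_range_succ _ (2 * n + 1)]
    have e1 : (2 * n + 1) % 2 = 1 := by omega
    have e2 : (2 * n + 1 + 1) % 2 ≠ 1 := by omega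
    have e3 : ∀ i ∈ Finset.range (2 * n + 1), ζ * (c i * modelComponent T D ζ i (ω i)) =
        (if i < 2 * n + 1 then ζ * c i else if i = 2 * n + 1 then 1 else
          -((1 - ζ) * √(1 / F))) * modelComponent T D ζ i (ω i) := fun i hi => by
      rw [if_pos (Finset.mem_range.1 hi), mul_assoc]
    rw [Finset.sum_congr rfl e3, modelComponent.eq_def T D ζ (2 * n + 1),
      modelComponent.eq_def T D ζ (2 * n + 1 + 1), if_pos e1, if_neg e2]
    simp
    ring

lemma isGaussianProcess_modelError (hT : 0 < T) :
    IsGaussianProcess (modelError F T D ζ v) noiseLaw := by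
  have hm : ∀ i, Measurable (modelComponent T D ζ i) := fun i => by
    unfold modelComponent
    split_ifs
    · exact ((measurable_brownian _).const_mul _).sub ((measurable_noiseIntegral
        continuous_brownian (fun t _ => measurable_brownian t) hT.le).const_mul _)
    · exact measurable_pi_apply _
  have hi : iIndepFun (fun (i : ℕ) ω => modelComponent T D ζ i (ω i)) noiseLaw :=
    iIndepFun_infinitePi (P := fun _ : ℕ => whiteNoise) hm
  have hG : ∀ i, HasGaussianLaw (fun ω => modelComponent T D ζ i (ω i)) noiseLaw := fun i => by
    have h1 : ∃ u, HasLaw (modelComponent T D ζ i) (gaussianReal 0 u) whiteNoise := by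
      unfold modelComponent
      split_ifs
      · exact ⟨_, hasLaw_periodNoise isBrownianReal_brownian measurable_brownian hT⟩
      · exact ⟨_, hasLaw_whiteNoise _⟩
    obtain ⟨u, hu⟩ := h1
    exact (hu.comp (measurePreserving_eval_noiseLaw i).hasLaw).hasGaussianLaw
  have hX : IsGaussianProcess (fun (i : ℕ) ω => modelComponent T D ζ i (ω i)) noiseLaw :=
    ⟨fun I => (hi.precomp (Subtype.val_injective (p := (· ∈ I)))).hasGaussianLaw fun p => hG p⟩
  exact isGaussianProcess_of_eq_sum hX fun n =>
    let ⟨c, hc⟩ := exists_modelError_eq_sum n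
    ⟨_, c, hc⟩

theorem isGaussianStationaryState_model (hF : 0 < F) (hT : 0 < T) (hζ : |ζ| < 1)
    (hv : v = (1 - ζ) / (1 + ζ) * (1 / F) +
      D ^ 2 * T / 3 * ((1 + ζ + ζ ^ 2) / (1 - ζ ^ 2))) :
    IsGaussianStationaryState (gaussianClock hF ζ) T D noiseLaw (modelState F T D ζ v) modelNoise
      (modelOutcome F T D ζ v) := by
  have hl := (hasLaw_whiteNoise ⟨0, 0⟩).comp (measurePreserving_eval_noiseLaw 0).hasLaw
  have hv0 : 0 ≤ v := by
    obtain ⟨h1, h2⟩ := abs_lt.1 hζ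
    have h3 : 0 < 1 - ζ ^ 2 := by nlinarith
    have h4 : 0 < 1 + ζ + ζ ^ 2 := by nlinarith
    have h5 : 0 < 1 - ζ := by linarith
    have h6 : 0 < 1 + ζ := by linarith
    rw [hv]
    positivity
  refine (isClockState_model hF hT).isGaussianStationaryState hT hζ ?_ ?_ ?_
  · rw [syncError_modelState hT]
    exact isGaussianProcess_modelError hT
  · have h1 := hl.integral_eq
    rw [integral_id_gaussianReal] at h1
    simp only [Function.comp_def] at h1
    simp only [syncError_modelState hT, modelError, integral_const_mul, h1, mul_zero]
  · have h1 := integral_sq_of_hasLaw_gaussianReal hl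
    simp only [Function.comp_def, NNReal.coe_one] at h1
    simp only [syncError_modelState hT, modelError, mul_pow, integral_const_mul, h1, mul_one,
      Real.sq_sqrt hv0]
    exact hv

end Model

end AtomicClock

theorem mainTheorem7 (F T D ζ : ℝ) (hF : 0 < F) (hT : 0 < T) (hζ : |ζ| < 1) :
    -- the strategy is `ζ`-biased and the family of states has Fisher information `F`
    (AtomicClock.gaussianClock hF ζ).IsBiased ζ ∧
    (∀ φ : ℝ, AtomicClock.IsQuantumFisherInformation
      (AtomicClock.gaussianClock hF ζ).state φ F) ∧
    -- the clock has a Gaussian stationary state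
    (∃ (Ω : Type) (_ : MeasurableSpace Ω) (P : Measure Ω) (y : ℝ → Ω → ℝ)
      (W : ℕ → ℝ≥0 → Ω → ℝ) (α : ℕ → Ω → ℝ), IsProbabilityMeasure P ∧
      AtomicClock.IsGaussianStationaryState (AtomicClock.gaussianClock hF ζ) T D P y W α) ∧
    -- every Gaussian stationary state has the stated properties
    (∀ (Ω : Type*) (_ : MeasurableSpace Ω) (P : Measure Ω) (y : ℝ → Ω → ℝ)
      (W : ℕ → ℝ≥0 → Ω → ℝ) (α : ℕ → Ω → ℝ), IsProbabilityMeasure P →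
      AtomicClock.IsGaussianStationaryState (AtomicClock.gaussianClock hF ζ) T D P y W α →
      ∀ n : ℕ,
        AtomicClock.loVariance P T y n = D ^ 2 * T / 3 ∧
        -- mean and variance of the stationary state
        ∫ ω, AtomicClock.syncError T y n ω ∂P = 0 ∧
        Var[AtomicClock.syncError T y n; P] = (1 - ζ) / (1 + ζ) * (1 / F) +
          AtomicClock.loVariance P T y n * ((1 + ζ + ζ ^ 2) / (1 - ζ ^ 2)) ∧
        -- variance of the clock time
        Tendsto (fun t : ℝ => (∫ ω, AtomicClock.clockTimeError y t ω ^ 2 ∂P) / t) atTop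
          (𝓝 (T * (1 / F) + T * AtomicClock.loVariance P T y n * (3 / (1 - ζ) ^ 2))) ∧
        -- both bounds for stationary states of unbiased clocks hold with equality
        AtomicClock.IsNoiseConstants P T D y W n 1 3 ∧
        ∀ a b : ℝ, AtomicClock.IsNoiseConstants P T D y W n a b →
          (∫ ω, AtomicClock.syncError T y n ω ^ 2 ∂P =
            (∫ ω, 1 / AtomicClock.quantumFisherInformation
                (AtomicClock.gaussianClock hF ζ).state (AtomicClock.avgError T y n ω) ∂P) *
              ((1 - ζ) / (1 + ζ)) +
            AtomicClock.loVariance P T y n *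
              ((ζ ^ 2 + a * ζ + b - 1 - a) / (1 - ζ ^ 2))) ∧
          Tendsto (fun t : ℝ => (∫ ω, AtomicClock.clockTimeError y t ω ^ 2 ∂P) / t) atTop
            (𝓝 (T * (∫ ω, 1 / AtomicClock.quantumFisherInformation
                (AtomicClock.gaussianClock hF ζ).state (AtomicClock.avgError T y n ω) ∂P) +
              T * AtomicClock.loVariance P T y n * (b / (1 - ζ) ^ 2)))) := by
  refine ⟨AtomicClock.isBiased_gaussianClock hF ζ,
    AtomicClock.isQuantumFisherInformation_gaussianClock hF ζ,
    ⟨_, _, _, _, _, _, inferInstance,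
      AtomicClock.isGaussianStationaryState_model (D := D) hF hT hζ rfl⟩,
    fun Ω _ P y W α _ h n => ?_⟩
  have hlo := h.loVariance_eq hT n
  have hab := h.isNoiseConstants hT n
  have hmean := h.integral_syncError hT hζ n
  have hsq := h.integral_sq_syncError hT hζ n
  have hlim := h.tendsto_clockTimeError hT h.memLp_syncError hζ (h.integral_sq_syncError hT hζ)
  refine ⟨hlo, hmean, ?_, ?_, hab, fun a b hab' => ?_⟩
  · rw [variance_of_integral_eq_zero (h.memLp_syncError n).aestronglyMeasurable.aemeasurable hmean,
      hsq, hlo]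
  · rw [hlo]
    convert hlim using 2
    ring
  · have hQ : ∫ ω, 1 / AtomicClock.quantumFisherInformation
        (AtomicClock.gaussianClock hF ζ).state (AtomicClock.avgError T y n ω) ∂P = 1 / F := by
      simp [AtomicClock.quantumFisherInformation_gaussianClock hF ζ]
    have e1 := hab.1.symm.trans hab'.1
    have e2 := hab.2.symm.trans hab'.2
    rw [hlo] at e1 e2
    rw [hQ, hlo]
    -- When `D = 0` the constants `a` and `b` are arbitrary. Only their products with `σ²_LO` are
    -- determined, and only these enter the two formulas.
    have h1 : D ^ 2 * T / 3 * a = D ^ 2 * T / 3 := by linarith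
    have h2 : D ^ 2 * T / 3 * b = D ^ 2 * T := by linarith
    constructor
    · rw [hsq]
      -- The two numerators differ by `(1 - ζ)(a - 1) - (b - 3)`, which vanishes after
      -- multiplication by `σ²_LO`.
      linear_combination (1 - ζ ^ 2)⁻¹ * ((1 - ζ) * h1 - h2)
    · convert hlim using 2
      linear_combination T * ((1 - ζ) ^ 2)⁻¹ * h2
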